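/- Let $R,T>0$, $0<c<1$ with $cT<R$, let $\Omega=\{x\in\mathbb R^2:|x|<R\}$ and, for $t\in[0,T]$, $$\Gamma_t=\{(\sigma,0)\in\overline\Omega:\sigma\le ct\},\qquad V_t=H^1(\Omega\setminus\Gamma_t),\qquad V_t^D=\{v\in V_t: v=0\text{ on }\partial\Omega\text{ in the sense of traces}\}.$$ Let $0<\varepsilon<R-cT$ and let $\Psi\in \mathrm{Lip}([0,T]\times\overline\Omega)$ satisfy $\nabla\dot\Psi\in L^\infty((0,T)\times\Omega;\mathbb R^2)$ (distributional derivative) and $\Psi(t,x)=0$ whenever $t\in[0,T]$, $x\in\overline\Omega$, $|x-(ct,0)|<\varepsilon$. Put $S(x_1,x_2)=\operatorname{Im}\sqrt{x_1+ix_2}$ (principal branch) and $$u(t,x)=\frac{2}{\sqrt\pi}\,S\Big(\frac{x_1-ct}{\sqrt{1-c^2}},x_2\Big),\qquad f=-\operatorname{div}(\Psi^2\nabla\dot u),$$ $$u^0(x)=\frac{2}{\sqrt\pi}S\Big(\frac{x_1}{\sqrt{1-c^2}},x_2\Big),\qquad u^1(x)=-\frac{2}{\sqrt\pi}\frac{c}{\sqrt{1-c^2}}\,\partial_1S\Big(\frac{x_1}{\sqrt{1-c^2}},x_2\Big).$$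 Let $\mathcal V$ be the set of $\varphi\in L^2(0,T;V_T)$ with $\dot\varphi\in L^2(0,T;L^2(\Omega))$ and $\varphi(t)\in V_t$ for a.e. $t$; let $\mathcal V^D$ be the set of $\varphi\in\mathcal V$ with $\varphi(t)\in V_t^D$ for a.e. $t$. Then the following hold. (i) $f=-\nabla\Psi\cdot 2\Psi\nabla\dot u-\Psi^2\Delta\dot u$ a.e. and $f\in L^2(0,T;L^2(\Omega))$; $u\in\mathcal V$, its weak derivatives being the classical ones; $\dot u(t)$ and $\nabla u(t)$ are in $L^2(\Omega)$ for every $t\in[0,T]$; $\Psi\nabla\dot u\in L^2((0,T)\times\Omega;\mathbb R^2)$. Moreover $u^0\in V_0$, $u^1\in L^2(\Omega)$ and $u(0)=u^0$, $\dot u(0)=u^1$ in the sense that $$\lim_{h\to0^+}\frac1h\int_0^h\big(\|u(t)-u^0\|_{V_t}^2+\|\dot u(t)-u^1\|_{L^2(\Omega)}^2\big)\,dt=0,\qquad \|v\|_{V_t}^2=\|v\|_{L^2}^2+\|\nabla v\|_{L^2}^2 .$$ (ii) There is $w\in H^2(0,T;L^2(\Omega))\cap H^1(0,T;V_0)$ with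 $w(t)=u(t)$ on $\partial\Omega$ (traces) for every $t\in[0,T]$. (iii) $\mathcal H^1(\Gamma_t\setminus\Gamma_0)=ct$ for every $t\in[0,T]$. (iv) For every $w$ as in (ii), $u$ is a weak solution of $\ddot u-\Delta u-\operatorname{div}(\Psi^2\nabla\dot u)=f$ in $\Omega\setminus\Gamma_t$, $t\in(0,T)$, with $u=w$ on $\partial\Omega$ and homogeneous Neumann condition on $\Gamma_t$; that is, $u\in\mathcal V$, $\Psi\dot u\in L^2(0,T;V_T)$ with $\Psi(t)\dot u(t)\in V_t$ for a.e. $t$, $u-w\in\mathcal V^D$, and, with $(\cdot,\cdot)$ the scalar product of $L^2(\Omega)$, $$-\int_0^T(\dot u,\dot\varphi)\,dt+\int_0^T(\nabla u,\nabla\varphi)\,dt+\int_0^T(\nabla(\Psi\dot u),\Psi\nabla\varphi)\,dt-\int_0^T(\dot u\nabla\Psi,\Psi\nabla\varphi)\,dt=\int_0^T(f,\varphi)\,dt$$ for every $\varphi\in\mathcal V^D$ with $\varphi(0)=\varphi(T)=0$. (v) For every $w$ as in (ii), Griffith's dynamic energy--dissipation balance holds for every $t\in[0,T]$: $$\tfrac12\|\dot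 u(t)\|^2_{L^2}+\tfrac12\|\nabla u(t)\|^2_{L^2}+\int_0^t\|\Psi\nabla\dot u\|^2_{L^2}\,ds+ct=\tfrac12\|\dot u(0)\|^2_{L^2}+\tfrac12\|\nabla u(0)\|^2_{L^2}+\mathcal W_{tot}(t),$$ $$\mathcal W_{tot}(t)=\int_0^t\big[(f,\dot u-\dot w)+(\nabla u,\nabla\dot w)+(\Psi\nabla\dot u,\Psi\nabla\dot w)\big]ds-\int_0^t(\dot u,\ddot w)\,ds+(\dot u(t),\dot w(t))-(\dot u(0),\dot w(0)).$$ -/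

import Mathlib

open Set Filter Topology MeasureTheory
open scoped ContDiff NNReal ENNReal

noncomputable section

/-- The Euclidean plane `ℝ²`. -/
abbrev Plane := EuclideanSpace ℝ (Fin 2)

/-- The standard basis vector `e_i` of the plane. -/
abbrev basisVec (i : Fin 2) : Plane := EuclideanSpace.single i (1 : ℝ)

/-! ### Sobolev spaces -/

/-- `G` is the distributional gradient of `v` in the open set `U`. -/
def HasWeakGradient (U : Set Plane) (v : Plane → ℝ) (G : Plane → Plane) : Prop :=
  ∀ η : Plane → ℝ, ContDiff ℝ ∞ η → HasCompactSupport η → tsupport η ⊆ U →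
    ∀ i : Fin 2,
      ∫ x in U, v x * fderiv ℝ η x (basisVec i) = - ∫ x in U, G x i * η x

/-- `v ∈ H¹(U)`, with distributional gradient `G`. -/
structure IsSobolev (U : Set Plane) (v : Plane → ℝ) (G : Plane → Plane) : Prop where
  memLp : MemLp v 2 (volume.restrict U)
  memLp_grad : MemLp G 2 (volume.restrict U)
  weak : HasWeakGradient U v G

/-- `v ∈ H¹(Ω ∖ K)` (with gradient `G`) and `v = 0` on `∂Ω` in the sense of traces: `v` is a limit
in `H¹(Ω ∖ K)` of functions of `H¹(Ω ∖ K)` each of which vanishes in a neighbourhood of `∂Ω`. -/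
structure IsSobolevZeroTrace (Ω K : Set Plane) (v : Plane → ℝ) (G : Plane → Plane) : Prop where
  sobolev : IsSobolev (Ω \ K) v G
  approx : ∀ δ : ℝ, 0 < δ → ∃ (z : Plane → ℝ) (Z : Plane → Plane),
    IsSobolev (Ω \ K) z Z ∧
    (∃ O : Set Plane, IsOpen O ∧ frontier Ω ⊆ O ∧
      ∀ᵐ x ∂(volume.restrict (Ω \ K)), x ∈ O → z x = 0) ∧
    ∫ x in Ω \ K, ((v x - z x) ^ 2 + ‖G x - Z x‖ ^ 2) < δ

/-! ### Spaces of time-dependent functions -/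

/-- Lebesgue measure on the space-time cylinder `(0,T) × Ω`. The space `L²(0,T; L²(Ω))` is
identified with `L²((0,T) × Ω)`. -/
def cylMeasure (T : ℝ) (Ω : Set Plane) : Measure (ℝ × Plane) :=
  volume.restrict (Ioo 0 T ×ˢ Ω)

/-- `v ∈ H¹(0,T; L²(Ω))` with time derivative `v'`. The function `t ↦ v t` is the representative
in `C⁰([0,T]; L²(Ω))`, so that the values `v t` are meaningful (up to null sets in space) for
every `t ∈ [0,T]`. -/
structure IsH1Time (T : ℝ) (Ω : Set Plane) (v v' : ℝ → Plane → ℝ) : Prop where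
  memLp : MemLp (fun p : ℝ × Plane => v p.1 p.2) 2 (cylMeasure T Ω)
  memLp_deriv : MemLp (fun p : ℝ × Plane => v' p.1 p.2) 2 (cylMeasure T Ω)
  eq_integral : ∀ t ∈ Icc 0 T, ∀ᵐ x ∂(volume.restrict Ω),
    v t x = v 0 x + ∫ s in (0 : ℝ)..t, v' s x

/-- `v ∈ L²(0,T; H¹(Ω ∖ Γ_T))` and `v(t) ∈ H¹(Ω ∖ Γ_t)` for a.e. `t ∈ (0,T)`, with spatial
gradient `Dv`. -/
structure IsL2Sobolev (T : ℝ) (Ω : Set Plane) (Γ : ℝ → Set Plane)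
    (v : ℝ → Plane → ℝ) (Dv : ℝ → Plane → Plane) : Prop where
  memLp : MemLp (fun p : ℝ × Plane => v p.1 p.2) 2 (cylMeasure T Ω)
  memLp_grad : MemLp (fun p : ℝ × Plane => Dv p.1 p.2) 2 (cylMeasure T Ω)
  sobolev : ∀ᵐ t ∂(volume.restrict (Ioo 0 T)), IsSobolev (Ω \ Γ t) (v t) (Dv t)

/-- `v ∈ 𝒱`: `v ∈ L²(0,T; V_T)`, `v̇ ∈ L²(0,T; L²(Ω))` and `v(t) ∈ V_t = H¹(Ω ∖ Γ_t)` for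
a.e. `t`; here `v'` is the time derivative and `Dv` the spatial gradient. -/
structure MemV (T : ℝ) (Ω : Set Plane) (Γ : ℝ → Set Plane)
    (v v' : ℝ → Plane → ℝ) (Dv : ℝ → Plane → Plane) : Prop where
  time : IsH1Time T Ω v v'
  space : IsL2Sobolev T Ω Γ v Dv

/-- `v ∈ 𝒱ᴰ`, with Dirichlet part the whole boundary: `v ∈ 𝒱` and `v(t) = 0` on `∂Ω`
for a.e. `t`. -/
structure MemVD (T : ℝ) (Ω : Set Plane) (Γ : ℝ → Set Plane)
    (v v' : ℝ → Plane → ℝ) (Dv : ℝ → Plane → Plane) : Prop where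
  memV : MemV T Ω Γ v v' Dv
  zeroTrace : ∀ᵐ t ∂(volume.restrict (Ioo 0 T)), IsSobolevZeroTrace Ω (Γ t) (v t) (Dv t)

/-- `w ∈ H²(0,T; L²(Ω)) ∩ H¹(0,T; H¹(Ω ∖ K))`, with time derivatives `w'`, `w''` and gradients
`Dw` of `w` and `Dw'` of `w'`. -/
structure IsDirichletDatum (T : ℝ) (Ω K : Set Plane) (w w' w'' : ℝ → Plane → ℝ)
    (Dw Dw' : ℝ → Plane → Plane) : Prop where
  time : IsH1Time T Ω w w'
  time' : IsH1Time T Ω w' w''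
  space : IsL2Sobolev T Ω (fun _ => K) w Dw
  space' : IsL2Sobolev T Ω (fun _ => K) w' Dw'

/-- `v = w` on `∂Ω` for every `t ∈ [0,T]`, in the sense of traces of functions
of `H¹(Ω ∖ Γ_t)`. -/
def SameTrace (T : ℝ) (Ω : Set Plane) (Γ : ℝ → Set Plane) (v w : ℝ → Plane → ℝ) : Prop :=
  ∀ t ∈ Icc 0 T, ∃ G : Plane → Plane,
    IsSobolevZeroTrace Ω (Γ t) (fun x => v t x - w t x) G

/-! ### Weak solutions -/

/-- `u ∈ 𝒲` is a weak solution of the antiplane system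
`ü - Δu - div(Ψ² ∇u̇) = f` in `Ω ∖ Γ_t`, `t ∈ (0,T)`, with `u = w` on `∂Ω` and homogeneous Neumann
condition `∂_ν u + Ψ² ∂_ν u̇ = 0` on `Γ_t`. The function `Ψ` is supposed to be Lipschitz, so that
its classical gradient exists a.e. and is its weak gradient.

Here `u'` is the time derivative of `u`, `Du` its gradient, `DΨu'` the gradient of `Ψ u'`. -/
def IsWeakSolution (T : ℝ) (Ω : Set Plane) (Γ : ℝ → Set Plane) (Ψ f w u : ℝ → Plane → ℝ) :
    Prop :=
  ∃ (u' : ℝ → Plane → ℝ) (Du DΨu' : ℝ → Plane → Plane),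
    MemV T Ω Γ u u' Du ∧
    IsL2Sobolev T Ω Γ (fun t x => Ψ t x * u' t x) DΨu' ∧
    (∃ (v' : ℝ → Plane → ℝ) (Dv : ℝ → Plane → Plane),
      MemVD T Ω Γ (fun t x => u t x - w t x) v' Dv) ∧
    ∀ (φ φ' : ℝ → Plane → ℝ) (Dφ : ℝ → Plane → Plane), MemVD T Ω Γ φ φ' Dφ →
      (∀ᵐ x ∂(volume.restrict Ω), φ 0 x = 0) →
      (∀ᵐ x ∂(volume.restrict Ω), φ T x = 0) →
      - (∫ t in (0 : ℝ)..T, ∫ x in Ω, u' t x * φ' t x)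
        + (∫ t in (0 : ℝ)..T, ∫ x in Ω, inner ℝ (Du t x) (Dφ t x))
        + (∫ t in (0 : ℝ)..T, ∫ x in Ω, inner ℝ (DΨu' t x) (Ψ t x • Dφ t x))
        - (∫ t in (0 : ℝ)..T, ∫ x in Ω,
            inner ℝ (u' t x • gradient (Ψ t) x) (Ψ t x • Dφ t x))
      = ∫ t in (0 : ℝ)..T, ∫ x in Ω, f t x * φ t x

/-- `u(0) = u⁰` and `u̇(0) = u¹`, in the sense that `u⁰ ∈ H¹(Ω ∖ Γ_0)`, `u¹ ∈ L²(Ω)` and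
`(1/h) ∫₀ʰ (‖u(t) - u⁰‖²_{V_t} + ‖u̇(t) - u¹‖²_{L²(Ω)}) dt → 0` as `h → 0⁺`, where
`‖v‖²_{V_t} = ‖v‖²_{L²} + ‖∇v‖²_{L²}`. -/
def AttainsInitialData (T : ℝ) (Ω : Set Plane) (Γ : ℝ → Set Plane) (u : ℝ → Plane → ℝ)
    (u0 u1 : Plane → ℝ) : Prop :=
  ∃ (u' : ℝ → Plane → ℝ) (Du : ℝ → Plane → Plane) (Du0 : Plane → Plane),
    MemV T Ω Γ u u' Du ∧
    IsSobolev (Ω \ Γ 0) u0 Du0 ∧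
    MemLp u1 2 (volume.restrict Ω) ∧
    Tendsto (fun h : ℝ => h⁻¹ * ∫ t in (0 : ℝ)..h,
        ((∫ x in Ω, (u t x - u0 x) ^ 2) + (∫ x in Ω, ‖Du t x - Du0 x‖ ^ 2)
          + ∫ x in Ω, (u' t x - u1 x) ^ 2))
      (𝓝[>] 0) (𝓝 0)

/-! ### Classical derivatives -/

/-- The (classical) time derivative of `v`. -/
def timeDeriv (v : ℝ → Plane → ℝ) (t : ℝ) (x : Plane) : ℝ :=
  deriv (fun s => v s x) t

/-- The (classical) divergence of a planar vector field. -/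
def divergence (F : Plane → Plane) (x : Plane) : ℝ :=
  ∑ i : Fin 2, fderiv ℝ F x (basisVec i) i

/-! ### Energy and work -/

/-- Kinetic plus elastic energy of a state with velocity `v` and displacement gradient `G`. -/
def energy (Ω : Set Plane) (v : Plane → ℝ) (G : Plane → Plane) : ℝ :=
  1 / 2 * (∫ x in Ω, v x ^ 2) + 1 / 2 * ∫ x in Ω, ‖G x‖ ^ 2

/-- The viscous dissipation `∫₀ᵗ ‖Ψ(s) ∇u̇(s)‖²_{L²(Ω)} ds`. -/
def dissipation (Ω : Set Plane) (Ψ u : ℝ → Plane → ℝ) (t : ℝ) : ℝ :=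
  ∫ s in (0 : ℝ)..t, ∫ x in Ω, ‖Ψ s x • gradient (timeDeriv u s) x‖ ^ 2

/-- The total work `𝒲_tot(t)` of the load `f` and of the boundary datum `w` on `u`. -/
def totalWork (Ω : Set Plane) (Ψ f u w' w'' : ℝ → Plane → ℝ) (Dw' : ℝ → Plane → Plane)
    (t : ℝ) : ℝ :=
  (∫ s in (0 : ℝ)..t,
      ((∫ x in Ω, f s x * (timeDeriv u s x - w' s x))
        + (∫ x in Ω, inner ℝ (gradient (u s) x) (Dw' s x))
        + ∫ x in Ω, inner ℝ (Ψ s x • gradient (timeDeriv u s) x) (Ψ s x • Dw' s x)))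
    - (∫ s in (0 : ℝ)..t, ∫ x in Ω, timeDeriv u s x * w'' s x)
    + (∫ x in Ω, timeDeriv u t x * w' t x)
    - ∫ x in Ω, timeDeriv u 0 x * w' 0 x

/-! ### The moving crack -/

/-- The crack `Γ_t = {(σ, 0) ∈ closure Ω : σ ≤ c t}` in the disc `Ω` of radius `R`. -/
def crack (R c t : ℝ) : Set Plane :=
  {x | x ∈ Metric.closedBall 0 R ∧ x 1 = 0 ∧ x 0 ≤ c * t}

/-- `S(x₁, x₂) = Im √(x₁ + i x₂)`, with the principal branch of the square root. -/
def tipFunction (x : Plane) : ℝ :=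
  (Complex.sqrt ⟨x 0, x 1⟩).im

/-- `u(t, x) = (2/√π) S((x₁ - c t)/√(1 - c²), x₂)`. -/
def crackDisplacement (c t : ℝ) (x : Plane) : ℝ :=
  2 / √Real.pi * tipFunction !₂[(x 0 - c * t) / √(1 - c ^ 2), x 1]

/-- `u⁰(x) = (2/√π) S(x₁/√(1 - c²), x₂)`. -/
def initialDisplacement (c : ℝ) (x : Plane) : ℝ :=
  2 / √Real.pi * tipFunction !₂[x 0 / √(1 - c ^ 2), x 1]

/-- `u¹(x) = -(2/√π) (c/√(1 - c²)) ∂₁S(x₁/√(1 - c²), x₂)`. -/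
def initialVelocity (c : ℝ) (x : Plane) : ℝ :=
  -(2 / √Real.pi) * (c / √(1 - c ^ 2)) *
    fderiv ℝ tipFunction !₂[x 0 / √(1 - c ^ 2), x 1] (basisVec 0)

/-- The forcing term `f = -div(Ψ² ∇u̇)`. -/
def crackForce (c : ℝ) (Ψ : ℝ → Plane → ℝ) (t : ℝ) (x : Plane) : ℝ :=
  - divergence
    (fun y => Ψ t y ^ 2 • gradient (timeDeriv (crackDisplacement c) t) y) x

/-- The assumptions on `Ψ`: it is Lipschitz on `[0,T] × closure Ω`, the distributional derivative
`∇Ψ̇` is in `L^∞((0,T) × Ω)`, and `Ψ(t)` vanishes in the part of `closure Ω` at distance less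
than `ε` from the crack tip `(ct, 0)`, for every `t ∈ [0,T]`. -/
structure IsAdmissibleViscosity (R T c ε : ℝ) (Ψ : ℝ → Plane → ℝ) : Prop where
  lipschitz : ∃ L : ℝ≥0, LipschitzOnWith L (fun p : ℝ × Plane => Ψ p.1 p.2)
    (Icc 0 T ×ˢ Metric.closedBall 0 R)
  mixed_deriv : ∃ M : ℝ × Plane → Plane,
    MemLp M ∞ (cylMeasure T (Metric.ball 0 R)) ∧
    ∀ η : ℝ × Plane → ℝ, ContDiff ℝ ∞ η → HasCompactSupport η →
      tsupport η ⊆ Ioo 0 T ×ˢ Metric.ball 0 R → ∀ i : Fin 2,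
        ∫ p in Ioo 0 T ×ˢ Metric.ball (0 : Plane) R,
            Ψ p.1 p.2 * fderiv ℝ (fun q => fderiv ℝ η q (0, basisVec i)) p (1, 0)
          = ∫ p in Ioo 0 T ×ˢ Metric.ball (0 : Plane) R, M p i * η p
  vanishing : ∀ t ∈ Icc 0 T, ∀ x ∈ Metric.closedBall (0 : Plane) R,
    dist x !₂[c * t, 0] < ε → Ψ t x = 0

end

/-! In the variable z = (x₁ - ct)/α + i x₂ with α = √(1 - c²), the displacement is a multiple of Im
√z, a harmonic function of a Lorentz-contracted variable that travels with the crack tip. Since ∂ₜ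
acts as -c ∂₁, harmonicity in z is the wave equation in (t, x). The derivative of Im √z across the
slit is Re (1/(2√z)), which vanishes on the slit: this is the Neumann condition. The velocity is a
multiple of Im (1/(2√z)), and its derivative across the slit is a multiple of Re z^(-3/2), again
zero there. The force is by definition minus the divergence of the viscous flux, and Ψ removes the
tip, so the wave part and the viscous part of the equation balance separately.

No traces on the crack are taken. The fields are multiplied by `slitCutoff n`, a function of Re √z
that vanishes near the slit. Because Re √z and Im √z are harmonic conjugates, the cut-off gradient
remains divergence free in the z plane (`divergence_slitCutoff`), so integration by parts is exact
for every n and `wave_identity` follows by n → ∞. For the viscous flux the cutoff leaves a cross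
term. The factor n from its derivative is compensated by a factor Re √z, of order 1/n where that
derivative lives; away from the tip the cross term is therefore bounded uniformly in n
(`exists_cutoff_cross_bound`) and tends to zero pointwise, which gives `viscous_identity`. Vanishing
on ∂Ω enters only through `WeakZeroTrace`: integration by parts holds against test functions that
need not vanish at ∂Ω.

The energy balance would follow by testing with u̇ - ẇ, but ∇u̇ is of order |z|^(-3/2) and is not
square integrable. Instead w is compared with the explicit datum (1 - θ)u, where θ = 1 around all
positions of the tip. The difference ẇ - (1 - θ)u̇ is admissible in `wave_identity`, because
equality of traces at all times passes to the time derivatives (`ae_weakZeroTrace_deriv`). What is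
left is an identity for explicit functions. The part weighted by 1 - θ is differentiated in time
directly. The part weighted by θ is transported with the tip, and its flux is, pointwise, a constant
times the radial derivative of θ divided by |z|²; in polar coordinates this integrates to -c θ(tip)
(`integral_tip_flux`). The factor 2/√π makes the constant exactly one, so energy is released at the
rate c at which the crack grows. The viscous work equals the dissipation by `ae_viscous_balance`,
where integrability of ∇u̇ is enough. -/

noncomputable section

/-! ### Weak gradients and their test functions -/

theorem ae_coord_ne_zero : ∀ᵐ x : Plane, x 1 ≠ 0 := by
  have h : (volume : Measure Plane) (LinearMap.ker
      (EuclideanSpace.proj (1 : Fin 2) : Plane →L[ℝ] ℝ).toLinearMap : Set Plane) = 0 := by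
    apply Measure.addHaar_submodule
    intro h
    have : (basisVec 1) ∈ LinearMap.ker
      (EuclideanSpace.proj (1 : Fin 2) : Plane →L[ℝ] ℝ).toLinearMap := by rw [h]; trivial
    simp at this
  rw [ae_iff]
  convert h using 2
  ext x
  simp

theorem gradient_coord (f : Plane → ℝ) (x : Plane) (i : Fin 2) :
    gradient f x i = fderiv ℝ f x (basisVec i) := by
  rw [← inner_gradient_left, EuclideanSpace.inner_single_right]
  simp

/-- The product of a compactly supported function and a function which is continuous on its
support is integrable. -/
theorem integrable_mul_of_tsupport {U : Set Plane} {v g : Plane → ℝ}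
    (hU : IsOpen U) (hv : ContinuousOn v U) (hg : Continuous g) (hc : HasCompactSupport g)
    (hs : tsupport g ⊆ U) : Integrable (fun x => v x * g x) := by
  apply Continuous.integrable_of_hasCompactSupport
  · apply continuous_of_tsupport
    intro x hx
    have hx' : x ∈ U := hs (tsupport_mul_subset_right hx)
    exact (hv.continuousAt (hU.mem_nhds hx')).mul hg.continuousAt
  · exact hc.mul_left

theorem setIntegral_eq_of_tsupport {U : Set Plane} {v g : Plane → ℝ} (hs : tsupport g ⊆ U) :
    ∫ x in U, v x * g x = ∫ x, v x * g x := by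
  apply setIntegral_eq_integral_of_forall_compl_eq_zero
  intro x hx
  rw [image_eq_zero_of_notMem_tsupport (fun h => hx (hs h)), mul_zero]

/-- The classical gradient of a function of class `C¹` in an open set is its weak gradient. -/
theorem hasWeakGradient_of_contDiffOn {U : Set Plane} {v : Plane → ℝ} (hU : IsOpen U)
    (hv : ContDiffOn ℝ 1 v U) : HasWeakGradient U v (gradient v) := by
  intro η hη hc hs i
  have hdv : ContinuousOn (fun x => fderiv ℝ v x (basisVec i)) U :=
    (hv.continuousOn_fderiv_of_isOpen hU le_rfl).clm_apply continuousOn_const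
  have hdη : Continuous (fun x => fderiv ℝ η x (basisVec i)) :=
    (hη.continuous_fderiv (by simp)).clm_apply continuous_const
  have hs' := (tsupport_fderiv_apply_subset ℝ (f := η) (basisVec i)).trans hs
  rw [setIntegral_eq_of_tsupport hs', setIntegral_eq_of_tsupport hs]
  simp_rw [gradient_coord]
  -- Neither `v` nor its gradient need be integrable on `U`: each product carries `η` or its
  -- derivative, which is supported in a compact subset of `U`, where `v` is of class C¹.
  apply integral_mul_fderiv_eq_neg_fderiv_mul_of_integrable
  · exact integrable_mul_of_tsupport hU hdv hη.continuous hc hs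
  · exact integrable_mul_of_tsupport hU hv.continuousOn hdη (hc.fderiv_apply ℝ _) hs'
  · exact integrable_mul_of_tsupport hU hv.continuousOn hη.continuous hc hs
  · intro x hx
    exact ((hv x (hs hx)).contDiffAt (hU.mem_nhds (hs hx))).differentiableAt (by simp)
  · intro x _
    exact hη.differentiable (by simp) x

theorem HasWeakGradient.mono {U V : Set Plane} {v : Plane → ℝ} {G : Plane → Plane}
    (h : HasWeakGradient U v G) (hVU : V ⊆ U) : HasWeakGradient V v G := by
  intro η hη hc hs i
  have := h η hη hc (hs.trans hVU) i
  have hs' := (tsupport_fderiv_apply_subset ℝ (f := η) (basisVec i)).trans hs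
  rw [setIntegral_eq_of_tsupport (hs'.trans hVU),
    setIntegral_eq_of_tsupport (v := fun x => G x i) (hs.trans hVU)] at this
  rw [setIntegral_eq_of_tsupport hs', setIntegral_eq_of_tsupport (v := fun x => G x i) hs]
  exact this

theorem memLp_coord {μ : Measure Plane} {G : Plane → Plane} {p : ℝ≥0∞} (hG : MemLp G p μ)
    (i : Fin 2) : MemLp (fun x => G x i) p μ :=
  (EuclideanSpace.proj i : Plane →L[ℝ] ℝ).comp_memLp' hG

/-- A locally integrable function which is orthogonal to all test functions vanishes. -/
theorem ae_eq_zero_of_forall_test {U : Set Plane} (hU : IsOpen U) {g : Plane → ℝ}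
    (hg : IntegrableOn g U)
    (h : ∀ η : Plane → ℝ, ContDiff ℝ ∞ η → HasCompactSupport η → tsupport η ⊆ U →
      ∫ x in U, g x * η x = 0) :
    ∀ᵐ x ∂(volume.restrict U), g x = 0 := by
  rw [ae_restrict_iff' hU.measurableSet]
  apply hU.ae_eq_zero_of_integral_contDiff_smul_eq_zero hg.locallyIntegrableOn
  intro η hη hc hs
  rw [← h η hη hc hs, setIntegral_eq_of_tsupport hs]
  simp [mul_comm]

theorem test_mul_integrable {U : Set Plane} {g : Plane → ℝ} (hg : IntegrableOn g U)
    {η : Plane → ℝ} (hη : Continuous η) (hc : HasCompactSupport η) :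
    IntegrableOn (fun x => g x * η x) U := by
  obtain ⟨C, hC⟩ := hc.exists_bound_of_continuous hη
  exact Integrable.mul_bdd hg hη.aestronglyMeasurable (ae_of_all _ hC)

theorem test_fderiv_mul_integrable {U : Set Plane} {g : Plane → ℝ} (hg : IntegrableOn g U)
    {η : Plane → ℝ} (hη : ContDiff ℝ ∞ η) (hc : HasCompactSupport η) (e : Plane) :
    IntegrableOn (fun x => g x * fderiv ℝ η x e) U :=
  test_mul_integrable hg ((hη.continuous_fderiv (by simp)).clm_apply continuous_const)
    (hc.fderiv_apply ℝ _)

/-- Weak gradients are unique. -/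
theorem HasWeakGradient.unique {U : Set Plane} (hU : IsOpen U) {v v' : Plane → ℝ}
    {G G' : Plane → Plane} (h : HasWeakGradient U v G) (h' : HasWeakGradient U v' G')
    (hv : ∀ᵐ x ∂(volume.restrict U), v x = v' x)
    (hG : IntegrableOn G U) (hG' : IntegrableOn G' U) :
    ∀ᵐ x ∂(volume.restrict U), G x = G' x := by
  have hc : ∀ {F : Plane → Plane}, IntegrableOn F U → ∀ i, IntegrableOn (fun x => F x i) U :=
    fun hF i => (EuclideanSpace.proj i : Plane →L[ℝ] ℝ).integrable_comp hF
  have key : ∀ i, ∀ᵐ x ∂(volume.restrict U), G x i - G' x i = 0 := by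
    intro i
    apply ae_eq_zero_of_forall_test hU ((hc hG i).sub (hc hG' i))
    intro η hη hcs hs
    simp_rw [Pi.sub_apply, sub_mul]
    rw [integral_sub (test_mul_integrable (hc hG i) hη.continuous hcs)
      (test_mul_integrable (hc hG' i) hη.continuous hcs)]
    have h1 := h η hη hcs hs i
    have h2 := h' η hη hcs hs i
    have h3 : ∫ x in U, v x * fderiv ℝ η x (basisVec i)
        = ∫ x in U, v' x * fderiv ℝ η x (basisVec i) := by
      apply integral_congr_ae
      filter_upwards [hv] with x hx
      rw [hx]
    linarith
  filter_upwards [key 0, key 1] with x h0 h1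
  ext i
  fin_cases i
  · exact sub_eq_zero.1 h0
  · exact sub_eq_zero.1 h1

/-- Convolution with a bump function commutes with the line derivative of a Lipschitz function. -/
theorem fderiv_convolution_lipschitz {L : ℝ≥0} {η : Plane → ℝ} (hL : LipschitzWith L η)
    (φ : ContDiffBump (0 : Plane)) (x e : Plane) :
    fderiv ℝ (convolution (φ.normed volume) η (ContinuousLinearMap.lsmul ℝ ℝ) volume) x e
      = convolution (φ.normed volume) (fun y => lineDeriv ℝ η y e)
          (ContinuousLinearMap.lsmul ℝ ℝ) volume x := by
  set F := convolution (φ.normed volume) η (ContinuousLinearMap.lsmul ℝ ℝ) volume with hF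
  have hd : ContDiff ℝ 1 F :=
    φ.hasCompactSupport_normed.contDiff_convolution_left _ φ.contDiff_normed
      (hL.continuous.locallyIntegrable)
  rw [← (hd.differentiable (by simp) x).lineDeriv_eq_fderiv]
  apply HasDerivAt.deriv
  simp_rw [hF, convolution_def]
  have hφi : Integrable (φ.normed (volume : Measure Plane)) := φ.integrable_normed
  have hx : ∀ᵐ y : Plane, LineDifferentiableAt ℝ η (x - y) e := by
    have := hL.ae_lineDifferentiableAt (μ := volume) e
    exact (quasiMeasurePreserving_sub_left volume x).ae this
  -- Difference quotients of `η` along `e` are bounded by `L * ‖e‖`, and by Rademacher's theorem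
  -- they converge at almost every point; so differentiation under the integral needs no smoothness
  -- of `η`.
  refine (hasDerivAt_integral_of_dominated_loc_of_lip
    (bound := fun y => φ.normed volume y * (L * ‖e‖)) univ_mem ?_ ?_ ?_ ?_ ?_ ?_).2
  · refine Eventually.of_forall fun t => Continuous.aestronglyMeasurable ?_
    have := φ.continuous_normed (μ := volume)
    have := hL.continuous
    simp only [ContinuousLinearMap.lsmul_apply]
    fun_prop
  · apply Continuous.integrable_of_hasCompactSupport
    · have := φ.continuous_normed (μ := volume)
      have := hL.continuous
      simp only [ContinuousLinearMap.lsmul_apply]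
      fun_prop
    · exact φ.hasCompactSupport_normed.smul_right
  · simp only [ContinuousLinearMap.lsmul_apply]
    apply φ.continuous_normed.aestronglyMeasurable.smul
    exact ((measurable_lineDeriv hL.continuous).comp (measurable_const.sub measurable_id)).aestronglyMeasurable
  · refine ae_of_all _ fun y => ?_
    apply LipschitzWith.lipschitzOnWith
    apply LipschitzWith.of_dist_le_mul
    intro s t
    have h0 := φ.nonneg_normed (μ := volume) y
    have h1 := hL.dist_le_mul (x + s • e - y) (x + t • e - y)
    have h2 : dist (x + s • e - y) (x + t • e - y) = dist s t * ‖e‖ := by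
      rw [dist_eq_norm, dist_eq_norm, ← norm_smul]
      congr 1
      module
    rw [Real.dist_eq] at h1 ⊢
    simp only [ContinuousLinearMap.lsmul_apply, smul_eq_mul]
    rw [← mul_sub, abs_mul, abs_of_nonneg h0]
    rw [h2] at h1
    have h3 : ((Real.nnabs (φ.normed volume y * (L * ‖e‖)) : ℝ≥0) : ℝ)
        = φ.normed volume y * (L * ‖e‖) := by
      rw [Real.coe_nnabs, abs_of_nonneg (by positivity)]
    rw [h3]
    nlinarith [mul_le_mul_of_nonneg_left h1 h0]
  · exact hφi.mul_const _
  · filter_upwards [hx] with y hy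
    simp only [ContinuousLinearMap.lsmul_apply, smul_eq_mul]
    have h := hy.hasLineDerivAt
    simp only [HasLineDerivAt] at h
    have := h.const_mul (φ.normed volume y)
    refine this.congr_of_eventuallyEq (Eventually.of_forall fun t => ?_)
    simp only
    congr 2
    abel

/-- Weak derivatives may be tested against Lipschitz functions with compact support. -/
theorem integral_lipschitz_test {U : Set Plane} (hU : IsOpen U) {v g : Plane → ℝ}
    (hv : Integrable v) (hg : Integrable g) {e : Plane}
    (H : ∀ η : Plane → ℝ, ContDiff ℝ ∞ η → HasCompactSupport η → tsupport η ⊆ U →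
      ∫ x, v x * fderiv ℝ η x e = - ∫ x, g x * η x)
    {L : ℝ≥0} {η : Plane → ℝ} (hL : LipschitzWith L η) (hc : HasCompactSupport η)
    (hs : tsupport η ⊆ U) :
    ∫ x, v x * fderiv ℝ η x e = - ∫ x, g x * η x := by
  obtain ⟨δ, hδ, hδU⟩ := hc.isCompact.exists_cthickening_subset_open hU hs
  -- Outer radii below `δ` keep the mollified functions supported in `U`. The fixed ratio two of the
  -- radii is what the almost everywhere convergence of the mollified derivative asks for.
  let φ : ℕ → ContDiffBump (0 : Plane) := fun n =>
    ⟨δ / (n + 2) / 2, δ / (n + 2), by positivity, by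
      have : 0 < δ / ((n : ℝ) + 2) := by positivity
      linarith⟩
  have hφ : Tendsto (fun n => (φ n).rOut) atTop (𝓝 0) := by
    show Tendsto (fun n : ℕ => δ / ((n : ℝ) + 2)) atTop (𝓝 0)
    exact tendsto_const_nhds.div_atTop (tendsto_atTop_add_const_right _ _ tendsto_natCast_atTop_atTop)
  set ηn : ℕ → Plane → ℝ := fun n =>
    convolution ((φ n).normed volume) η (ContinuousLinearMap.lsmul ℝ ℝ) volume with hηn
  have hcn : ∀ n, HasCompactSupport (ηn n) := fun n =>
    HasCompactSupport.convolution _ (φ n).hasCompactSupport_normed hc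
  have hdn : ∀ n, ContDiff ℝ ∞ (ηn n) := fun n =>
    (φ n).hasCompactSupport_normed.contDiff_convolution_left _ (φ n).contDiff_normed
      hL.continuous.locallyIntegrable
  have hsn : ∀ n, tsupport (ηn n) ⊆ U := by
    intro n
    refine Subset.trans (closure_minimal ?_ Metric.isClosed_cthickening) hδU
    refine (support_convolution_subset _).trans ?_
    rintro _ ⟨a, ha, b, hb, rfl⟩
    rw [(φ n).support_normed_eq, mem_ball_zero_iff] at ha
    apply Metric.mem_cthickening_of_dist_le _ b _ _ (subset_closure hb)
    rw [dist_eq_norm, add_sub_cancel_right]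
    refine ha.le.trans ?_
    show δ / ((n : ℝ) + 2) ≤ δ
    apply div_le_self hδ.le
    have : (0 : ℝ) ≤ n := by positivity
    linarith
  have hLd : ∀ y, ‖lineDeriv ℝ η y e‖ ≤ L * ‖e‖ := fun y => norm_lineDeriv_le_of_lipschitz ℝ hL
  obtain ⟨M, hM⟩ := hc.exists_bound_of_continuous hL.continuous
  have hbound : ∀ (f : Plane → ℝ) (C : ℝ), (∀ y, ‖f y‖ ≤ C) → ∀ n x,
      ‖convolution ((φ n).normed volume) f (ContinuousLinearMap.lsmul ℝ ℝ) volume x‖ ≤ C := by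
    intro f C hf n x
    rw [convolution_def]
    refine (norm_integral_le_of_norm_le ((φ n).integrable_normed.mul_const C)
      (ae_of_all _ fun y => ?_)).trans ?_
    · simp only [ContinuousLinearMap.lsmul_apply, norm_smul]
      rw [Real.norm_of_nonneg ((φ n).nonneg_normed y)]
      exact mul_le_mul_of_nonneg_left (hf _) ((φ n).nonneg_normed y)
    · rw [integral_mul_const, (φ n).integral_normed, one_mul]
  have hLi : LocallyIntegrable (fun y => lineDeriv ℝ η y e) (volume : Measure Plane) :=
    hL.locallyIntegrable_lineDeriv e
  have lim1 : Tendsto (fun n => ∫ x, v x * fderiv ℝ (ηn n) x e) atTop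
      (𝓝 (∫ x, v x * fderiv ℝ η x e)) := by
    apply tendsto_integral_of_dominated_convergence (fun x => ‖v x‖ * (L * ‖e‖))
    · intro n
      exact hv.aestronglyMeasurable.mul (((hdn n).continuous_fderiv (by simp)).clm_apply
        continuous_const).aestronglyMeasurable
    · exact hv.norm.mul_const _
    · intro n
      refine ae_of_all _ fun x => ?_
      rw [norm_mul]
      apply mul_le_mul_of_nonneg_left _ (norm_nonneg _)
      rw [hηn]
      simp only
      rw [fderiv_convolution_lipschitz hL]
      exact hbound _ _ hLd n x
    -- The derivative of the mollification is the mollification of the line derivative, so it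
    -- converges almost everywhere; at points of differentiability the limit is the Fréchet
    -- derivative.
    · filter_upwards [hL.ae_differentiableAt (μ := volume),
        ContDiffBump.ae_convolution_tendsto_right_of_locallyIntegrable (K := 2) hφ
          (Eventually.of_forall fun n => by
            show δ / ((n : ℝ) + 2) ≤ 2 * (δ / (n + 2) / 2)
            linarith) hLi] with x hx hx'
      rw [← hx.lineDeriv_eq_fderiv]
      simp only [hηn, fderiv_convolution_lipschitz hL]
      exact hx'.const_mul _
  have lim2 : Tendsto (fun n => - ∫ x, g x * ηn n x) atTop (𝓝 (- ∫ x, g x * η x)) := by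
    apply Tendsto.neg
    apply tendsto_integral_of_dominated_convergence (fun x => ‖g x‖ * M)
    · intro n
      exact hg.aestronglyMeasurable.mul (hdn n).continuous.aestronglyMeasurable
    · exact hg.norm.mul_const _
    · intro n
      refine ae_of_all _ fun x => ?_
      rw [norm_mul]
      exact mul_le_mul_of_nonneg_left (hbound _ _ hM n x) (norm_nonneg _)
    · refine ae_of_all _ fun x => ?_
      exact (ContDiffBump.convolution_tendsto_right_of_continuous hφ hL.continuous x).const_mul _
  refine tendsto_nhds_unique lim1 (lim2.congr fun n => ?_)
  rw [H _ (hdn n) (hcn n) (hsn n)]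

/-! ### Zero boundary values in weak form -/

/-- `G` is the weak gradient of `v` in `Ω \ K`, tested also against functions which do not
vanish on the boundary of `Ω`: this expresses that `v = 0` on `∂Ω`. -/
def WeakZeroTrace (Ω K : Set Plane) (v : Plane → ℝ) (G : Plane → Plane) : Prop :=
  ∀ η : Plane → ℝ, ContDiff ℝ ∞ η → HasCompactSupport η → tsupport η ⊆ Kᶜ →
    ∀ i : Fin 2,
      ∫ x in Ω, v x * fderiv ℝ η x (basisVec i) = - ∫ x in Ω, G x i * η x

theorem restrict_diff_null {Ω K : Set Plane} (hK : volume K = 0) :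
    (volume : Measure Plane).restrict (Ω \ K) = volume.restrict Ω :=
  Measure.restrict_congr_set (sdiff_null_ae_eq_self hK)

theorem memLp_two_integrableOn {E : Type*} [NormedAddCommGroup E] {R : ℝ} {f : Plane → E}
    (h : MemLp f 2 (volume.restrict (Metric.ball (0 : Plane) R))) :
    IntegrableOn f (Metric.ball (0 : Plane) R) := by
  have : IsFiniteMeasure ((volume : Measure Plane).restrict (Metric.ball 0 R)) :=
    ⟨by rw [Measure.restrict_apply_univ]; exact measure_ball_lt_top⟩
  exact h.integrable (by norm_num)

/-- Multiplying `η` by a radial cutoff makes it an admissible test function in the disc. The cutoff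
can be chosen equal to one wherever `z` or its gradient is nonzero, so it does not change either
integral. -/
theorem IsSobolev.test_of_vanish {R : ℝ} (hR : 0 < R) {K : Set Plane} (hK : IsClosed K)
    {z : Plane → ℝ} {Z : Plane → Plane} (h : IsSobolev (Metric.ball 0 R \ K) z Z)
    {O : Set Plane} (hO : IsOpen O) (hfO : frontier (Metric.ball (0 : Plane) R) ⊆ O)
    (hz : ∀ᵐ x ∂(volume.restrict (Metric.ball (0 : Plane) R \ K)), x ∈ O → z x = 0)
    {η : Plane → ℝ} (hη : ContDiff ℝ ∞ η) (hc : HasCompactSupport η) (hs : tsupport η ⊆ Kᶜ)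
    (i : Fin 2) :
    ∫ x in Metric.ball (0 : Plane) R \ K, z x * fderiv ℝ η x (basisVec i)
      = - ∫ x in Metric.ball (0 : Plane) R \ K, Z x i * η x := by
  -- The part of the closed disc outside `O` is compact and misses the circle, hence it lies in a
  -- strictly smaller disc.
  have hsub : Metric.closedBall (0 : Plane) R \ O ⊆ Metric.ball 0 R := by
    rintro x ⟨hx, hxO⟩
    by_contra hx'
    apply hxO
    apply hfO
    rw [frontier_ball _ hR.ne']
    simp only [Metric.mem_ball, Metric.mem_closedBall, Metric.mem_sphere] at *
    linarith
  obtain ⟨ρ, hρR, hρ⟩ := exists_lt_subset_ball (Metric.isClosed_closedBall.sdiff hO) hsub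
  -- The smaller radius `ρ` may fail to be positive; the maximum gives a legitimate bump radius.
  set r := max ρ (R / 2) with hr
  have hrR : r < R := max_lt hρR (by linarith)
  have hr0 : 0 < r := lt_of_lt_of_le (by linarith) (le_max_right _ _)
  let κ : ContDiffBump (0 : Plane) := ⟨r, (r + R) / 2, hr0, by linarith⟩
  have hop : IsOpen (Metric.ball (0 : Plane) R \ K) := Metric.isOpen_ball.sdiff hK
  have hfin : IsFiniteMeasure ((volume : Measure Plane).restrict (Metric.ball 0 R \ K)) :=
    ⟨by simpa using lt_of_le_of_lt (measure_mono sdiff_subset) measure_ball_lt_top⟩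
  have hzρ : ∀ᵐ x ∂(volume.restrict (Metric.ball (0 : Plane) R \ K)), ρ ≤ ‖x‖ → z x = 0 := by
    filter_upwards [hz, ae_restrict_mem hop.measurableSet] with x hx hxm hxρ
    apply hx
    by_contra hxO
    have := hρ ⟨Metric.ball_subset_closedBall hxm.1, hxO⟩
    rw [mem_ball_zero_iff] at this
    linarith
  -- In the open outer ring the function is zero almost everywhere, so uniqueness of weak gradients
  -- forces its gradient to vanish there as well.
  have hZρ : ∀ᵐ x ∂(volume.restrict (Metric.ball (0 : Plane) R \ K)), ρ < ‖x‖ → Z x = 0 := by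
    set V := (Metric.ball (0 : Plane) R \ K) ∩ {x | ρ < ‖x‖} with hV
    have hVo : IsOpen V := hop.inter (isOpen_lt continuous_const continuous_norm)
    have h0 : HasWeakGradient V (fun _ => 0) (fun _ => 0) := by
      intro η _ _ _ i
      simp
    have hZi : IntegrableOn Z (Metric.ball 0 R \ K) := h.memLp_grad.integrable (by norm_num)
    have := HasWeakGradient.unique hVo (h.weak.mono inter_subset_left) h0
      (by
        have := ae_restrict_of_ae_restrict_of_subset (s := V) inter_subset_left hzρ
        filter_upwards [this, ae_restrict_mem hVo.measurableSet] with x hx hxm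
        exact hx (le_of_lt hxm.2))
      (hZi.mono_set inter_subset_left) integrableOn_zero
    rw [ae_restrict_iff' hVo.measurableSet] at this
    rw [ae_restrict_iff' hop.measurableSet]
    filter_upwards [this] with x hx hxm hxρ
    exact hx ⟨hxm, hxρ⟩
  have hκ := h.weak (fun x => κ x * η x) (κ.contDiff.mul hη) hc.mul_left (by
    intro x hx
    refine ⟨?_, hs (tsupport_mul_subset_right hx)⟩
    have : x ∈ tsupport κ := tsupport_mul_subset_left hx
    rw [κ.tsupport_eq] at this
    refine Metric.closedBall_subset_ball ?_ this
    show (r + R) / 2 < R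
    linarith) i
  have e1 : ∫ x in Metric.ball (0 : Plane) R \ K, z x * fderiv ℝ η x (basisVec i)
      = ∫ x in Metric.ball (0 : Plane) R \ K,
        z x * fderiv ℝ (fun x => κ x * η x) x (basisVec i) := by
    apply integral_congr_ae
    filter_upwards [hzρ] with x hx
    by_cases hxρ : ρ ≤ ‖x‖
    · simp [hx hxρ]
    · congr 2
      apply Filter.EventuallyEq.fderiv_eq
      have hxr : x ∈ Metric.ball (0 : Plane) r := by
        rw [mem_ball_zero_iff]
        exact lt_of_lt_of_le (not_le.1 hxρ) (le_max_left _ _)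
      filter_upwards [Metric.isOpen_ball.mem_nhds hxr] with y hy
      rw [κ.one_of_mem_closedBall (Metric.ball_subset_closedBall hy), one_mul]
  have e2 : ∫ x in Metric.ball (0 : Plane) R \ K, Z x i * η x
      = ∫ x in Metric.ball (0 : Plane) R \ K, Z x i * (κ x * η x) := by
    apply integral_congr_ae
    filter_upwards [hZρ] with x hx
    by_cases hxρ : ρ < ‖x‖
    · simp [hx hxρ]
    · rw [κ.one_of_mem_closedBall, one_mul]
      rw [mem_closedBall_zero_iff]
      exact (not_lt.1 hxρ).trans (le_max_left _ _)
  rw [e1, e2, hκ]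

/-- The defect `E` in the integration by parts formula is continuous in `v` for the H¹ norm and
vanishes on functions that are zero near the boundary, hence on their limits. Continuity is used in
quantitative form, through Young's inequality with a weight. -/
theorem IsSobolevZeroTrace.weakZeroTrace {R : ℝ} (hR : 0 < R) {K : Set Plane} (hK : IsClosed K)
    (hK0 : volume K = 0) {v : Plane → ℝ} {G : Plane → Plane}
    (h : IsSobolevZeroTrace (Metric.ball 0 R) K v G) :
    WeakZeroTrace (Metric.ball 0 R) K v G := by
  intro η hη hc hs i
  rw [← restrict_diff_null hK0]
  set μ := (volume : Measure Plane).restrict (Metric.ball 0 R \ K) with hμ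
  have hfin : IsFiniteMeasure μ :=
    ⟨by simpa [hμ] using lt_of_le_of_lt (measure_mono sdiff_subset) measure_ball_lt_top⟩
  set E := ∫ x, v x * fderiv ℝ η x (basisVec i) ∂μ + ∫ x, G x i * η x ∂μ with hE
  suffices E = 0 by linarith
  have hdc : Continuous (fun x => fderiv ℝ η x (basisVec i)) :=
    (hη.continuous_fderiv (by simp)).clm_apply continuous_const
  set A := ∫ x, ((fderiv ℝ η x (basisVec i)) ^ 2 + η x ^ 2) ∂μ with hA
  have hA0 : 0 ≤ A := integral_nonneg fun x => by positivity
  have hAi : Integrable (fun x => (fderiv ℝ η x (basisVec i)) ^ 2 + η x ^ 2) μ := by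
    apply Integrable.add
    · simp_rw [sq]
      exact test_mul_integrable (hdc.integrable_of_hasCompactSupport
        (hc.fderiv_apply ℝ _)).integrableOn hdc (hc.fderiv_apply ℝ _)
    · simp_rw [sq]
      exact test_mul_integrable (hη.continuous.integrable_of_hasCompactSupport hc).integrableOn
        hη.continuous hc
  by_contra hE0
  have hlam : 0 < |E| / (1 + A) := by positivity
  -- With this weight and an approximation error below `lam ^ 2`, Young's inequality gives |E| ≤
  -- lam/2 + lam·A/2 = |E|/2, which contradicts E ≠ 0.
  set lam := |E| / (1 + A) with hlamdef
  obtain ⟨z, Z, hz, ⟨O, hO, hfO, hzO⟩, hlt⟩ := h.approx (lam ^ 2) (by positivity)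
  have hzt := hz.test_of_vanish hR hK hO hfO hzO hη hc hs i
  rw [← hμ] at hzt hlt
  have i1 : Integrable v μ := h.sobolev.memLp.integrable (by norm_num)
  have i2 : Integrable z μ := hz.memLp.integrable (by norm_num)
  have i3 : Integrable (fun x => G x i) μ :=
    (memLp_coord h.sobolev.memLp_grad i).integrable (by norm_num)
  have i4 : Integrable (fun x => Z x i) μ := (memLp_coord hz.memLp_grad i).integrable (by norm_num)
  have j1 := test_fderiv_mul_integrable i1 hη hc (basisVec i)
  have j2 := test_fderiv_mul_integrable i2 hη hc (basisVec i)
  have j3 := test_mul_integrable i3 hη.continuous hc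
  have j4 := test_mul_integrable i4 hη.continuous hc
  have hEeq : E = ∫ x, ((v x - z x) * fderiv ℝ η x (basisVec i) + (G x i - Z x i) * η x) ∂μ := by
    have : ∀ x, (v x - z x) * fderiv ℝ η x (basisVec i) + (G x i - Z x i) * η x
        = (v x * fderiv ℝ η x (basisVec i) - z x * fderiv ℝ η x (basisVec i))
          + (G x i * η x - Z x i * η x) := fun x => by ring
    simp_rw [this]
    have k1 : Integrable (fun x => v x * fderiv ℝ η x (basisVec i)
      - z x * fderiv ℝ η x (basisVec i)) μ := j1.sub j2
    have k2 : Integrable (fun x => G x i * η x - Z x i * η x) μ := j3.sub j4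
    rw [integral_add k1 k2, integral_sub j1 j2, integral_sub j3 j4, hzt]
    ring
  have hdi : Integrable (fun x => (v x - z x) ^ 2 + ‖G x - Z x‖ ^ 2) μ :=
    (h.sobolev.memLp.sub hz.memLp).integrable_sq.add
      ((h.sobolev.memLp_grad.sub hz.memLp_grad).norm.integrable_sq)
  have hb : |E| ≤ ∫ x, (1 / 2 * (1 / lam) * ((v x - z x) ^ 2 + ‖G x - Z x‖ ^ 2)
      + 1 / 2 * lam * ((fderiv ℝ η x (basisVec i)) ^ 2 + η x ^ 2)) ∂μ := by
    rw [hEeq]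
    refine abs_integral_le_integral_abs.trans (integral_mono_of_nonneg
      (ae_of_all _ fun x => abs_nonneg _) ((hdi.const_mul _).add (hAi.const_mul _))
      (ae_of_all _ fun x => ?_))
    simp only
    have hG : (G x i - Z x i) ^ 2 ≤ ‖G x - Z x‖ ^ 2 := by
      rw [EuclideanSpace.norm_sq_eq, Fin.sum_univ_two]
      fin_cases i <;> simp [sq_nonneg]
    have young : ∀ a b : ℝ, |a * b| ≤ 1 / 2 * (1 / lam) * a ^ 2 + 1 / 2 * lam * b ^ 2 := by
      intro a b
      have h1 : 0 ≤ 1 / 2 * (1 / lam) * (|a| - lam * |b|) ^ 2 := by positivity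
      rw [abs_mul, ← sq_abs a, ← sq_abs b]
      have : 1 / 2 * (1 / lam) * (|a| - lam * |b|) ^ 2
        = 1 / 2 * (1 / lam) * |a| ^ 2 + 1 / 2 * lam * |b| ^ 2 - |a| * |b| := by
        field_simp
        ring
      linarith
    refine (abs_add_le _ _).trans ?_
    have y1 := young (v x - z x) (fderiv ℝ η x (basisVec i))
    have y2 := young (G x i - Z x i) (η x)
    have y3 : 1 / 2 * (1 / lam) * (G x i - Z x i) ^ 2 ≤ 1 / 2 * (1 / lam) * ‖G x - Z x‖ ^ 2 :=
      mul_le_mul_of_nonneg_left hG (by positivity)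
    linarith
  rw [integral_add (hdi.const_mul _) (hAi.const_mul _), integral_const_mul, integral_const_mul,
    ← hA] at hb
  have h1 : 1 / 2 * (1 / lam) * ∫ x, ((v x - z x) ^ 2 + ‖G x - Z x‖ ^ 2) ∂μ ≤ 1 / 2 * lam := by
    calc _ ≤ 1 / 2 * (1 / lam) * lam ^ 2 := mul_le_mul_of_nonneg_left hlt.le (by positivity)
      _ = 1 / 2 * lam := by field_simp
  have h2 : lam * (1 + A) = |E| := by rw [hlamdef]; field_simp
  have : |E| ≤ 1 / 2 * |E| := by nlinarith
  have : 0 < |E| := by positivity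
  linarith

theorem LipschitzWith.mul_of_hasCompactSupport {E : Type*} [PseudoMetricSpace E] {a g : E → ℝ}
    {A B : ℝ≥0} (ha : LipschitzWith A a) (hc : HasCompactSupport a) (hg : LipschitzWith B g) :
    ∃ C : ℝ≥0, LipschitzWith C (fun x => a x * g x) := by
  obtain ⟨N, hN⟩ := hc.exists_bound_of_continuous ha.continuous
  obtain ⟨M, hM⟩ := hc.isCompact.exists_bound_of_continuousOn hg.continuous.continuousOn
  have hN' : ∀ x, |a x| ≤ |N| := fun x => (hN x).trans (le_abs_self _)
  refine ⟨⟨A * |M| + |N| * B, by positivity⟩, LipschitzWith.of_dist_le_mul ?_⟩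
  -- The factor `g` is bounded only on the support of `a`. The difference is therefore expanded so
  -- that `g` stands alone only at the point known to lie in that support.
  have key : ∀ x y, x ∈ tsupport a → |a x * g x - a y * g y| ≤ (A * |M| + |N| * B) * dist x y := by
    intro x y hx
    have h1 : |g x| ≤ |M| := (hM x hx).trans (le_abs_self _)
    have h2 := ha.dist_le_mul x y
    have h3 := hg.dist_le_mul x y
    rw [Real.dist_eq] at h2 h3
    calc |a x * g x - a y * g y| = |(a x - a y) * g x + a y * (g x - g y)| := by ring_nf
      _ ≤ |a x - a y| * |g x| + |a y| * |g x - g y| := by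
        rw [← abs_mul, ← abs_mul]; exact abs_add_le _ _
      _ ≤ (A * dist x y) * |M| + |N| * (B * dist x y) := by
        exact add_le_add (mul_le_mul h2 h1 (abs_nonneg _) (by positivity))
          (mul_le_mul (hN' y) h3 (abs_nonneg _) (abs_nonneg _))
      _ = _ := by ring
  intro x y
  rw [Real.dist_eq]
  show _ ≤ (A * |M| + |N| * B) * dist x y
  by_cases hx : x ∈ tsupport a
  · exact key x y hx
  by_cases hy : y ∈ tsupport a
  · rw [abs_sub_comm, dist_comm]
    exact key y x hy
  · rw [image_eq_zero_of_notMem_tsupport hx, image_eq_zero_of_notMem_tsupport hy]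
    simp only [zero_mul, sub_self, abs_zero]
    positivity

/-- Functions with zero trace may be tested with products of a smooth function vanishing near
the crack and a Lipschitz function. -/
theorem WeakZeroTrace.test_mul {R : ℝ} (hR : 0 < R) {K : Set Plane} (hK : IsClosed K)
    {v : Plane → ℝ} {G : Plane → Plane} (h : WeakZeroTrace (Metric.ball 0 R) K v G)
    (hv : IntegrableOn v (Metric.ball 0 R)) (hG : IntegrableOn G (Metric.ball 0 R))
    {a g : Plane → ℝ} (ha : ContDiff ℝ 1 a) (hs : tsupport a ⊆ Kᶜ)
    {L : ℝ≥0} (hg : LipschitzOnWith L g (Metric.ball 0 R)) (i : Fin 2) :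
    ∫ x in Metric.ball (0 : Plane) R, v x * fderiv ℝ (fun y => a y * g y) x (basisVec i)
      = - ∫ x in Metric.ball (0 : Plane) R, G x i * (a x * g x) := by
  -- The Lipschitz factor is extended to the whole plane, and a bump equal to one on the disc
  -- supplies compact support; neither change is visible inside the disc.
  obtain ⟨g', hg', hgg'⟩ := hg.extend_real
  let κ : ContDiffBump (0 : Plane) := ⟨R, R + 1, hR, by linarith⟩
  have hκa : HasCompactSupport (fun x => κ x * a x) := κ.hasCompactSupport.mul_right
  obtain ⟨A, hA⟩ := ((κ.contDiff (n := 1)).mul ha).lipschitzWith_of_hasCompactSupport hκa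
    (by simp)
  obtain ⟨C, hC⟩ := hA.mul_of_hasCompactSupport hκa hg'
  have hsup : tsupport (fun x => κ x * a x * g' x) ⊆ Kᶜ :=
    (tsupport_mul_subset_left.trans tsupport_mul_subset_right).trans hs
  have hGi : IntegrableOn (fun x => G x i) (Metric.ball 0 R) :=
    (EuclideanSpace.proj i : Plane →L[ℝ] ℝ).integrable_comp hG
  have ind : ∀ f w : Plane → ℝ, ∫ x, (Metric.ball (0 : Plane) R).indicator f x * w x
      = ∫ x in Metric.ball (0 : Plane) R, f x * w x := by
    intro f w
    rw [← integral_indicator Metric.isOpen_ball.measurableSet]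
    congr 1
    ext x
    by_cases hx : x ∈ Metric.ball (0 : Plane) R <;> simp [hx]
  -- After extension by zero, `G` is the weak gradient of `v` in the complement of `K`: the weak
  -- zero trace says that no jump appears on the circle. Lipschitz test functions are then allowed.
  have := integral_lipschitz_test (e := basisVec i) hK.isOpen_compl
    (hv.integrable_indicator Metric.isOpen_ball.measurableSet)
    (hGi.integrable_indicator Metric.isOpen_ball.measurableSet)
    (fun η hη hc hs' => by rw [ind, ind]; exact h η hη hc hs' i) hC
    (hκa.mul_right) hsup
  rw [ind, ind] at this
  have hone : ∀ x ∈ Metric.ball (0 : Plane) R, κ x * a x * g' x = a x * g x := by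
    intro x hx
    rw [κ.one_of_mem_closedBall (Metric.ball_subset_closedBall hx), one_mul, hgg' hx]
  have e1 : ∫ x in Metric.ball (0 : Plane) R, G x i * (a x * g x)
      = ∫ x in Metric.ball (0 : Plane) R, G x i * (κ x * a x * g' x) :=
    setIntegral_congr_fun Metric.isOpen_ball.measurableSet fun x hx => by simp only [hone x hx]
  rw [e1, ← this]
  refine setIntegral_congr_fun Metric.isOpen_ball.measurableSet fun x hx => ?_
  congr 2
  apply Filter.EventuallyEq.fderiv_eq
  filter_upwards [Metric.isOpen_ball.mem_nhds hx] with y hy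
  rw [hone y hy]

theorem gradient_eq_zero_of_notMem_tsupport {v : Plane → ℝ} {x : Plane} (hx : x ∉ tsupport v) :
    gradient v x = 0 := by
  have : fderiv ℝ v x = 0 := by
    by_contra h
    exact hx (support_fderiv_subset ℝ h)
  rw [gradient, this, map_zero]

theorem setIntegral_eq_setIntegral_of_tsupport {U V : Set Plane} {f : Plane → ℝ}
    (hU : tsupport f ⊆ U) (hV : tsupport f ⊆ V) : ∫ x in U, f x = ∫ x in V, f x := by
  rw [setIntegral_eq_integral_of_forall_compl_eq_zero, setIntegral_eq_integral_of_forall_compl_eq_zero]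
  · exact fun x hx => image_eq_zero_of_notMem_tsupport fun h => hx (hV h)
  · exact fun x hx => image_eq_zero_of_notMem_tsupport fun h => hx (hU h)

/-- The support condition removes the boundary term. No integrability of the gradient is asked,
which matters for the velocity: near the tip its gradient is not square integrable. -/
theorem weakZeroTrace_of_contDiffOn {Ω K : Set Plane} (hK : IsClosed K)
    {v : Plane → ℝ} (hv : ContDiffOn ℝ 1 v Kᶜ) (hs : tsupport v ⊆ Ω) :
    WeakZeroTrace Ω K v (gradient v) := by
  intro η hη hc hηs i
  have := hasWeakGradient_of_contDiffOn hK.isOpen_compl hv η hη hc hηs i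
  have s1 : tsupport (fun x => v x * fderiv ℝ η x (basisVec i)) ⊆ tsupport v :=
    tsupport_mul_subset_left
  have s1' : tsupport (fun x => v x * fderiv ℝ η x (basisVec i)) ⊆ Kᶜ :=
    tsupport_mul_subset_right.trans ((tsupport_fderiv_apply_subset ℝ _).trans hηs)
  have s2 : tsupport (fun x => gradient v x i * η x) ⊆ tsupport v := by
    refine tsupport_mul_subset_left.trans (closure_minimal ?_ isClosed_closure)
    intro x hx
    by_contra h
    apply hx
    simp [gradient_eq_zero_of_notMem_tsupport h]
  have s2' : tsupport (fun x => gradient v x i * η x) ⊆ Kᶜ := tsupport_mul_subset_right.trans hηs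
  rw [setIntegral_eq_setIntegral_of_tsupport (s1.trans hs) s1',
    setIntegral_eq_setIntegral_of_tsupport (s2.trans hs) s2', this]

theorem IsSobolev.zeroTrace_of_tsupport {R : ℝ} (hR : 0 < R) {K : Set Plane}
    {v : Plane → ℝ} {G : Plane → Plane} (h : IsSobolev (Metric.ball 0 R \ K) v G)
    (hs : tsupport v ⊆ Metric.ball 0 R) : IsSobolevZeroTrace (Metric.ball 0 R) K v G := by
  refine ⟨h, fun δ hδ => ⟨v, G, h, ⟨(tsupport v)ᶜ, (isClosed_tsupport v).isOpen_compl, ?_, ?_⟩,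
    by simpa using hδ⟩⟩
  · rw [frontier_ball _ hR.ne']
    intro x hx hx'
    have := hs hx'
    simp only [Metric.mem_ball, Metric.mem_sphere] at *
    linarith
  · exact ae_of_all _ fun x hx => image_eq_zero_of_notMem_tsupport hx

theorem WeakZeroTrace.mono {Ω K K' : Set Plane} {v : Plane → ℝ} {G : Plane → Plane}
    (h : WeakZeroTrace Ω K v G) (hK : K ⊆ K') : WeakZeroTrace Ω K' v G :=
  fun η hη hc hs i => h η hη hc (hs.trans (compl_subset_compl.2 hK)) i

theorem WeakZeroTrace.sub {Ω K : Set Plane} {v v' : Plane → ℝ} {G G' : Plane → Plane}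
    (h : WeakZeroTrace Ω K v G) (h' : WeakZeroTrace Ω K v' G')
    (hv : IntegrableOn v Ω) (hv' : IntegrableOn v' Ω)
    (hG : IntegrableOn G Ω) (hG' : IntegrableOn G' Ω) :
    WeakZeroTrace Ω K (fun x => v x - v' x) (fun x => G x - G' x) := by
  intro η hη hc hs i
  have c1 : IntegrableOn (fun x => G x i) Ω :=
    (EuclideanSpace.proj i : Plane →L[ℝ] ℝ).integrable_comp hG
  have c2 : IntegrableOn (fun x => G' x i) Ω :=
    (EuclideanSpace.proj i : Plane →L[ℝ] ℝ).integrable_comp hG'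
  simp_rw [PiLp.sub_apply, sub_mul]
  have j1 := test_fderiv_mul_integrable hv hη hc (basisVec i)
  have j2 := test_fderiv_mul_integrable hv' hη hc (basisVec i)
  have j3 := test_mul_integrable c1 hη.continuous hc
  have j4 := test_mul_integrable c2 hη.continuous hc
  rw [integral_sub j1 j2, integral_sub j3 j4, h η hη hc hs i, h' η hη hc hs i]
  ring

theorem WeakZeroTrace.congr {Ω K : Set Plane} {v v' : Plane → ℝ} {G G' : Plane → Plane}
    (h : WeakZeroTrace Ω K v G) (hv : ∀ᵐ x ∂(volume.restrict Ω), v x = v' x)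
    (hG : ∀ᵐ x ∂(volume.restrict Ω), G x = G' x) : WeakZeroTrace Ω K v' G' := by
  intro η h1 h2 h3 i
  rw [← integral_congr_ae (hv.mono fun x hx => by simp only [hx] :
      (fun x => v x * fderiv ℝ η x (basisVec i)) =ᵐ[volume.restrict Ω] _), h η h1 h2 h3 i]
  congr 1
  exact integral_congr_ae (hG.mono fun x hx => by simp only [hx])

/-! ### The complex square root and cutoffs of the slit -/

open Complex in
theorem sqrt_mul_self (z : ℂ) : Complex.sqrt z * Complex.sqrt z = z := by
  by_cases hz : z = 0
  · simp [hz]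
  · rw [Complex.sqrt, ← cpow_add _ _ hz]; norm_num

theorem sqrt_ne_zero {z : ℂ} (hz : z ∈ Complex.slitPlane) : Complex.sqrt z ≠ 0 := by
  intro h
  have := sqrt_mul_self z
  rw [h, zero_mul] at this
  exact Complex.slitPlane_ne_zero hz this.symm

theorem norm_sqrt_sq (z : ℂ) : ‖Complex.sqrt z‖ ^ 2 = ‖z‖ := by
  rw [sq, ← norm_mul, sqrt_mul_self]

/-- The first derivative of the square root. -/
def sqrtD1 (z : ℂ) : ℂ := (2 * Complex.sqrt z)⁻¹

/-- The second derivative of the square root. -/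
def sqrtD2 (z : ℂ) : ℂ := -(4 * Complex.sqrt z ^ 3)⁻¹

/-- The third derivative of the square root. -/
def sqrtD3 (z : ℂ) : ℂ := 3 * (8 * Complex.sqrt z ^ 5)⁻¹

theorem hasDerivAt_sqrt {z : ℂ} (hz : z ∈ Complex.slitPlane) :
    HasDerivAt Complex.sqrt (sqrtD1 z) z := by
  convert Complex.hasDerivAt_sqrt hz using 1
  rw [sqrtD1, Complex.sqrt, neg_div, Complex.cpow_neg, mul_inv]
  norm_num
  ring

theorem hasDerivAt_sqrtD1 {z : ℂ} (hz : z ∈ Complex.slitPlane) :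
    HasDerivAt sqrtD1 (sqrtD2 z) z := by
  have h0 := sqrt_ne_zero hz
  have := ((hasDerivAt_sqrt hz).const_mul 2).inv (by simpa using h0)
  refine this.congr_deriv ?_
  rw [sqrtD1, sqrtD2]
  field_simp
  ring

theorem hasDerivAt_sqrtD2 {z : ℂ} (hz : z ∈ Complex.slitPlane) :
    HasDerivAt sqrtD2 (sqrtD3 z) z := by
  have h0 := sqrt_ne_zero hz
  have := ((((hasDerivAt_sqrt hz).pow 3).const_mul 4).inv (by simpa using h0)).neg
  refine this.congr_deriv ?_
  rw [sqrtD1, sqrtD3]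
  simp only [Pi.pow_apply]
  field_simp
  ring

theorem contDiffOn_slitPlane {h h' : ℂ → ℂ}
    (H : ∀ z ∈ Complex.slitPlane, HasDerivAt h (h' z) z) :
    ContDiffOn ℝ ∞ h Complex.slitPlane := by
  have : DifferentiableOn ℂ h Complex.slitPlane :=
    fun z hz => (H z hz).differentiableAt.differentiableWithinAt
  exact (this.contDiffOn Complex.isOpen_slitPlane).restrict_scalars ℝ

theorem contDiffOn_sqrt : ContDiffOn ℝ ∞ Complex.sqrt Complex.slitPlane :=
  contDiffOn_slitPlane fun _ => hasDerivAt_sqrt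

theorem contDiffOn_sqrtD1 : ContDiffOn ℝ ∞ sqrtD1 Complex.slitPlane :=
  contDiffOn_slitPlane fun _ => hasDerivAt_sqrtD1

theorem contDiffOn_sqrtD2 : ContDiffOn ℝ ∞ sqrtD2 Complex.slitPlane :=
  contDiffOn_slitPlane fun _ => hasDerivAt_sqrtD2

theorem norm_sqrtD1_sq (z : ℂ) : ‖sqrtD1 z‖ ^ 2 = 1 / 4 * ‖z‖⁻¹ := by
  rw [sqrtD1, norm_inv, norm_mul, inv_pow, mul_pow, norm_sqrt_sq]
  norm_num
  ring

theorem re_sqrt (z : ℂ) : (Complex.sqrt z).re = √((‖z‖ + z.re) / 2) := by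
  rw [Complex.sqrt_eq_real_add_ite]
  split_ifs <;> simp

theorem continuous_re_sqrt : Continuous fun z => (Complex.sqrt z).re := by
  simp_rw [re_sqrt]
  fun_prop

theorem re_sqrt_nonneg (z : ℂ) : 0 ≤ (Complex.sqrt z).re := by
  rw [re_sqrt]; positivity

/-- The function Re √z is continuous on all of ℂ, nonnegative, and zero exactly on the slit. It can
thus play the part of a distance to the slit in a cutoff, although √z itself jumps there. -/
theorem re_sqrt_pos_iff {z : ℂ} : 0 < (Complex.sqrt z).re ↔ z ∈ Complex.slitPlane := by
  rw [re_sqrt, Real.sqrt_pos, Complex.mem_slitPlane_iff]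
  have h := Complex.abs_re_le_norm z
  constructor
  · intro h0
    by_contra hn
    push Not at hn
    have : ‖z‖ = |z.re| := (Complex.abs_re_eq_norm).2 hn.2 |>.symm
    rw [this, abs_of_nonpos hn.1] at h0
    linarith
  · rintro (h0 | h0)
    · have := norm_nonneg z
      linarith
    · have := Complex.abs_re_lt_norm.2 h0
      have := neg_abs_le z.re
      linarith

/-- A smooth cutoff function vanishing near the slit. -/
def slitCutoff (n : ℕ) (z : ℂ) : ℝ := Real.smoothTransition (n * (Complex.sqrt z).re - 1)

theorem slitCutoff_nonneg (n : ℕ) (z : ℂ) : 0 ≤ slitCutoff n z := Real.smoothTransition.nonneg _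

theorem slitCutoff_le_one (n : ℕ) (z : ℂ) : slitCutoff n z ≤ 1 := Real.smoothTransition.le_one _

theorem norm_slitCutoff_le (n : ℕ) (z : ℂ) : ‖slitCutoff n z‖ ≤ 1 := by
  rw [Real.norm_of_nonneg (slitCutoff_nonneg n z)]
  exact slitCutoff_le_one n z

theorem continuous_slitCutoff (n : ℕ) : Continuous (slitCutoff n) :=
  Real.smoothTransition.continuous.comp ((continuous_const.mul continuous_re_sqrt).sub
    continuous_const)

theorem tsupport_slitCutoff_subset (n : ℕ) : tsupport (slitCutoff n) ⊆ Complex.slitPlane := by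
  have h : tsupport (slitCutoff n) ⊆ {z | 1 ≤ n * (Complex.sqrt z).re} := by
    refine closure_minimal ?_ (isClosed_le continuous_const
      (continuous_const.mul continuous_re_sqrt))
    intro z hz
    by_contra hn
    apply hz
    simp only [mem_ofPred_eq, not_le] at hn
    exact Real.smoothTransition.zero_of_nonpos (by linarith)
  intro z hz
  have h1 : 1 ≤ n * (Complex.sqrt z).re := h hz
  rw [← re_sqrt_pos_iff]
  refine lt_of_le_of_ne (re_sqrt_nonneg z) fun h0 => ?_
  rw [← h0, mul_zero] at h1
  linarith

theorem slitCutoff_eventually_one {z : ℂ} (hz : z ∈ Complex.slitPlane) :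
    ∀ᶠ n : ℕ in atTop, slitCutoff n z = 1 := by
  have h0 := re_sqrt_pos_iff.2 hz
  obtain ⟨N, hN⟩ := exists_nat_ge (2 / (Complex.sqrt z).re)
  filter_upwards [eventually_ge_atTop N] with n hn
  apply Real.smoothTransition.one_of_one_le
  have h1 : 2 / (Complex.sqrt z).re ≤ n := hN.trans (by exact_mod_cast hn)
  rw [div_le_iff₀ h0] at h1
  linarith

theorem slitCutoff_tendsto {z : ℂ} (hz : z ∈ Complex.slitPlane) :
    Tendsto (fun n => slitCutoff n z) atTop (𝓝 1) :=
  tendsto_const_nhds.congr' ((slitCutoff_eventually_one hz).mono fun _ h => h.symm)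

theorem hasFDerivAt_re_comp {h : ℂ → ℂ} {h' z : ℂ} (H : HasDerivAt h h' z) :
    HasFDerivAt (fun z => (h z).re) (Complex.reCLM.comp (h' • (1 : ℂ →L[ℝ] ℂ))) z :=
  (Complex.reCLM.hasFDerivAt).comp z H.complexToReal_fderiv

theorem hasFDerivAt_im_comp {h : ℂ → ℂ} {h' z : ℂ} (H : HasDerivAt h h' z) :
    HasFDerivAt (fun z => (h z).im) (Complex.imCLM.comp (h' • (1 : ℂ →L[ℝ] ℂ))) z :=
  (Complex.imCLM.hasFDerivAt).comp z H.complexToReal_fderiv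

theorem hasFDerivAt_slitCutoff (n : ℕ) {z : ℂ} (hz : z ∈ Complex.slitPlane) :
    HasFDerivAt (slitCutoff n)
      ((deriv Real.smoothTransition (n * (Complex.sqrt z).re - 1) * n) •
        Complex.reCLM.comp (sqrtD1 z • (1 : ℂ →L[ℝ] ℂ))) z := by
  have h1 := ((hasFDerivAt_re_comp (hasDerivAt_sqrt hz)).const_mul (n : ℝ)).sub_const 1
  have h2 : HasDerivAt Real.smoothTransition
      (deriv Real.smoothTransition (n * (Complex.sqrt z).re - 1)) (n * (Complex.sqrt z).re - 1) :=
    ((Real.smoothTransition.contDiff (n := 1)).differentiable (by simp) _).hasDerivAt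
  have := h2.comp_hasFDerivAt z h1
  exact this.congr_fderiv (smul_smul _ _ _)

/-- The closed support of the cutoff stays inside the slit plane, so whatever jump or singularity
`g` has on the slit is removed. -/
theorem contDiff_slitCutoff_mul (n : ℕ) {g : ℂ → ℝ} (hg : ContDiffOn ℝ ∞ g Complex.slitPlane) :
    ContDiff ℝ ∞ fun z => slitCutoff n z * g z := by
  rw [contDiff_iff_contDiffAt]
  intro z
  by_cases hz : z ∈ tsupport (slitCutoff n)
  · have hz' := tsupport_slitCutoff_subset n hz
    have hn := Complex.isOpen_slitPlane.mem_nhds hz'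
    refine ContDiffAt.mul ?_ (hg.contDiffAt hn)
    apply Real.smoothTransition.contDiff.contDiffAt.comp
    apply ContDiffAt.sub _ contDiffAt_const
    apply contDiffAt_const.mul
    exact Complex.reCLM.contDiff.contDiffAt.comp _ (contDiffOn_sqrt.contDiffAt hn)
  · have : (fun z => slitCutoff n z * g z) =ᶠ[𝓝 z] fun _ => 0 := by
      filter_upwards [(isClosed_tsupport (slitCutoff n)).isOpen_compl.mem_nhds hz] with y hy
      rw [image_eq_zero_of_notMem_tsupport hy, zero_mul]
    exact contDiffAt_const.congr_of_eventuallyEq this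

theorem contDiff_slitCutoff (n : ℕ) : ContDiff ℝ ∞ (slitCutoff n) := by
  simpa using contDiff_slitCutoff_mul n (contDiffOn_const (c := (1 : ℝ)))

theorem contDiff_slitCutoff_im (n : ℕ) : ContDiff ℝ ∞ fun z => slitCutoff n z * (sqrtD1 z).im :=
  contDiff_slitCutoff_mul n (Complex.imCLM.contDiff.comp_contDiffOn contDiffOn_sqrtD1)

theorem contDiff_slitCutoff_re (n : ℕ) : ContDiff ℝ ∞ fun z => slitCutoff n z * (sqrtD1 z).re :=
  contDiff_slitCutoff_mul n (Complex.reCLM.contDiff.comp_contDiffOn contDiffOn_sqrtD1)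

/-- The cut off gradient of `Im √z` is divergence free, because the cutoff is a function of the
harmonic conjugate `Re √z`. -/
theorem divergence_slitCutoff (n : ℕ) (z : ℂ) :
    fderiv ℝ (fun z => slitCutoff n z * (sqrtD1 z).im) z 1
      + fderiv ℝ (fun z => slitCutoff n z * (sqrtD1 z).re) z Complex.I = 0 := by
  by_cases hz : z ∈ tsupport (slitCutoff n)
  · have hz' := tsupport_slitCutoff_subset n hz
    have h1 := (hasFDerivAt_slitCutoff n hz').fun_mul (hasFDerivAt_im_comp (hasDerivAt_sqrtD1 hz'))
    have h2 := (hasFDerivAt_slitCutoff n hz').fun_mul (hasFDerivAt_re_comp (hasDerivAt_sqrtD1 hz'))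
    -- Write h for `sqrtD1`. The derivative of the cutoff contributes a multiple of Re h · Im h - Im
    -- h · Re h, and the derivative of h contributes Im h' - Im h' by the Cauchy–Riemann equations.
    -- Both vanish.
    rw [h1.fderiv, h2.fderiv]
    simp
    ring
  · have : ∀ g : ℂ → ℝ, fderiv ℝ (fun z => slitCutoff n z * g z) z = 0 := by
      intro g
      have : (fun z => slitCutoff n z * g z) =ᶠ[𝓝 z] fun _ => 0 := by
        filter_upwards [(isClosed_tsupport (slitCutoff n)).isOpen_compl.mem_nhds hz] with y hy
        rw [image_eq_zero_of_notMem_tsupport hy, zero_mul]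
      rw [this.fderiv_eq]
      simp
    rw [this, this]
    simp

theorem measurable_sqrt : Measurable Complex.sqrt := by
  unfold Complex.sqrt
  exact measurable_id.pow_const _

theorem measurable_sqrtD1 : Measurable sqrtD1 := (measurable_sqrt.const_mul 2).inv

theorem measurable_sqrtD2 : Measurable sqrtD2 := (((measurable_sqrt.pow_const 3).const_mul 4).inv).neg

theorem measurable_sqrtD3 : Measurable sqrtD3 := ((measurable_sqrt.pow_const 5).const_mul 8).inv.const_mul 3

theorem norm_sqrt_eq (z : ℂ) : ‖Complex.sqrt z‖ = √‖z‖ := by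
  rw [← norm_sqrt_sq z, Real.sqrt_sq (norm_nonneg _)]

theorem norm_sqrtD1_le {δ : ℝ} (hδ : 0 < δ) {z : ℂ} (hz : δ ≤ ‖z‖) :
    ‖sqrtD1 z‖ ≤ (2 * √δ)⁻¹ := by
  rw [sqrtD1, norm_inv, norm_mul, norm_sqrt_eq, Complex.norm_ofNat]
  gcongr

theorem norm_sqrtD2_le {δ : ℝ} (hδ : 0 < δ) {z : ℂ} (hz : δ ≤ ‖z‖) :
    ‖sqrtD2 z‖ ≤ (4 * √δ ^ 3)⁻¹ := by
  rw [sqrtD2, norm_neg, norm_inv, norm_mul, norm_pow, norm_sqrt_eq, Complex.norm_ofNat]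
  gcongr

theorem norm_sqrtD3_le {δ : ℝ} (hδ : 0 < δ) {z : ℂ} (hz : δ ≤ ‖z‖) :
    ‖sqrtD3 z‖ ≤ 3 * (8 * √δ ^ 5)⁻¹ := by
  rw [sqrtD3, norm_mul, norm_inv, norm_mul, norm_pow, norm_sqrt_eq, Complex.norm_ofNat,
    Complex.norm_ofNat]
  gcongr

/-! ### Coordinates centred at the moving crack tip -/

/-- The linear part of `tipCoord`. -/
def tipLin (c : ℝ) : Plane →L[ℝ] ℂ :=
  (√(1 - c ^ 2))⁻¹ • (Complex.ofRealCLM.comp (EuclideanSpace.proj (0 : Fin 2) : Plane →L[ℝ] ℝ))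
    + Complex.I • (Complex.ofRealCLM.comp (EuclideanSpace.proj (1 : Fin 2) : Plane →L[ℝ] ℝ))

/-- Lorentz-contracted coordinates centred at the crack tip. -/
def tipCoord (c t : ℝ) (x : Plane) : ℂ := ⟨(x 0 - c * t) / √(1 - c ^ 2), x 1⟩

theorem tipCoord_eq (c t : ℝ) (x : Plane) :
    tipCoord c t x = tipLin c x - (((c / √(1 - c ^ 2)) * t : ℝ) : ℂ) := by
  apply Complex.ext
  · simp [tipCoord, tipLin, -Complex.ofReal_mul, -Complex.ofReal_div]
    ring
  · simp [tipCoord, tipLin, -Complex.ofReal_mul, -Complex.ofReal_div]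

theorem tipLin_basis_zero (c : ℝ) : tipLin c (basisVec 0) = ((√(1 - c ^ 2))⁻¹ : ℝ) := by
  simp [tipLin]

theorem tipLin_basis_one (c : ℝ) : tipLin c (basisVec 1) = Complex.I := by
  simp [tipLin]

theorem contDiff_tipCoord (c : ℝ) : ContDiff ℝ ∞ fun p : ℝ × Plane => tipCoord c p.1 p.2 := by
  simp_rw [tipCoord_eq]
  apply ContDiff.sub
  · exact (tipLin c).contDiff.comp contDiff_snd
  · exact Complex.ofRealCLM.contDiff.comp (contDiff_const.mul contDiff_fst)

theorem continuous_tipCoord (c : ℝ) : Continuous fun p : ℝ × Plane => tipCoord c p.1 p.2 :=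
  (contDiff_tipCoord c).continuous

theorem contDiff_tipCoord_space (c t : ℝ) : ContDiff ℝ ∞ (tipCoord c t) :=
  (contDiff_tipCoord c).comp (contDiff_const.prodMk contDiff_id)

theorem hasFDerivAt_tipCoord (c t : ℝ) (x : Plane) : HasFDerivAt (tipCoord c t) (tipLin c) x := by
  have : tipCoord c t = fun x => tipLin c x - (((c / √(1 - c ^ 2)) * t : ℝ) : ℂ) :=
    funext (tipCoord_eq c t)
  rw [this]
  exact (tipLin c).hasFDerivAt.sub_const _

theorem hasDerivAt_tipCoord (c t : ℝ) (x : Plane) :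
    HasDerivAt (fun s => tipCoord c s x) (-((c / √(1 - c ^ 2) : ℝ) : ℂ)) t := by
  simp_rw [tipCoord_eq]
  have h : HasDerivAt (fun s : ℝ => (((c / √(1 - c ^ 2)) * s : ℝ) : ℂ))
      (((c / √(1 - c ^ 2)) * 1 : ℝ) : ℂ) t :=
    ((hasDerivAt_id t).const_mul _).ofReal_comp
  simpa using h.const_sub (tipLin c x)

theorem tipCoord_mem_slitPlane {c t : ℝ} {x : Plane} (hx : x 1 ≠ 0) :
    tipCoord c t x ∈ Complex.slitPlane := Or.inr hx

theorem ae_tipCoord_mem_slitPlane (c t : ℝ) : ∀ᵐ x : Plane, tipCoord c t x ∈ Complex.slitPlane := by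
  filter_upwards [ae_coord_ne_zero] with x hx using tipCoord_mem_slitPlane hx

theorem alpha_pos {c : ℝ} (hc0 : 0 < c) (hc1 : c < 1) : 0 < √(1 - c ^ 2) :=
  Real.sqrt_pos.2 (by nlinarith)

theorem alpha_sq {c : ℝ} (hc0 : 0 < c) (hc1 : c < 1) : √(1 - c ^ 2) ^ 2 = 1 - c ^ 2 :=
  Real.sq_sqrt (by nlinarith)

theorem tipCoord_mem_slitPlane_iff {c t : ℝ} (hc0 : 0 < c) (hc1 : c < 1) {x : Plane} :
    tipCoord c t x ∈ Complex.slitPlane ↔ ¬ (x 1 = 0 ∧ x 0 ≤ c * t) := by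
  rw [Complex.mem_slitPlane_iff]
  simp only [tipCoord]
  rw [div_pos_iff_of_pos_right (alpha_pos hc0 hc1)]
  by_cases h : x 1 = 0
  · simp [h]
  · simp [h]

theorem tipCoord_mem_of_notMem_crack {R c t : ℝ} (hc0 : 0 < c) (hc1 : c < 1) {x : Plane}
    (hx : x ∈ Metric.ball (0 : Plane) R \ crack R c t) : tipCoord c t x ∈ Complex.slitPlane := by
  rw [tipCoord_mem_slitPlane_iff hc0 hc1]
  exact fun h => hx.2 ⟨Metric.ball_subset_closedBall hx.1, h⟩

/-- The contraction factor 1/α is at least one, so tip coordinates only increase distances from the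
tip. This carries both the vanishing of Ψ near the tip and the singular bounds between the two
coordinate systems. -/
theorem norm_sub_tip_le {c t : ℝ} (hc0 : 0 < c) (hc1 : c < 1) (x : Plane) :
    ‖x - !₂[c * t, 0]‖ ≤ ‖tipCoord c t x‖ := by
  rw [EuclideanSpace.norm_eq, Fin.sum_univ_two, Complex.norm_eq_sqrt_sq_add_sq]
  apply Real.sqrt_le_sqrt
  simp [tipCoord]
  rw [div_pow, alpha_sq hc0 hc1]
  apply le_div_self (sq_nonneg _) <;> nlinarith

/-! ### The displacement and its derivatives -/

/-- The speed of the crack tip in the coordinates `tipCoord`. -/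
abbrev alpha (c : ℝ) : ℝ := √(1 - c ^ 2)

/-- The normalizing constant of the displacement. -/
abbrev ampl : ℝ := 2 / √Real.pi

theorem crackDisplacement_eq (c t : ℝ) (x : Plane) :
    crackDisplacement c t x = ampl * (Complex.sqrt (tipCoord c t x)).im := by
  simp [crackDisplacement, tipFunction, tipCoord]

/-- The velocity of the displacement. -/
def velField (c t : ℝ) (x : Plane) : ℝ := -(ampl * (c / alpha c)) * (sqrtD1 (tipCoord c t x)).im

/-- The gradient of the displacement. -/
def gradField (c t : ℝ) (x : Plane) : Plane :=
  !₂[ampl / alpha c * (sqrtD1 (tipCoord c t x)).im, ampl * (sqrtD1 (tipCoord c t x)).re]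

/-- The acceleration. -/
def accField (c t : ℝ) (x : Plane) : ℝ :=
  (ampl * (c / alpha c) ^ 2) * (sqrtD2 (tipCoord c t x)).im

/-- The gradient of the velocity. -/
def velGradField (c t : ℝ) (x : Plane) : Plane :=
  !₂[-(ampl * (c / alpha c)) / alpha c * (sqrtD2 (tipCoord c t x)).im,
    -(ampl * (c / alpha c)) * (sqrtD2 (tipCoord c t x)).re]

/-- Time enters `tipCoord` only as a real shift with velocity -c/α, so each time derivative
multiplies the complex derivative by this real number. -/
theorem hasDerivAt_comp_tipCoord_im {h : ℂ → ℂ} {h' : ℂ} {c t : ℝ} {x : Plane}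
    (H : HasDerivAt h h' (tipCoord c t x)) :
    HasDerivAt (fun s => (h (tipCoord c s x)).im) (-(c / alpha c) * h'.im) t := by
  have := (hasFDerivAt_im_comp H).comp_hasDerivAt t (hasDerivAt_tipCoord c t x)
  refine this.congr_deriv ?_
  simp [-Complex.ofReal_div]
  ring

theorem hasFDerivAt_comp_tipCoord_im {h : ℂ → ℂ} {h' : ℂ} {c t : ℝ} {x : Plane}
    (H : HasDerivAt h h' (tipCoord c t x)) :
    HasFDerivAt (fun y => (h (tipCoord c t y)).im)
      ((Complex.imCLM.comp (h' • (1 : ℂ →L[ℝ] ℂ))).comp (tipLin c)) x :=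
  (hasFDerivAt_im_comp H).comp x (hasFDerivAt_tipCoord c t x)

theorem gradient_comp_tipCoord_im {h : ℂ → ℂ} {h' : ℂ} {c t : ℝ} {x : Plane}
    (H : HasDerivAt h h' (tipCoord c t x)) (b : ℝ) :
    gradient (fun y => b * (h (tipCoord c t y)).im) x = !₂[b / alpha c * h'.im, b * h'.re] := by
  have := (hasFDerivAt_comp_tipCoord_im H).const_mul b
  ext i
  rw [gradient_coord, this.fderiv]
  fin_cases i
  · simp [tipLin_basis_zero]
    simp [alpha]
    ring
  · simp [tipLin_basis_one]

/-- The closed formulas are defined and measurable everywhere, with conventional values on the slit.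
The slit is a null set, so agreement off it suffices to replace classical derivatives by these
formulas under every integral. -/
theorem timeDeriv_crackDisplacement {c t : ℝ} {x : Plane}
    (hx : tipCoord c t x ∈ Complex.slitPlane) :
    timeDeriv (crackDisplacement c) t x = velField c t x := by
  have := (hasDerivAt_comp_tipCoord_im (hasDerivAt_sqrt hx)).const_mul ampl
  rw [timeDeriv]
  simp_rw [crackDisplacement_eq]
  rw [this.deriv, velField]
  ring

theorem gradient_crackDisplacement {c t : ℝ} {x : Plane}
    (hx : tipCoord c t x ∈ Complex.slitPlane) :
    gradient (crackDisplacement c t) x = gradField c t x := by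
  have : crackDisplacement c t = fun y => ampl * (Complex.sqrt (tipCoord c t y)).im :=
    funext (crackDisplacement_eq c t)
  rw [this, gradient_comp_tipCoord_im (hasDerivAt_sqrt hx), gradField]

theorem eventually_tipCoord_mem {c t : ℝ} {x : Plane}
    (hx : tipCoord c t x ∈ Complex.slitPlane) :
    ∀ᶠ y in 𝓝 x, tipCoord c t y ∈ Complex.slitPlane :=
  (contDiff_tipCoord_space c t).continuous.continuousAt.eventually
    (Complex.isOpen_slitPlane.mem_nhds hx)

theorem timeDeriv_eventuallyEq {c t : ℝ} {x : Plane}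
    (hx : tipCoord c t x ∈ Complex.slitPlane) :
    timeDeriv (crackDisplacement c) t =ᶠ[𝓝 x] velField c t :=
  (eventually_tipCoord_mem hx).mono fun _ hy => timeDeriv_crackDisplacement hy

theorem gradient_velField {c t : ℝ} {x : Plane}
    (hx : tipCoord c t x ∈ Complex.slitPlane) :
    gradient (velField c t) x = velGradField c t x := by
  unfold velField
  rw [gradient_comp_tipCoord_im (hasDerivAt_sqrtD1 hx), velGradField]

theorem gradient_timeDeriv {c t : ℝ} {x : Plane}
    (hx : tipCoord c t x ∈ Complex.slitPlane) :
    gradient (timeDeriv (crackDisplacement c) t) x = velGradField c t x := by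
  rw [← gradient_velField hx, gradient, gradient, (timeDeriv_eventuallyEq hx).fderiv_eq]

theorem hasDerivAt_velField {c t : ℝ} {x : Plane} (hx : tipCoord c t x ∈ Complex.slitPlane) :
    HasDerivAt (fun s => velField c s x) (accField c t x) t := by
  have := (hasDerivAt_comp_tipCoord_im (hasDerivAt_sqrtD1 hx)).const_mul (-(ampl * (c / alpha c)))
  refine this.congr_deriv ?_
  rw [accField]
  ring

theorem hasDerivAt_crackDisplacement {c t : ℝ} {x : Plane}
    (hx : tipCoord c t x ∈ Complex.slitPlane) :
    HasDerivAt (fun s => crackDisplacement c s x) (velField c t x) t := by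
  have := (hasDerivAt_comp_tipCoord_im (hasDerivAt_sqrt hx)).const_mul ampl
  simp_rw [crackDisplacement_eq]
  refine this.congr_deriv ?_
  rw [velField]
  ring

/-! ### Integration over the space-time cylinder -/

theorem cylMeasure_eq_prod (T : ℝ) (Ω : Set Plane) :
    cylMeasure T Ω = (volume.restrict (Ioo 0 T)).prod (volume.restrict Ω) := by
  rw [cylMeasure, Measure.prod_restrict]
  rfl

theorem cylMeasure_mono {t T : ℝ} (h : t ≤ T) (Ω : Set Plane) :
    cylMeasure t Ω ≤ cylMeasure T Ω :=
  Measure.restrict_mono (prod_mono (Ioo_subset_Ioo_right h) le_rfl) le_rfl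

instance isFiniteMeasure_restrict_ball (R : ℝ) :
    IsFiniteMeasure ((volume : Measure Plane).restrict (Metric.ball (0 : Plane) R)) :=
  ⟨by rw [Measure.restrict_apply_univ]; exact measure_ball_lt_top⟩

instance isFiniteMeasure_cylMeasure (T R : ℝ) :
    IsFiniteMeasure (cylMeasure T (Metric.ball (0 : Plane) R)) := by
  rw [cylMeasure_eq_prod]
  have : IsFiniteMeasure ((volume : Measure ℝ).restrict (Ioo 0 T)) :=
    ⟨by rw [Measure.restrict_apply_univ]; exact measure_Ioo_lt_top⟩
  infer_instance

theorem intervalIntegral_eq_Ioo {t : ℝ} (ht : 0 ≤ t) {E : Type*} [NormedAddCommGroup E]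
    [NormedSpace ℝ E] (g : ℝ → E) : ∫ s in (0 : ℝ)..t, g s = ∫ s in Ioo 0 t, g s := by
  rw [intervalIntegral.integral_of_le ht, integral_Ioc_eq_integral_Ioo]

theorem integral_time_space {T t : ℝ} (ht : t ∈ Icc 0 T) {Ω : Set Plane} {F : ℝ → Plane → ℝ}
    (hF : Integrable (fun p : ℝ × Plane => F p.1 p.2) (cylMeasure T Ω)) :
    ∫ s in (0 : ℝ)..t, ∫ x in Ω, F s x = ∫ p, F p.1 p.2 ∂(cylMeasure t Ω) := by
  have h := hF.mono_measure (cylMeasure_mono ht.2 Ω)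
  rw [cylMeasure_eq_prod] at h ⊢
  rw [intervalIntegral_eq_Ioo ht.1, integral_prod _ h]

theorem integral_space_time {T t : ℝ} (ht : t ∈ Icc 0 T) {Ω : Set Plane} {F : ℝ → Plane → ℝ}
    (hF : Integrable (fun p : ℝ × Plane => F p.1 p.2) (cylMeasure T Ω)) :
    ∫ x in Ω, ∫ s in (0 : ℝ)..t, F s x = ∫ p, F p.1 p.2 ∂(cylMeasure t Ω) := by
  have h := hF.mono_measure (cylMeasure_mono ht.2 Ω)
  rw [cylMeasure_eq_prod] at h ⊢
  simp_rw [intervalIntegral_eq_Ioo ht.1]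
  rw [integral_prod_symm _ h]

theorem intervalIntegrable_space {T t : ℝ} (ht : t ∈ Icc 0 T) {Ω : Set Plane} {F : ℝ → Plane → ℝ}
    (hF : Integrable (fun p : ℝ × Plane => F p.1 p.2) (cylMeasure T Ω)) :
    IntervalIntegrable (fun s => ∫ x in Ω, F s x) volume 0 t := by
  have h := hF.mono_measure (cylMeasure_mono ht.2 Ω)
  rw [cylMeasure_eq_prod] at h
  rw [intervalIntegrable_iff_integrableOn_Ioo_of_le ht.1]
  exact h.integral_prod_left

theorem ae_cyl_coord_ne_zero (T : ℝ) (Ω : Set Plane) :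
    ∀ᵐ p ∂(cylMeasure T Ω), p.2 1 ≠ 0 := by
  apply ae_restrict_of_ae
  have : ∀ᵐ p ∂((volume : Measure ℝ).prod (volume : Measure Plane)), p.2 1 ≠ 0 := by
    have hq := Measure.quasiMeasurePreserving_snd
      (μ := (volume : Measure ℝ)) (ν := (volume : Measure Plane))
    exact hq.ae ae_coord_ne_zero
  exact this

theorem ae_cyl_mem {T : ℝ} {Ω : Set Plane} (hΩ : MeasurableSet Ω) :
    ∀ᵐ p ∂(cylMeasure T Ω), p.1 ∈ Ioo 0 T ∧ p.2 ∈ Ω :=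
  ae_restrict_mem (measurableSet_Ioo.prod hΩ)

theorem ae_memLp_slice {T R : ℝ} {E : Type*} [NormedAddCommGroup E] {F : ℝ → Plane → E}
    (hF : MemLp (fun p : ℝ × Plane => F p.1 p.2) 2 (cylMeasure T (Metric.ball 0 R))) :
    ∀ᵐ t ∂(volume.restrict (Ioo 0 T)), MemLp (F t) 2 (volume.restrict (Metric.ball 0 R)) := by
  have h := hF.norm.integrable_sq
  have hm := hF.1
  rw [cylMeasure_eq_prod] at h hm
  filter_upwards [h.prod_right_ae, hm.prodMk_left] with t ht hmt
  exact (memLp_two_iff_integrable_sq_norm hmt).2 ht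

theorem memLp_cyl_of_lintegral_le {T R : ℝ} {E : Type*} [NormedAddCommGroup E]
    {F : ℝ → Plane → E}
    (hm : AEStronglyMeasurable (fun p : ℝ × Plane => F p.1 p.2) (cylMeasure T (Metric.ball 0 R)))
    {M : ℝ≥0∞} (hM : M ≠ ⊤)
    (h : ∀ t ∈ Ioo 0 T, ∫⁻ x in Metric.ball (0 : Plane) R, ‖F t x‖ₑ ^ (2 : ℝ) ≤ M) :
    MemLp (fun p : ℝ × Plane => F p.1 p.2) 2 (cylMeasure T (Metric.ball 0 R)) := by
  refine ⟨hm, ?_⟩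
  rw [eLpNorm_lt_top_iff_lintegral_rpow_enorm_lt_top (by norm_num) (by norm_num)]
  simp only [ENNReal.toReal_ofNat]
  have hm' := hm
  rw [cylMeasure_eq_prod] at hm' ⊢
  rw [lintegral_prod _ (by simpa using hm'.enorm.pow_const (2 : ℝ))]
  calc _ ≤ ∫⁻ _ in Ioo 0 T, M := setLIntegral_mono measurable_const h
    _ < ⊤ := by
      rw [setLIntegral_const]
      exact ENNReal.mul_lt_top hM.lt_top measure_Ioo_lt_top

theorem memLp_cyl_of_bound {T R : ℝ} {E : Type*} [NormedAddCommGroup E]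
    {F : ℝ × Plane → E} {p : ℝ≥0∞}
    (hm : AEStronglyMeasurable F (cylMeasure T (Metric.ball 0 R))) (C : ℝ)
    (h : ∀ᵐ q ∂(cylMeasure T (Metric.ball (0 : Plane) R)), ‖F q‖ ≤ C) :
    MemLp F p (cylMeasure T (Metric.ball 0 R)) :=
  MemLp.of_bound hm C h

/-- Dominated convergence for cutoff functions converging to one. -/
theorem tendsto_integral_cutoff {X : Type*} [MeasurableSpace X] {μ : Measure X} {m : ℕ → X → ℝ}
    {F : X → ℝ} (hF : Integrable F μ) (hm : ∀ n, AEStronglyMeasurable (m n) μ)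
    (h1 : ∀ n x, ‖m n x‖ ≤ 1) (hlim : ∀ᵐ x ∂μ, Tendsto (fun n => m n x) atTop (𝓝 1)) :
    Tendsto (fun n => ∫ x, m n x * F x ∂μ) atTop (𝓝 (∫ x, F x ∂μ)) := by
  apply tendsto_integral_of_dominated_convergence (fun x => ‖F x‖)
  · exact fun n => (hm n).mul hF.1
  · exact hF.norm
  · intro n
    refine ae_of_all _ fun x => ?_
    rw [norm_mul]
    exact mul_le_of_le_one_left (norm_nonneg _) (h1 n x)
  · filter_upwards [hlim] with x hx
    simpa using hx.mul_const (F x)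

/-! ### Functions with a weak time derivative -/

/-- The Cauchy–Schwarz inequality on an interval, in the form that the variance of `g` is
nonnegative. -/
theorem sq_integral_le {t : ℝ} (ht : 0 < t) {g : ℝ → ℝ}
    (hg : Integrable g (volume.restrict (Ioo 0 t)))
    (hg2 : Integrable (fun s => g s ^ 2) (volume.restrict (Ioo 0 t))) :
    (∫ s in Ioo 0 t, g s) ^ 2 ≤ t * ∫ s in Ioo 0 t, g s ^ 2 := by
  set m := ∫ s in Ioo 0 t, g s with hm
  have h0 : 0 ≤ ∫ s in Ioo 0 t, (g s - m / t) ^ 2 := integral_nonneg fun s => sq_nonneg _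
  have e : ∫ s in Ioo 0 t, (g s - m / t) ^ 2
      = (∫ s in Ioo 0 t, g s ^ 2) - 2 * (m / t) * m + t * (m / t) ^ 2 := by
    have : ∀ s, (g s - m / t) ^ 2 = g s ^ 2 - 2 * (m / t) * g s + (m / t) ^ 2 := fun s => by ring
    simp_rw [this]
    have hs : Integrable (fun s => g s ^ 2 - 2 * (m / t) * g s) (volume.restrict (Ioo 0 t)) :=
      hg2.sub (hg.const_mul _)
    rw [integral_add hs (integrable_const _), integral_sub hg2 (hg.const_mul _),
      integral_const_mul, ← hm]
    simp [ht.le]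
  rw [e] at h0
  have : t * ((∫ s in Ioo 0 t, g s ^ 2) - 2 * (m / t) * m + t * (m / t) ^ 2)
      = t * (∫ s in Ioo 0 t, g s ^ 2) - m ^ 2 := by
    field_simp
    ring
  nlinarith [mul_nonneg ht.le h0]

theorem memLp_time_integral {T R t : ℝ} (ht : t ∈ Icc 0 T) {g : ℝ → Plane → ℝ}
    (hg : MemLp (fun p : ℝ × Plane => g p.1 p.2) 2 (cylMeasure T (Metric.ball 0 R))) :
    MemLp (fun x => ∫ s in (0 : ℝ)..t, g s x) 2 (volume.restrict (Metric.ball 0 R)) := by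
  rcases ht.1.eq_or_lt with h0 | h0
  · subst h0
    simp
  have hgt := hg.mono_measure (cylMeasure_mono ht.2 (Metric.ball 0 R))
  have h1 : Integrable (fun p : ℝ × Plane => g p.1 p.2) (cylMeasure t (Metric.ball 0 R)) :=
    hgt.integrable (by norm_num)
  have h2 := hgt.integrable_sq
  rw [cylMeasure_eq_prod] at h1 h2
  simp_rw [intervalIntegral_eq_Ioo ht.1]
  have hm := h1.integral_prod_right.aestronglyMeasurable
  rw [memLp_two_iff_integrable_sq hm]
  refine Integrable.mono' (h2.integral_prod_right.const_mul t) (hm.pow 2) ?_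
  filter_upwards [h1.prod_left_ae, h2.prod_left_ae] with x hx1 hx2
  rw [Real.norm_of_nonneg (sq_nonneg _)]
  exact sq_integral_le h0 hx1 hx2

/-- Membership in L² of the cylinder gives square integrability only at almost every time. One good
time is connected to time zero by the integral formula, and time zero to any other time. -/
theorem IsH1Time.memLp_at {T R t : ℝ} (hT : 0 < T) (ht : t ∈ Icc 0 T) {v v' : ℝ → Plane → ℝ}
    (h : IsH1Time T (Metric.ball 0 R) v v') :
    MemLp (v t) 2 (volume.restrict (Metric.ball 0 R)) := by
  have h0 : MemLp (v 0) 2 (volume.restrict (Metric.ball 0 R)) := by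
    have hne : (ae ((volume : Measure ℝ).restrict (Ioo 0 T))).NeBot := by
      rw [ae_neBot]
      intro hz
      rw [Measure.restrict_eq_zero, Real.volume_Ioo, ENNReal.ofReal_eq_zero] at hz
      linarith
    obtain ⟨s, hs, hsm⟩ := ((ae_memLp_slice h.memLp).and
      (ae_restrict_mem measurableSet_Ioo)).exists
    refine MemLp.ae_eq ?_ (hs.sub (memLp_time_integral (Ioo_subset_Icc_self hsm) h.memLp_deriv))
    filter_upwards [h.eq_integral s (Ioo_subset_Icc_self hsm)] with x hx
    rw [Pi.sub_apply, hx]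
    ring
  refine MemLp.ae_eq ?_ (h0.add (memLp_time_integral ht h.memLp_deriv))
  filter_upwards [h.eq_integral t ht] with x hx
  rw [hx]
  rfl

theorem ae_intervalIntegrable {T R t : ℝ} (ht : t ∈ Icc 0 T) {g : ℝ → Plane → ℝ}
    (hg : MemLp (fun p : ℝ × Plane => g p.1 p.2) 2 (cylMeasure T (Metric.ball 0 R))) :
    ∀ᵐ x ∂(volume.restrict (Metric.ball (0 : Plane) R)),
      IntervalIntegrable (fun s => g s x) volume 0 t := by
  have hgt := hg.mono_measure (cylMeasure_mono ht.2 (Metric.ball 0 R))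
  have h1 : Integrable (fun p : ℝ × Plane => g p.1 p.2) (cylMeasure t (Metric.ball 0 R)) :=
    hgt.integrable (by norm_num)
  rw [cylMeasure_eq_prod] at h1
  filter_upwards [h1.prod_left_ae] with x hx
  rw [intervalIntegrable_iff_integrableOn_Ioo_of_le ht.1]
  exact hx

theorem IsH1Time.sub {T R : ℝ} {v v' w w' : ℝ → Plane → ℝ}
    (hv : IsH1Time T (Metric.ball 0 R) v v') (hw : IsH1Time T (Metric.ball 0 R) w w') :
    IsH1Time T (Metric.ball 0 R) (fun t x => v t x - w t x) (fun t x => v' t x - w' t x) where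
  memLp := hv.memLp.sub hw.memLp
  memLp_deriv := hv.memLp_deriv.sub hw.memLp_deriv
  eq_integral t ht := by
    filter_upwards [hv.eq_integral t ht, hw.eq_integral t ht,
      ae_intervalIntegrable ht hv.memLp_deriv, ae_intervalIntegrable ht hw.memLp_deriv]
      with x h1 h2 h3 h4
    rw [h1, h2, intervalIntegral.integral_sub h3 h4]
    ring

/-- The single null line x₂ = 0 contains the singular sets of all times. Off this line the
fundamental theorem of calculus applies in time for each fixed point. -/
theorem isH1Time_of_hasDerivAt {T : ℝ} {Ω : Set Plane} {v v' : ℝ → Plane → ℝ}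
    (hv : MemLp (fun p : ℝ × Plane => v p.1 p.2) 2 (cylMeasure T Ω))
    (hv' : MemLp (fun p : ℝ × Plane => v' p.1 p.2) 2 (cylMeasure T Ω))
    (hd : ∀ x : Plane, x 1 ≠ 0 → ∀ t, HasDerivAt (fun s => v s x) (v' t x) t)
    (hc : ∀ x : Plane, x 1 ≠ 0 → Continuous (fun s => v' s x)) :
    IsH1Time T Ω v v' where
  memLp := hv
  memLp_deriv := hv'
  eq_integral t _ := by
    apply ae_restrict_of_ae
    filter_upwards [ae_coord_ne_zero] with x hx
    rw [intervalIntegral.integral_eq_sub_of_hasDerivAt (fun s _ => hd x hx s)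
      ((hc x hx).intervalIntegrable _ _)]
    ring

theorem exists_bound_on_cylinder {a : ℝ × Plane → ℝ} (ha : Continuous a) (T R : ℝ) :
    ∃ C, ∀ t ∈ Icc 0 T, ∀ x ∈ Metric.ball (0 : Plane) R, ‖a (t, x)‖ ≤ C := by
  obtain ⟨C, hC⟩ := (isCompact_Icc.prod (isCompact_closedBall (0 : Plane) R)
    : IsCompact (Icc 0 T ×ˢ Metric.closedBall (0 : Plane) R)).exists_bound_of_continuousOn
    ha.continuousOn
  exact ⟨C, fun t ht x hx => hC (t, x) ⟨ht, Metric.ball_subset_closedBall hx⟩⟩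

theorem integrable_cyl_mul {T R : ℝ} {a : ℝ × Plane → ℝ} (ha : Continuous a)
    {g : ℝ × Plane → ℝ} (hg : Integrable g (cylMeasure T (Metric.ball 0 R))) :
    Integrable (fun p => a p * g p) (cylMeasure T (Metric.ball 0 R)) := by
  obtain ⟨C, hC⟩ := exists_bound_on_cylinder ha T R
  refine Integrable.bdd_mul hg ha.aestronglyMeasurable (c := C) ?_
  filter_upwards [ae_cyl_mem Metric.isOpen_ball.measurableSet] with p hp
  exact hC _ (Ioo_subset_Icc_self hp.1) _ hp.2

theorem integrable_ball_mul {R : ℝ} {a : Plane → ℝ} (ha : Continuous a)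
    {g : Plane → ℝ} (hg : IntegrableOn g (Metric.ball 0 R)) :
    IntegrableOn (fun p => a p * g p) (Metric.ball 0 R) := by
  obtain ⟨C, hC⟩ := (isCompact_closedBall (0 : Plane) R).exists_bound_of_continuousOn
    ha.continuousOn
  refine Integrable.bdd_mul hg ha.aestronglyMeasurable (c := C) ?_
  filter_upwards [ae_restrict_mem Metric.isOpen_ball.measurableSet] with p hp
  exact hC _ (Metric.ball_subset_closedBall hp)

/-- Integration by parts in time. -/
theorem IsH1Time.integral_mul_deriv {T R t : ℝ} (hT : 0 < T) (ht : t ∈ Icc 0 T)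
    {v v' : ℝ → Plane → ℝ} (h : IsH1Time T (Metric.ball 0 R) v v') {a a' : ℝ → Plane → ℝ}
    (ha : Continuous fun p : ℝ × Plane => a p.1 p.2)
    (ha' : Continuous fun p : ℝ × Plane => a' p.1 p.2)
    (hd : ∀ x s, HasDerivAt (fun s => a s x) (a' s x) s) :
    ∫ s in (0 : ℝ)..t, ∫ x in Metric.ball (0 : Plane) R, a s x * v' s x
      = (∫ x in Metric.ball (0 : Plane) R, a t x * v t x)
        - (∫ x in Metric.ball (0 : Plane) R, a 0 x * v 0 x)
        - ∫ s in (0 : ℝ)..t, ∫ x in Metric.ball (0 : Plane) R, a' s x * v s x := by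
  set Ω := Metric.ball (0 : Plane) R with hΩ
  set ν := (volume : Measure ℝ).restrict (Ioo 0 t) with hν
  have hνf : IsFiniteMeasure ν := ⟨by rw [hν, Measure.restrict_apply_univ]; exact measure_Ioo_lt_top⟩
  have hv'T : Integrable (fun p : ℝ × Plane => v' p.1 p.2) (cylMeasure T Ω) :=
    h.memLp_deriv.integrable (by norm_num)
  have hv' : Integrable (fun p : ℝ × Plane => v' p.1 p.2) (cylMeasure t Ω) :=
    hv'T.mono_measure (cylMeasure_mono ht.2 Ω)
  have hac : ∀ s, Continuous (a s) := fun s => ha.comp (by fun_prop : Continuous fun x => (s, x))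
  have hac' : ∀ s, Continuous (a' s) := fun s => ha'.comp (by fun_prop : Continuous fun x => (s, x))
  have hsc' : ∀ x, Continuous fun s => a' s x :=
    fun x => ha'.comp (by fun_prop : Continuous fun s => (s, x))
  have h0i : IntegrableOn (v 0) Ω := memLp_two_integrableOn (h.memLp_at hT ⟨le_rfl, hT.le⟩)
  have hti : IntegrableOn (v t) Ω := memLp_two_integrableOn (h.memLp_at hT ht)
  -- the triple integral
  let Φ : ℝ → ℝ × Plane → ℝ := fun s p => (if p.1 < s then a' s p.2 else 0) * v' p.1 p.2
  have hΦ : Integrable (Function.uncurry Φ) (ν.prod (cylMeasure t Ω)) := by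
    obtain ⟨C, hC⟩ := exists_bound_on_cylinder ha' t R
    have h1 : Integrable (fun q : ℝ × ℝ × Plane => v' q.2.1 q.2.2) (ν.prod (cylMeasure t Ω)) :=
      hv'.comp_snd ν
    have hmem : ∀ᵐ q ∂(ν.prod (cylMeasure t Ω)), q.1 ∈ Ioo 0 t ∧ q.2.2 ∈ Ω := by
      have e1 : ∀ᵐ q ∂(ν.prod (cylMeasure t Ω)), q.1 ∈ Ioo 0 t :=
        Measure.quasiMeasurePreserving_fst.ae (ae_restrict_mem measurableSet_Ioo)
      have e2 : ∀ᵐ q ∂(ν.prod (cylMeasure t Ω)), q.2.1 ∈ Ioo 0 t ∧ q.2.2 ∈ Ω :=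
        Measure.quasiMeasurePreserving_snd.ae (ae_cyl_mem Metric.isOpen_ball.measurableSet)
      filter_upwards [e1, e2] with q h1 h2 using ⟨h1, h2.2⟩
    refine Integrable.bdd_mul (c := |C|) h1 ?_ ?_
    · apply Measurable.aestronglyMeasurable
      apply Measurable.ite
      · exact measurableSet_lt measurable_snd.fst measurable_fst
      · exact ha'.measurable.comp (measurable_fst.prodMk measurable_snd.snd)
      · exact measurable_const
    · filter_upwards [hmem] with q hq
      split_ifs
      · exact (hC _ (Ioo_subset_Icc_self hq.1) _ hq.2).trans (le_abs_self _)
      · simp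
  -- first evaluation
  have e1 : ∀ s ∈ Ioo 0 t, ∫ p, Φ s p ∂(cylMeasure t Ω)
      = (∫ x in Ω, a' s x * v s x) - ∫ x in Ω, a' s x * v 0 x := by
    intro s hs
    have hsT : s ∈ Icc 0 T := ⟨hs.1.le, hs.2.le.trans ht.2⟩
    have hi : Integrable (fun p : ℝ × Plane => a' s p.2 * v' p.1 p.2) (cylMeasure T Ω) :=
      integrable_cyl_mul ((hac' s).comp continuous_snd) hv'T
    have hset : ∫ p, Φ s p ∂(cylMeasure t Ω) = ∫ p, a' s p.2 * v' p.1 p.2 ∂(cylMeasure s Ω) := by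
      rw [cylMeasure, cylMeasure, ← integral_indicator (measurableSet_Ioo.prod
        Metric.isOpen_ball.measurableSet), ← integral_indicator (measurableSet_Ioo.prod
        Metric.isOpen_ball.measurableSet)]
      congr 1
      ext p
      by_cases hp : p ∈ Ioo 0 s ×ˢ Metric.ball (0 : Plane) R
      · rw [indicator_of_mem hp, indicator_of_mem
          (show p ∈ Ioo 0 t ×ˢ Ω from ⟨⟨hp.1.1, hp.1.2.trans hs.2⟩, hp.2⟩)]
        simp [Φ, hp.1.2]
      · rw [indicator_of_notMem hp]
        by_cases h2 : p ∈ Ioo 0 t ×ˢ Metric.ball (0 : Plane) R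
        · rw [indicator_of_mem h2]
          have : ¬ p.1 < s := fun h => hp ⟨⟨h2.1.1, h⟩, h2.2⟩
          simp [Φ, this]
        · rw [indicator_of_notMem h2]
    rw [hset, ← integral_space_time (F := fun r x => a' s x * v' r x) hsT hi, ← integral_sub
      (integrable_ball_mul (hac' s) (memLp_two_integrableOn (h.memLp_at hT hsT)))
      (integrable_ball_mul (hac' s) h0i)]
    apply integral_congr_ae
    filter_upwards [h.eq_integral s hsT] with x hx
    rw [intervalIntegral.integral_const_mul, hx]
    ring
  -- second evaluation
  have e2 : ∀ᵐ p ∂(cylMeasure t Ω), ∫ s, Φ s p ∂ν = a t p.2 * v' p.1 p.2 - a p.1 p.2 * v' p.1 p.2 := by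
    filter_upwards [ae_cyl_mem Metric.isOpen_ball.measurableSet] with p hp
    have : ∫ s, Φ s p ∂ν = (∫ s in p.1..t, a' s p.2) * v' p.1 p.2 := by
      simp only [Φ]
      rw [integral_mul_const, intervalIntegral.integral_of_le hp.1.2.le, hν,
        integral_Ioc_eq_integral_Ioo]
      congr 1
      rw [← integral_indicator measurableSet_Ioo, ← integral_indicator measurableSet_Ioo]
      congr 1
      ext s
      simp only [indicator_apply, mem_Ioo]
      have := hp.1.1
      by_cases h1 : p.1 < s
      · have : 0 < s := by linarith
        simp [h1, this]
      · simp [h1]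
    rw [this, intervalIntegral.integral_eq_sub_of_hasDerivAt (fun s _ => hd p.2 s)
      ((hsc' p.2).intervalIntegrable _ _)]
    ring
  have hvT : Integrable (fun p : ℝ × Plane => v p.1 p.2) (cylMeasure T Ω) :=
    h.memLp.integrable (by norm_num)
  have i1 := integrable_cyl_mul ha' hvT
  have i2 : Integrable (fun p : ℝ × Plane => a' p.1 p.2 * v 0 p.2) (cylMeasure T Ω) := by
    apply integrable_cyl_mul ha'
    rw [cylMeasure_eq_prod]
    have : IsFiniteMeasure ((volume : Measure ℝ).restrict (Ioo 0 T)) :=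
      ⟨by rw [Measure.restrict_apply_univ]; exact measure_Ioo_lt_top⟩
    exact Integrable.comp_snd (ν := volume.restrict Ω) h0i _
  have i3 : Integrable (fun p : ℝ × Plane => a t p.2 * v' p.1 p.2) (cylMeasure T Ω) :=
    integrable_cyl_mul ((hac t).comp continuous_snd) hv'T
  have i4 : Integrable (fun p : ℝ × Plane => a p.1 p.2 * v' p.1 p.2) (cylMeasure T Ω) :=
    integrable_cyl_mul ha hv'T
  -- Fubini on the region r < s: integrating v'(r) over r first produces v(s) - v(0) against a'(s),
  -- while integrating a'(s) over s first produces a(t) - a(r) against v'(r).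
  have key := integral_integral_swap hΦ
  rw [hν, setIntegral_congr_fun measurableSet_Ioo e1, ← hν, integral_congr_ae e2,
    ← intervalIntegral_eq_Ioo ht.1, intervalIntegral.integral_sub
      (intervalIntegrable_space (F := fun s x => a' s x * v s x) ht i1)
      (intervalIntegrable_space (F := fun s x => a' s x * v 0 x) ht i2),
    integral_sub (i3.mono_measure (cylMeasure_mono ht.2 Ω))
      (i4.mono_measure (cylMeasure_mono ht.2 Ω)),
    ← integral_time_space (F := fun s x => a s x * v' s x) ht i4,
    integral_time_space (F := fun s x => a' s x * v 0 x) ht i2,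
    ← integral_space_time (F := fun s x => a' s x * v 0 x) ht i2,
    ← integral_space_time (F := fun s x => a t x * v' s x) ht i3] at key
  have k1 : ∫ x in Ω, ∫ s in (0 : ℝ)..t, a' s x * v 0 x
      = (∫ x in Ω, a t x * v 0 x) - ∫ x in Ω, a 0 x * v 0 x := by
    rw [← integral_sub (integrable_ball_mul (hac t) h0i) (integrable_ball_mul (hac 0) h0i)]
    congr 1
    ext x
    rw [intervalIntegral.integral_mul_const, intervalIntegral.integral_eq_sub_of_hasDerivAt
      (fun s _ => hd x s) ((hsc' x).intervalIntegrable _ _)]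
    ring
  have k2 : ∫ x in Ω, ∫ s in (0 : ℝ)..t, a t x * v' s x
      = (∫ x in Ω, a t x * v t x) - ∫ x in Ω, a t x * v 0 x := by
    rw [← integral_sub (integrable_ball_mul (hac t) hti) (integrable_ball_mul (hac t) h0i)]
    apply integral_congr_ae
    filter_upwards [h.eq_integral t ht] with x hx
    rw [intervalIntegral.integral_const_mul, hx]
    ring
  rw [k1, k2] at key
  linarith

/-! ### The crack -/

theorem isClosed_crack (R c t : ℝ) : IsClosed (crack R c t) := by
  have h : crack R c t = Metric.closedBall 0 R ∩ {x | x 1 = 0} ∩ {x | x 0 ≤ c * t} := by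
    ext x
    simp [crack, and_assoc]
  rw [h]
  exact (Metric.isClosed_closedBall.inter (isClosed_eq (by fun_prop) continuous_const)).inter
    (isClosed_le (by fun_prop) continuous_const)

theorem volume_crack (R c t : ℝ) : volume (crack R c t) = 0 := by
  refine measure_mono_null ?_ (ae_iff.1 ae_coord_ne_zero)
  intro x hx
  simpa using hx.2.1

theorem crack_mono {R c s t : ℝ} (hc : 0 < c) (h : s ≤ t) : crack R c s ⊆ crack R c t :=
  fun _ hx => ⟨hx.1, hx.2.1, hx.2.2.trans (mul_le_mul_of_nonneg_left h hc.le)⟩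

theorem notMem_crack_of_mem_slitPlane {R c t : ℝ} (hc0 : 0 < c) (hc1 : c < 1) {x : Plane}
    (hx : tipCoord c t x ∈ Complex.slitPlane) : x ∉ crack R c t := by
  rw [tipCoord_mem_slitPlane_iff hc0 hc1] at hx
  exact fun h => hx h.2

theorem tsupport_comp_tipCoord_subset {R c t : ℝ} (hc0 : 0 < c) (hc1 : c < 1) (n : ℕ) :
    tsupport (fun x => slitCutoff n (tipCoord c t x)) ⊆ (crack R c t)ᶜ := by
  intro x hx
  apply notMem_crack_of_mem_slitPlane hc0 hc1
  apply tsupport_slitCutoff_subset n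
  exact tsupport_comp_subset_preimage _ (contDiff_tipCoord_space c t).continuous hx

/-! ### Integrability of the derivatives of the displacement -/

/-- The squared norm is 1/(4|z|), at most the inverse distance to the tip up to the factor 1/4, and
this is integrable in the plane. After translation by the tip the disc lies in a disc of radius 2R,
so the bound does not depend on time. -/
theorem exists_lintegral_sqrtD1_bound {R T c : ℝ} (hc0 : 0 < c) (hc1 : c < 1)
    (hcT : c * T < R) :
    ∃ M : ℝ≥0∞, M ≠ ⊤ ∧ ∀ t ∈ Icc 0 T,
      ∫⁻ x in Metric.ball (0 : Plane) R, ‖sqrtD1 (tipCoord c t x)‖ₑ ^ (2 : ℝ) ≤ M := by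
  have hi : IntegrableOn (fun x : Plane => 1 / 4 * ‖x‖⁻¹) (Metric.ball 0 (2 * R)) := by
    refine integrableOn_ball_of_norm_le_rpow (C := 1 / 4) (α := 1) (μ := (volume : Measure Plane))
      (by simp) (by simp) (ae_of_all _ fun x => ?_) ?_
    · rw [Real.rpow_neg_one, Real.norm_of_nonneg (by positivity)]
    · exact (Measurable.const_mul (Measurable.inv measurable_norm) (1 / 4 : ℝ)).aestronglyMeasurable
  refine ⟨∫⁻ x in Metric.ball (0 : Plane) (2 * R), ‖1 / 4 * ‖x‖⁻¹‖ₑ, hi.2.ne, fun t ht => ?_⟩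
  set p : Plane := !₂[c * t, 0] with hp
  have hpn : ‖p‖ < R := by
    rw [EuclideanSpace.norm_eq, Fin.sum_univ_two]
    simp only [hp, PiLp.toLp_apply, Matrix.cons_val_zero, Matrix.cons_val_one, norm_zero]
    rw [zero_pow (by norm_num), add_zero, Real.sqrt_sq (norm_nonneg _), Real.norm_eq_abs,
      abs_of_nonneg (mul_nonneg hc0.le ht.1)]
    exact lt_of_le_of_lt (mul_le_mul_of_nonneg_left ht.2 hc0.le) hcT
  rw [← lintegral_indicator Metric.isOpen_ball.measurableSet,
    ← lintegral_indicator Metric.isOpen_ball.measurableSet,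
    ← lintegral_sub_right_eq_self ((Metric.ball (0 : Plane) (2 * R)).indicator _) p]
  apply lintegral_mono_ae
  filter_upwards [ae_tipCoord_mem_slitPlane c t, (measure_eq_zero_iff_ae_notMem.1
    (measure_singleton p) : ∀ᵐ x : Plane, x ∉ ({p} : Set Plane))] with x hx hxp
  by_cases hxR : x ∈ Metric.ball (0 : Plane) R
  · have hxR' : x - p ∈ Metric.ball (0 : Plane) (2 * R) := by
      rw [mem_ball_zero_iff] at *
      linarith [norm_sub_le x p]
    rw [indicator_of_mem hxR, indicator_of_mem hxR']
    rw [← ofReal_norm, ← ofReal_norm, ENNReal.ofReal_rpow_of_nonneg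
      (norm_nonneg _) (by norm_num), Real.rpow_ofNat, norm_sqrtD1_sq,
      Real.norm_of_nonneg (by positivity)]
    apply ENNReal.ofReal_le_ofReal
    have h1 := norm_sub_tip_le (t := t) hc0 hc1 x
    have h2 : 0 < ‖x - p‖ := norm_pos_iff.2 (sub_ne_zero.2 (by simpa using hxp))
    gcongr
  · rw [indicator_of_notMem hxR]
    exact bot_le

theorem lintegral_rpow_le_of_norm_le {R c t C : ℝ} {E : Type*} [NormedAddCommGroup E]
    {F : Plane → E} (hF : ∀ x, ‖F x‖ ≤ C * ‖sqrtD1 (tipCoord c t x)‖) {M : ℝ≥0∞}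
    (hM : ∫⁻ x in Metric.ball (0 : Plane) R, ‖sqrtD1 (tipCoord c t x)‖ₑ ^ (2 : ℝ) ≤ M) :
    ∫⁻ x in Metric.ball (0 : Plane) R, ‖F x‖ₑ ^ (2 : ℝ) ≤ (ENNReal.ofReal |C|) ^ (2 : ℝ) * M := by
  refine le_trans ?_ (mul_le_mul_right hM _)
  rw [← lintegral_const_mul' _ _ (by simp)]
  apply lintegral_mono
  intro x
  simp only
  rw [← ENNReal.mul_rpow_of_nonneg _ _ (by norm_num), ← ofReal_norm,
    ← ofReal_norm, ← ENNReal.ofReal_mul (abs_nonneg _)]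
  gcongr
  exact (hF x).trans (mul_le_mul_of_nonneg_right (le_abs_self C) (norm_nonneg _))

theorem memLp_cyl_of_norm_le {R T c C : ℝ} (hR : 0 < R) (hc0 : 0 < c) (hc1 : c < 1)
    (hcT : c * T < R) {E : Type*} [NormedAddCommGroup E] {F : ℝ → Plane → E}
    (hm : StronglyMeasurable (fun p : ℝ × Plane => F p.1 p.2))
    (hF : ∀ t x, ‖F t x‖ ≤ C * ‖sqrtD1 (tipCoord c t x)‖) :
    MemLp (fun p : ℝ × Plane => F p.1 p.2) 2 (cylMeasure T (Metric.ball 0 R)) := by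
  obtain ⟨M, hM, h⟩ := exists_lintegral_sqrtD1_bound hc0 hc1 hcT
  exact memLp_cyl_of_lintegral_le hm.aestronglyMeasurable
    (ENNReal.mul_ne_top (by simp) hM)
    fun t ht => lintegral_rpow_le_of_norm_le (hF t) (h t (Ioo_subset_Icc_self ht))

theorem memLp_ball_of_norm_le {R T c C t : ℝ} (hR : 0 < R) (hc0 : 0 < c) (hc1 : c < 1)
    (hcT : c * T < R) (ht : t ∈ Icc 0 T) {E : Type*} [NormedAddCommGroup E] {F : ℝ → Plane → E}
    (hm : StronglyMeasurable (fun p : ℝ × Plane => F p.1 p.2))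
    (hF : ∀ t x, ‖F t x‖ ≤ C * ‖sqrtD1 (tipCoord c t x)‖) :
    MemLp (F t) 2 (volume.restrict (Metric.ball 0 R)) := by
  obtain ⟨M, hM, h⟩ := exists_lintegral_sqrtD1_bound hc0 hc1 hcT
  refine ⟨(hm.comp_measurable measurable_prodMk_left).aestronglyMeasurable, ?_⟩
  rw [eLpNorm_lt_top_iff_lintegral_rpow_enorm_lt_top (by norm_num) (by norm_num)]
  simp only [ENNReal.toReal_ofNat]
  exact (lintegral_rpow_le_of_norm_le (hF t) (h t ht)).trans_lt
    (ENNReal.mul_ne_top (by simp) hM).lt_top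

theorem measurable_toLp {X : Type*} [MeasurableSpace X] {f g : X → ℝ} (hf : Measurable f)
    (hg : Measurable g) : Measurable (fun x => (!₂[f x, g x] : Plane)) := by
  apply (PiLp.continuous_toLp 2 _).measurable.comp
  apply measurable_pi_lambda
  intro i
  fin_cases i
  · exact hf
  · exact hg

theorem measurable_velField (c : ℝ) : Measurable fun p : ℝ × Plane => velField c p.1 p.2 :=
  (Complex.measurable_im.comp (measurable_sqrtD1.comp
    (continuous_tipCoord c).measurable)).const_mul _

theorem measurable_accField (c : ℝ) : Measurable fun p : ℝ × Plane => accField c p.1 p.2 :=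
  (Complex.measurable_im.comp (measurable_sqrtD2.comp
    (continuous_tipCoord c).measurable)).const_mul _

theorem measurable_gradField (c : ℝ) : Measurable fun p : ℝ × Plane => gradField c p.1 p.2 :=
  measurable_toLp
    ((Complex.measurable_im.comp (measurable_sqrtD1.comp (continuous_tipCoord c).measurable)).const_mul _)
    ((Complex.measurable_re.comp (measurable_sqrtD1.comp (continuous_tipCoord c).measurable)).const_mul _)

theorem measurable_velGradField (c : ℝ) : Measurable fun p : ℝ × Plane => velGradField c p.1 p.2 :=
  measurable_toLp
    ((Complex.measurable_im.comp (measurable_sqrtD2.comp (continuous_tipCoord c).measurable)).const_mul _)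
    ((Complex.measurable_re.comp (measurable_sqrtD2.comp (continuous_tipCoord c).measurable)).const_mul _)

theorem norm_velField_le (c t : ℝ) (x : Plane) :
    ‖velField c t x‖ ≤ |ampl * (c / alpha c)| * ‖sqrtD1 (tipCoord c t x)‖ := by
  rw [velField, norm_mul, norm_neg, Real.norm_eq_abs, Real.norm_eq_abs]
  gcongr
  exact Complex.abs_im_le_norm _

theorem norm_toLp_le {a b A B N : ℝ} (ha : |a| ≤ N) (hb : |b| ≤ N) :
    ‖(!₂[A * a, B * b] : Plane)‖ ≤ (|A| + |B|) * N := by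
  rw [EuclideanSpace.norm_eq, Fin.sum_univ_two]
  have hN : 0 ≤ N := (abs_nonneg _).trans ha
  apply Real.sqrt_le_iff.2 ⟨by positivity, ?_⟩
  simp only [Matrix.cons_val_zero, Matrix.cons_val_one, Real.norm_eq_abs, abs_mul]
  have h1 : |A| * |a| ≤ |A| * N := mul_le_mul_of_nonneg_left ha (abs_nonneg _)
  have h2 : |B| * |b| ≤ |B| * N := mul_le_mul_of_nonneg_left hb (abs_nonneg _)
  have h3 : 0 ≤ |A| * |a| := by positivity
  have h4 : 0 ≤ |B| * |b| := by positivity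
  nlinarith

theorem norm_gradField_le (c t : ℝ) (x : Plane) :
    ‖gradField c t x‖ ≤ (|ampl / alpha c| + |ampl|) * ‖sqrtD1 (tipCoord c t x)‖ :=
  norm_toLp_le (Complex.abs_im_le_norm _) (Complex.abs_re_le_norm _)

theorem norm_velGradField_le (c t : ℝ) (x : Plane) :
    ‖velGradField c t x‖ ≤ (|-(ampl * (c / alpha c)) / alpha c| + |-(ampl * (c / alpha c))|)
      * ‖sqrtD2 (tipCoord c t x)‖ :=
  norm_toLp_le (Complex.abs_im_le_norm _) (Complex.abs_re_le_norm _)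

section

variable {R T c t : ℝ} (hR : 0 < R) (hc0 : 0 < c) (hc1 : c < 1) (hcT : c * T < R)
include hR hc0 hc1 hcT

theorem memLp_velField :
    MemLp (fun p : ℝ × Plane => velField c p.1 p.2) 2 (cylMeasure T (Metric.ball 0 R)) :=
  memLp_cyl_of_norm_le hR hc0 hc1 hcT (measurable_velField c).stronglyMeasurable
    (norm_velField_le c)

theorem memLp_gradField :
    MemLp (fun p : ℝ × Plane => gradField c p.1 p.2) 2 (cylMeasure T (Metric.ball 0 R)) :=
  memLp_cyl_of_norm_le hR hc0 hc1 hcT (measurable_gradField c).stronglyMeasurable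
    (norm_gradField_le c)

theorem memLp_velField_at (ht : t ∈ Icc 0 T) :
    MemLp (velField c t) 2 (volume.restrict (Metric.ball 0 R)) :=
  memLp_ball_of_norm_le hR hc0 hc1 hcT ht (measurable_velField c).stronglyMeasurable
    (norm_velField_le c)

theorem memLp_gradField_at (ht : t ∈ Icc 0 T) :
    MemLp (gradField c t) 2 (volume.restrict (Metric.ball 0 R)) :=
  memLp_ball_of_norm_le hR hc0 hc1 hcT ht (measurable_gradField c).stronglyMeasurable
    (norm_gradField_le c)

end

/-! ### The wave equation in weak form -/

theorem inner_plane (a b : Plane) : inner ℝ a b = a 0 * b 0 + a 1 * b 1 := by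
  rw [PiLp.inner_apply, Fin.sum_univ_two]
  simp
  ring

theorem integrable_inner_of_memLp {X : Type*} [MeasurableSpace X] {μ : Measure X} {F G : X → Plane}
    (hF : MemLp F 2 μ) (hG : MemLp G 2 μ) : Integrable (fun x => inner ℝ (F x) (G x)) μ := by
  have hc : ∀ {H : X → Plane}, MemLp H 2 μ → ∀ i, MemLp (fun x => H x i) 2 μ :=
    fun hH i => (EuclideanSpace.proj i : Plane →L[ℝ] ℝ).comp_memLp' hH
  simp_rw [inner_plane]
  exact ((hc hF 0).integrable_mul (hc hG 0)).add ((hc hF 1).integrable_mul (hc hG 1))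

theorem fderiv_comp_tipCoord {b : ℂ → ℝ} (hb : ContDiff ℝ ∞ b) (c s : ℝ) (x e : Plane) :
    fderiv ℝ (fun y => b (tipCoord c s y)) x e = fderiv ℝ b (tipCoord c s x) (tipLin c e) := by
  have := ((hb.differentiable (by simp) (tipCoord c s x)).hasFDerivAt).comp x
    (hasFDerivAt_tipCoord c s x)
  rw [show (fun y => b (tipCoord c s y)) = b ∘ tipCoord c s from rfl, this.fderiv]
  rfl

theorem fderiv_real_smul {b : ℂ → ℝ} (z : ℂ) (r : ℝ) :
    fderiv ℝ b z (r : ℂ) = r * fderiv ℝ b z 1 := by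
  rw [← smul_eq_mul, ← map_smul]
  simp

/-- In the z plane the cut-off gradient is divergence free. In the physical plane only the factor
α⁻² - 1 on the first derivative survives, and it equals (c/α)²: the divergence of the cut-off strain
is the time derivative of the cut-off velocity. The wave equation thus holds exactly for the cut-off
fields. -/
theorem inner_gradField_cutoff_test {R c s : ℝ} (hR : 0 < R) (hc0 : 0 < c) (hc1 : c < 1)
    {v : Plane → ℝ} {G : Plane → Plane}
    (h : WeakZeroTrace (Metric.ball 0 R) (crack R c s) v G)
    (hv : IntegrableOn v (Metric.ball 0 R)) (hG : IntegrableOn G (Metric.ball 0 R)) (n : ℕ) :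
    ∫ x in Metric.ball (0 : Plane) R,
      slitCutoff n (tipCoord c s x) * inner ℝ (gradField c s x) (G x)
    = - ∫ x in Metric.ball (0 : Plane) R, ampl * (c / alpha c) ^ 2 *
        fderiv ℝ (fun z => slitCutoff n z * (sqrtD1 z).im) (tipCoord c s x) 1 * v x := by
  set b1 : ℂ → ℝ := fun z => slitCutoff n z * (sqrtD1 z).im with hb1
  set b2 : ℂ → ℝ := fun z => slitCutoff n z * (sqrtD1 z).re with hb2
  have cb1 : ContDiff ℝ ∞ b1 := contDiff_slitCutoff_im n
  have cb2 : ContDiff ℝ ∞ b2 := contDiff_slitCutoff_re n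
  have ca1 : ContDiff ℝ ∞ (fun x => b1 (tipCoord c s x)) := cb1.comp (contDiff_tipCoord_space c s)
  have ca2 : ContDiff ℝ ∞ (fun x => b2 (tipCoord c s x)) := cb2.comp (contDiff_tipCoord_space c s)
  have s1 : tsupport (fun x => b1 (tipCoord c s x)) ⊆ (crack R c s)ᶜ :=
    tsupport_mul_subset_left.trans (tsupport_comp_tipCoord_subset hc0 hc1 n)
  have s2 : tsupport (fun x => b2 (tipCoord c s x)) ⊆ (crack R c s)ᶜ :=
    tsupport_mul_subset_left.trans (tsupport_comp_tipCoord_subset hc0 hc1 n)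
  -- The test function here is smooth already, so the Lipschitz factor is the constant one.
  have hone : LipschitzOnWith 0 (fun _ : Plane => (1 : ℝ)) (Metric.ball 0 R) :=
    (LipschitzWith.const 1).lipschitzOnWith
  have t1 := h.test_mul hR (isClosed_crack R c s) hv hG (ca1.of_le (by simp)) s1 hone 0
  have t2 := h.test_mul hR (isClosed_crack R c s) hv hG (ca2.of_le (by simp)) s2 hone 1
  simp only [mul_one] at t1 t2
  simp_rw [fderiv_comp_tipCoord cb1, tipLin_basis_zero, fderiv_real_smul] at t1
  simp_rw [fderiv_comp_tipCoord cb2, tipLin_basis_one] at t2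
  have hG0 : ∀ i, IntegrableOn (fun x => G x i) (Metric.ball 0 R) := fun i =>
    (EuclideanSpace.proj i : Plane →L[ℝ] ℝ).integrable_comp hG
  have d1 : Continuous fun x => fderiv ℝ b1 (tipCoord c s x) 1 :=
    ((cb1.continuous_fderiv (by simp)).comp (contDiff_tipCoord_space c s).continuous).clm_apply
      continuous_const
  have i1 : IntegrableOn (fun x => G x 0 * b1 (tipCoord c s x)) (Metric.ball 0 R) := by
    simpa [mul_comm] using integrable_ball_mul ca1.continuous (hG0 0)
  have i2 : IntegrableOn (fun x => G x 1 * b2 (tipCoord c s x)) (Metric.ball 0 R) := by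
    simpa [mul_comm] using integrable_ball_mul ca2.continuous (hG0 1)
  have i3 : IntegrableOn (fun x => v x * fderiv ℝ b1 (tipCoord c s x) 1) (Metric.ball 0 R) := by
    simpa [mul_comm] using integrable_ball_mul d1 hv
  have e1 : ∀ x, slitCutoff n (tipCoord c s x) * inner ℝ (gradField c s x) (G x)
      = ampl / alpha c * (G x 0 * b1 (tipCoord c s x)) + ampl * (G x 1 * b2 (tipCoord c s x)) := by
    intro x
    rw [inner_plane]
    simp [gradField, hb1, hb2]
    ring
  have e2 : ∀ x, fderiv ℝ b2 (tipCoord c s x) Complex.I = - fderiv ℝ b1 (tipCoord c s x) 1 :=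
    fun x => by linarith [divergence_slitCutoff n (tipCoord c s x)]
  have e3 : ∀ x, v x * ((√(1 - c ^ 2))⁻¹ * fderiv ℝ b1 (tipCoord c s x) 1)
      = (√(1 - c ^ 2))⁻¹ * (v x * fderiv ℝ b1 (tipCoord c s x) 1) := fun x => by ring
  have e4 : ∀ x, ampl * (c / alpha c) ^ 2 * fderiv ℝ b1 (tipCoord c s x) 1 * v x
      = ampl * (c / alpha c) ^ 2 * (v x * fderiv ℝ b1 (tipCoord c s x) 1) := fun x => by ring
  simp_rw [e2, mul_neg, integral_neg] at t2
  simp_rw [e3, integral_const_mul] at t1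
  simp_rw [e1, e4]
  rw [integral_add (i1.const_mul _) (i2.const_mul _), integral_const_mul, integral_const_mul,
    integral_const_mul]
  have ha := alpha_pos hc0 hc1
  have ha2 := alpha_sq hc0 hc1
  have q1 := neg_eq_iff_eq_neg.2 t1
  have q2 := neg_eq_iff_eq_neg.2 t2
  rw [← q1, ← q2]
  -- The Lorentz relation α² = 1 - c²; this is where the contraction factor is forced by the wave
  -- speed.
  have : (c / alpha c) ^ 2 = (alpha c)⁻¹ ^ 2 - 1 := by
    rw [div_pow, inv_pow, ha2]
    have : (1 - c ^ 2) ≠ 0 := by nlinarith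
    field_simp
    ring
  rw [this]
  simp only [alpha]
  ring

theorem aestronglyMeasurable_cutoff (n : ℕ) (c : ℝ) (μ : Measure (ℝ × Plane)) :
    AEStronglyMeasurable (fun p : ℝ × Plane => slitCutoff n (tipCoord c p.1 p.2)) μ :=
  ((continuous_slitCutoff n).comp (continuous_tipCoord c)).aestronglyMeasurable

theorem aestronglyMeasurable_cutoff_at (n : ℕ) (c s : ℝ) (μ : Measure Plane) :
    AEStronglyMeasurable (fun x : Plane => slitCutoff n (tipCoord c s x)) μ :=
  ((continuous_slitCutoff n).comp (contDiff_tipCoord_space c s).continuous).aestronglyMeasurable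

/-- The weak wave equation, with the end terms in time retained so that it serves both for test
functions vanishing at the ends and for the energy balance. Neither a spatial trace on the crack nor
∇u̇ occurs: the cut-off velocity is smooth, integration by parts in time moves a derivative onto it,
and the cut-off wave equation turns that derivative into the strain term. -/
theorem wave_identity {R T c t : ℝ} (hR : 0 < R) (hT : 0 < T) (hc0 : 0 < c) (hc1 : c < 1)
    (hcT : c * T < R) (ht : t ∈ Icc 0 T) {ψ ψ' : ℝ → Plane → ℝ} {Dψ : ℝ → Plane → Plane}
    (hψ : IsH1Time T (Metric.ball 0 R) ψ ψ')
    (hD : MemLp (fun p : ℝ × Plane => Dψ p.1 p.2) 2 (cylMeasure T (Metric.ball 0 R)))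
    (hz : ∀ᵐ s ∂(volume.restrict (Ioo 0 T)),
      WeakZeroTrace (Metric.ball 0 R) (crack R c s) (ψ s) (Dψ s)) :
    ∫ s in (0 : ℝ)..t, ∫ x in Metric.ball (0 : Plane) R, velField c s x * ψ' s x
      = (∫ x in Metric.ball (0 : Plane) R, velField c t x * ψ t x)
        - (∫ x in Metric.ball (0 : Plane) R, velField c 0 x * ψ 0 x)
        + ∫ s in (0 : ℝ)..t, ∫ x in Metric.ball (0 : Plane) R,
            inner ℝ (gradField c s x) (Dψ s x) := by
  set Ω := Metric.ball (0 : Plane) R with hΩ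
  have hcyl := cylMeasure_mono ht.2 Ω
  have hF1 : Integrable (fun p : ℝ × Plane => velField c p.1 p.2 * ψ' p.1 p.2) (cylMeasure T Ω) :=
    (memLp_velField hR hc0 hc1 hcT).integrable_mul hψ.memLp_deriv
  have hF2 : Integrable (fun p : ℝ × Plane => inner ℝ (gradField c p.1 p.2) (Dψ p.1 p.2))
      (cylMeasure T Ω) := integrable_inner_of_memLp (memLp_gradField hR hc0 hc1 hcT) hD
  have hF3 : ∀ r ∈ Icc 0 T, IntegrableOn (fun x => velField c r x * ψ r x) Ω := fun r hr =>
    (memLp_velField_at hR hc0 hc1 hcT hr).integrable_mul (hψ.memLp_at hT hr)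
  have hm1 : ∀ᵐ p ∂(cylMeasure t Ω), Tendsto (fun n => slitCutoff n (tipCoord c p.1 p.2)) atTop
      (𝓝 1) := by
    filter_upwards [ae_cyl_coord_ne_zero t Ω] with p hp
    exact slitCutoff_tendsto (tipCoord_mem_slitPlane hp)
  have hm2 : ∀ r, ∀ᵐ x ∂(volume.restrict Ω), Tendsto (fun n => slitCutoff n (tipCoord c r x)) atTop
      (𝓝 1) := by
    intro r
    filter_upwards [ae_restrict_of_ae (ae_tipCoord_mem_slitPlane c r)] with x hx
    exact slitCutoff_tendsto hx
  have L1 := tendsto_integral_cutoff (hF1.mono_measure hcyl)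
    (fun n => aestronglyMeasurable_cutoff n c _) (fun n p => norm_slitCutoff_le n _) hm1
  have L2 := tendsto_integral_cutoff (hF2.mono_measure hcyl)
    (fun n => aestronglyMeasurable_cutoff n c _) (fun n p => norm_slitCutoff_le n _) hm1
  have L3 := fun r hr => tendsto_integral_cutoff (hF3 r hr)
    (fun n => aestronglyMeasurable_cutoff_at n c r _) (fun n p => norm_slitCutoff_le n _) (hm2 r)
  have h0 : (0 : ℝ) ∈ Icc 0 T := ⟨le_rfl, hT.le⟩
  rw [integral_time_space (F := fun s x => velField c s x * ψ' s x) ht hF1,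
    integral_time_space (F := fun s x => inner ℝ (gradField c s x) (Dψ s x)) ht hF2]
  -- The identity is exact for every n once the cutoff is inserted in all four terms; dominated
  -- convergence removes it.
  refine tendsto_nhds_unique L1 ((((L3 t ht).sub (L3 0 h0)).add L2).congr fun n => ?_)
  symm
  set b1 : ℂ → ℝ := fun z => slitCutoff n z * (sqrtD1 z).im with hb1
  have cb1 : ContDiff ℝ ∞ b1 := contDiff_slitCutoff_im n
  have ca : Continuous fun p : ℝ × Plane => -(ampl * (c / alpha c)) * b1 (tipCoord c p.1 p.2) :=
    continuous_const.mul (cb1.continuous.comp (continuous_tipCoord c))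
  have ca' : Continuous fun p : ℝ × Plane =>
      ampl * (c / alpha c) ^ 2 * fderiv ℝ b1 (tipCoord c p.1 p.2) 1 :=
    continuous_const.mul (((cb1.continuous_fderiv (by simp)).comp
      (continuous_tipCoord c)).clm_apply continuous_const)
  have hd : ∀ x s, HasDerivAt (fun s => -(ampl * (c / alpha c)) * b1 (tipCoord c s x))
      (ampl * (c / alpha c) ^ 2 * fderiv ℝ b1 (tipCoord c s x) 1) s := by
    intro x s
    have := (((cb1.differentiable (by simp) (tipCoord c s x)).hasFDerivAt).comp_hasDerivAt s
      (hasDerivAt_tipCoord c s x)).const_mul (-(ampl * (c / alpha c)))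
    refine this.congr_deriv ?_
    rw [map_neg, fderiv_real_smul]
    simp only [alpha]
    ring
  have P := hψ.integral_mul_deriv hT ht ca ca' hd
  have e1 : ∀ (r : ℝ) (x : Plane) (y : ℝ), slitCutoff n (tipCoord c r x) * (velField c r x * y)
      = -(ampl * (c / alpha c)) * b1 (tipCoord c r x) * y := by
    intro r x y
    simp only [velField, hb1]
    ring
  simp_rw [e1]
  have j1 : Integrable (fun p : ℝ × Plane => -(ampl * (c / alpha c)) * b1 (tipCoord c p.1 p.2)
      * ψ' p.1 p.2) (cylMeasure T Ω) :=
    integrable_cyl_mul ca (hψ.memLp_deriv.integrable (by norm_num))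
  have j2 : Integrable (fun p : ℝ × Plane => slitCutoff n (tipCoord c p.1 p.2)
      * inner ℝ (gradField c p.1 p.2) (Dψ p.1 p.2)) (cylMeasure T Ω) :=
    integrable_cyl_mul ((continuous_slitCutoff n).comp (continuous_tipCoord c)) hF2
  rw [← integral_time_space (F := fun s x => -(ampl * (c / alpha c)) * b1 (tipCoord c s x)
      * ψ' s x) ht j1, P,
    ← integral_time_space (F := fun s x => slitCutoff n (tipCoord c s x)
      * inner ℝ (gradField c s x) (Dψ s x)) ht j2, sub_eq_add_neg, ← intervalIntegral.integral_neg]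
  congr 1
  rw [intervalIntegral_eq_Ioo ht.1, intervalIntegral_eq_Ioo ht.1]
  apply integral_congr_ae
  have hsub : Ioo 0 t ⊆ Ioo 0 T := Ioo_subset_Ioo_right ht.2
  filter_upwards [ae_restrict_of_ae_restrict_of_subset hsub hz,
    ae_restrict_of_ae_restrict_of_subset hsub (ae_memLp_slice hψ.memLp),
    ae_restrict_of_ae_restrict_of_subset hsub (ae_memLp_slice hD)] with s hs1 hs2 hs3
  rw [inner_gradField_cutoff_test hR hc0 hc1 hs1 (memLp_two_integrableOn hs2)
    (memLp_two_integrableOn hs3)]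

/-! ### The viscosity coefficient -/

section

variable {R T c ε : ℝ} {Ψ : ℝ → Plane → ℝ}

/-- Nothing is known about Ψ outside the closed cylinder. A globally Lipschitz extension gives
access to measurability and to Rademacher's theorem, and it agrees with Ψ near every point of the
open disc. -/
theorem IsAdmissibleViscosity.exists_extension (hΨ : IsAdmissibleViscosity R T c ε Ψ) :
    ∃ (L : ℝ≥0) (Φ : ℝ × Plane → ℝ), LipschitzWith L Φ ∧
      ∀ t ∈ Icc 0 T, ∀ x ∈ Metric.closedBall (0 : Plane) R, Ψ t x = Φ (t, x) := by
  obtain ⟨L, hL⟩ := hΨ.lipschitz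
  obtain ⟨Φ, hΦ, h⟩ := hL.extend_real
  refine ⟨L, Φ, hΦ, fun t ht x hx => ?_⟩
  have hm : ((t, x) : ℝ × Plane) ∈ Icc 0 T ×ˢ Metric.closedBall (0 : Plane) R := mk_mem_prod ht hx
  exact h hm

theorem lipschitzWith_slice {L : ℝ≥0} {Φ : ℝ × Plane → ℝ} (h : LipschitzWith L Φ) (t : ℝ) :
    LipschitzWith L fun x => Φ (t, x) := by
  have := h.comp (LipschitzWith.prodMk_left t)
  rw [mul_one] at this
  exact this

theorem eventuallyEq_slice {Φ : ℝ × Plane → ℝ}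
    (h : ∀ t ∈ Icc 0 T, ∀ x ∈ Metric.closedBall (0 : Plane) R, Ψ t x = Φ (t, x)) {t : ℝ}
    (ht : t ∈ Icc 0 T) {x : Plane} (hx : x ∈ Metric.ball (0 : Plane) R) :
    Ψ t =ᶠ[𝓝 x] fun y => Φ (t, y) := by
  filter_upwards [Metric.isOpen_ball.mem_nhds hx] with y hy
  exact h t ht y (Metric.ball_subset_closedBall hy)

theorem gradient_congr {f g : Plane → ℝ} {x : Plane} (h : f =ᶠ[𝓝 x] g) :
    gradient f x = gradient g x := by
  rw [gradient, gradient, h.fderiv_eq]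

theorem norm_gradient (f : Plane → ℝ) (x : Plane) : ‖gradient f x‖ = ‖fderiv ℝ f x‖ := by
  rw [gradient, LinearIsometryEquiv.norm_map]

theorem measurable_gradient_with_param {Φ : ℝ × Plane → ℝ} (h : Continuous Φ) :
    Measurable fun p : ℝ × Plane => gradient (fun y => Φ (p.1, y)) p.2 := by
  have : Measurable fun p : ℝ × Plane => fderiv ℝ (fun y => Φ (p.1, y)) p.2 :=
    measurable_fderiv_with_param ℝ (f := fun t x => Φ (t, x)) h
  exact (InnerProductSpace.toDual ℝ Plane).symm.continuous.measurable.comp this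

theorem IsAdmissibleViscosity.exists_bounds (hΨ : IsAdmissibleViscosity R T c ε Ψ) :
    ∃ B : ℝ, 0 ≤ B ∧ ∀ t ∈ Icc 0 T, ∀ x ∈ Metric.ball (0 : Plane) R,
      |Ψ t x| ≤ B ∧ ‖gradient (Ψ t) x‖ ≤ B := by
  obtain ⟨L, Φ, hL, h⟩ := hΨ.exists_extension
  obtain ⟨B, hB⟩ := exists_bound_on_cylinder hL.continuous T R
  refine ⟨|B| + L, by positivity, fun t ht x hx => ⟨?_, ?_⟩⟩
  · rw [h t ht x (Metric.ball_subset_closedBall hx)]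
    refine (hB t ht x hx).trans ?_
    have := le_abs_self B
    have := L.coe_nonneg
    linarith
  · rw [gradient_congr (eventuallyEq_slice h ht hx), norm_gradient]
    refine (norm_fderiv_le_of_lipschitz ℝ (lipschitzWith_slice hL t)).trans ?_
    have := abs_nonneg B
    linarith

theorem IsAdmissibleViscosity.eq_zero_of_norm_lt (hΨ : IsAdmissibleViscosity R T c ε Ψ)
    (hc0 : 0 < c) (hc1 : c < 1) {t : ℝ} (ht : t ∈ Icc 0 T) {x : Plane}
    (hx : x ∈ Metric.ball (0 : Plane) R) (h : ‖tipCoord c t x‖ < ε) : Ψ t x = 0 := by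
  apply hΨ.vanishing t ht x (Metric.ball_subset_closedBall hx)
  rw [dist_eq_norm]
  exact (norm_sub_tip_le hc0 hc1 x).trans_lt h

theorem IsAdmissibleViscosity.ae_differentiable (hΨ : IsAdmissibleViscosity R T c ε Ψ) {t : ℝ}
    (ht : t ∈ Icc 0 T) :
    ∀ᵐ x ∂(volume.restrict (Metric.ball (0 : Plane) R)), DifferentiableAt ℝ (Ψ t) x := by
  obtain ⟨L, Φ, hL, h⟩ := hΨ.exists_extension
  filter_upwards [ae_restrict_of_ae (lipschitzWith_slice hL t).ae_differentiableAt,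
    ae_restrict_mem Metric.isOpen_ball.measurableSet] with x hx hxm
  exact hx.congr_of_eventuallyEq (eventuallyEq_slice h ht hxm)

theorem IsAdmissibleViscosity.ae_cyl_differentiable (hΨ : IsAdmissibleViscosity R T c ε Ψ) :
    ∀ᵐ p ∂(cylMeasure T (Metric.ball (0 : Plane) R)), DifferentiableAt ℝ (Ψ p.1) p.2 := by
  obtain ⟨L, Φ, hL, h⟩ := hΨ.exists_extension
  -- Rademacher's theorem is applied in space-time, which gives an exceptional set that is null in
  -- the cylinder at once, with no need to assemble it from time slices.
  have h1 : ∀ᵐ p : ℝ × Plane, DifferentiableAt ℝ Φ p := by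
    have : (volume : Measure (ℝ × Plane)).IsAddHaarMeasure := by
      rw [Measure.volume_eq_prod]; infer_instance
    exact hL.ae_differentiableAt
  filter_upwards [ae_restrict_of_ae h1, ae_cyl_mem Metric.isOpen_ball.measurableSet] with p hp hpm
  have h2 : DifferentiableAt ℝ (fun y => Φ (p.1, y)) p.2 :=
    DifferentiableAt.comp p.2 (f := fun y => (p.1, y)) hp (by fun_prop)
  exact h2.congr_of_eventuallyEq (eventuallyEq_slice h (Ioo_subset_Icc_self hpm.1) hpm.2)

theorem IsAdmissibleViscosity.aestronglyMeasurable (hΨ : IsAdmissibleViscosity R T c ε Ψ) :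
    AEStronglyMeasurable (fun p : ℝ × Plane => Ψ p.1 p.2)
      (cylMeasure T (Metric.ball (0 : Plane) R)) := by
  obtain ⟨L, Φ, hL, h⟩ := hΨ.exists_extension
  refine hL.continuous.aestronglyMeasurable.congr ?_
  filter_upwards [ae_cyl_mem Metric.isOpen_ball.measurableSet] with p hpm
  exact (h p.1 (Ioo_subset_Icc_self hpm.1) p.2 (Metric.ball_subset_closedBall hpm.2)).symm

theorem IsAdmissibleViscosity.aestronglyMeasurable_gradient
    (hΨ : IsAdmissibleViscosity R T c ε Ψ) :
    AEStronglyMeasurable (fun p : ℝ × Plane => gradient (Ψ p.1) p.2)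
      (cylMeasure T (Metric.ball (0 : Plane) R)) := by
  obtain ⟨L, Φ, hL, h⟩ := hΨ.exists_extension
  refine (measurable_gradient_with_param hL.continuous).aestronglyMeasurable.congr ?_
  filter_upwards [ae_cyl_mem Metric.isOpen_ball.measurableSet] with p hpm
  exact (gradient_congr (eventuallyEq_slice h (Ioo_subset_Icc_self hpm.1) hpm.2)).symm

theorem IsAdmissibleViscosity.aestronglyMeasurable_at (hΨ : IsAdmissibleViscosity R T c ε Ψ)
    {t : ℝ} (ht : t ∈ Icc 0 T) :
    AEStronglyMeasurable (Ψ t) (volume.restrict (Metric.ball (0 : Plane) R)) := by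
  obtain ⟨L, Φ, hL, h⟩ := hΨ.exists_extension
  refine (lipschitzWith_slice hL t).continuous.aestronglyMeasurable.congr ?_
  filter_upwards [ae_restrict_mem Metric.isOpen_ball.measurableSet] with x hx
  exact (h t ht x (Metric.ball_subset_closedBall hx)).symm

theorem IsAdmissibleViscosity.aestronglyMeasurable_gradient_at
    (hΨ : IsAdmissibleViscosity R T c ε Ψ) {t : ℝ} (ht : t ∈ Icc 0 T) :
    AEStronglyMeasurable (fun x => gradient (Ψ t) x)
      (volume.restrict (Metric.ball (0 : Plane) R)) := by
  obtain ⟨L, Φ, hL, h⟩ := hΨ.exists_extension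
  refine (((measurable_gradient_with_param hL.continuous).comp
    (measurable_prodMk_left (x := t))).aestronglyMeasurable).congr ?_
  filter_upwards [ae_restrict_mem Metric.isOpen_ball.measurableSet] with x hx
  exact (gradient_congr (eventuallyEq_slice h ht hx)).symm

end

/-! ### The forcing term -/

/-- The Laplacian of the velocity. -/
def velLapField (c t : ℝ) (x : Plane) : ℝ :=
  -(ampl * (c / alpha c)) * ((alpha c)⁻¹ ^ 2 - 1) * (sqrtD3 (tipCoord c t x)).im

theorem measurable_velLapField (c : ℝ) : Measurable fun p : ℝ × Plane => velLapField c p.1 p.2 :=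
  (Complex.measurable_im.comp (measurable_sqrtD3.comp
    (continuous_tipCoord c).measurable)).const_mul _

/-- The expanded form of the forcing term. -/
def forceField (c : ℝ) (Ψ : ℝ → Plane → ℝ) (t : ℝ) (x : Plane) : ℝ :=
  -(inner ℝ (gradient (Ψ t) x) ((2 * Ψ t x) • velGradField c t x))
    - Ψ t x ^ 2 * velLapField c t x

theorem hasFDerivAt_comp_tipCoord_re {h : ℂ → ℂ} {h' : ℂ} {c t : ℝ} {x : Plane}
    (H : HasDerivAt h h' (tipCoord c t x)) :
    HasFDerivAt (fun y => (h (tipCoord c t y)).re)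
      ((Complex.reCLM.comp (h' • (1 : ℂ →L[ℝ] ℂ))).comp (tipLin c)) x :=
  (hasFDerivAt_re_comp H).comp x (hasFDerivAt_tipCoord c t x)

theorem fderiv_velGradField_zero {c t : ℝ} {x : Plane} (hx : tipCoord c t x ∈ Complex.slitPlane) :
    DifferentiableAt ℝ (fun y => velGradField c t y 0) x ∧
    fderiv ℝ (fun y => velGradField c t y 0) x (basisVec 0)
      = -(ampl * (c / alpha c)) * (alpha c)⁻¹ ^ 2 * (sqrtD3 (tipCoord c t x)).im := by
  have := (hasFDerivAt_comp_tipCoord_im (hasDerivAt_sqrtD2 hx)).const_mul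
    (-(ampl * (c / alpha c)) / alpha c)
  refine ⟨this.differentiableAt, ?_⟩
  have e : (fun y => velGradField c t y 0) = fun y => -(ampl * (c / alpha c)) / alpha c *
    (sqrtD2 (tipCoord c t y)).im := by ext y; simp [velGradField]
  rw [e, this.fderiv]
  simp [tipLin_basis_zero]
  simp only [alpha]
  ring

theorem fderiv_velGradField_one {c t : ℝ} {x : Plane} (hx : tipCoord c t x ∈ Complex.slitPlane) :
    DifferentiableAt ℝ (fun y => velGradField c t y 1) x ∧
    fderiv ℝ (fun y => velGradField c t y 1) x (basisVec 1)
      = (ampl * (c / alpha c)) * (sqrtD3 (tipCoord c t x)).im := by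
  have := (hasFDerivAt_comp_tipCoord_re (hasDerivAt_sqrtD2 hx)).const_mul
    (-(ampl * (c / alpha c)))
  refine ⟨this.differentiableAt, ?_⟩
  have e : (fun y => velGradField c t y 1) = fun y => -(ampl * (c / alpha c)) *
    (sqrtD2 (tipCoord c t y)).re := by ext y; simp [velGradField]
  rw [e, this.fderiv]
  simp [tipLin_basis_one]

theorem fderiv_velGradField_add {c t : ℝ} {x : Plane} (hx : tipCoord c t x ∈ Complex.slitPlane) :
    fderiv ℝ (fun y => velGradField c t y 0) x (basisVec 0)
      + fderiv ℝ (fun y => velGradField c t y 1) x (basisVec 1) = velLapField c t x := by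
  rw [(fderiv_velGradField_zero hx).2, (fderiv_velGradField_one hx).2, velLapField]
  ring

theorem laplacian_timeDeriv {c t : ℝ} {x : Plane} (hx : tipCoord c t x ∈ Complex.slitPlane) :
    Laplacian.laplacian (timeDeriv (crackDisplacement c) t) x = velLapField c t x := by
  rw [(InnerProductSpace.laplacian_congr_nhds (timeDeriv_eventuallyEq hx)).eq_of_nhds,
    congrFun (InnerProductSpace.laplacian_eq_iteratedFDeriv_orthonormalBasis (velField c t)
      (EuclideanSpace.basisFun (Fin 2) ℝ)) x, Fin.sum_univ_two, ← fderiv_velGradField_add hx]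
  have hsmooth : ContDiffAt ℝ 2 (velField c t) x := by
    have h1 : ContDiffAt ℝ 2 (fun z => (sqrtD1 z).im) (tipCoord c t x) :=
      Complex.imCLM.contDiff.contDiffAt.comp _ (contDiffAt_infty.1 (contDiffOn_sqrtD1.contDiffAt
        (Complex.isOpen_slitPlane.mem_nhds hx)) 2)
    exact contDiffAt_const.mul (h1.comp x
      (contDiffAt_infty.1 (contDiff_tipCoord_space c t).contDiffAt 2))
  have key : ∀ i : Fin 2, iteratedFDeriv ℝ 2 (velField c t) x
      ![EuclideanSpace.basisFun (Fin 2) ℝ i, EuclideanSpace.basisFun (Fin 2) ℝ i]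
      = fderiv ℝ (fun y => velGradField c t y i) x (basisVec i) := by
    intro i
    rw [iteratedFDeriv_two_apply]
    have hd : DifferentiableAt ℝ (fderiv ℝ (velField c t)) x :=
      (hsmooth.fderiv_right (m := 1) (by norm_num)).differentiableAt (by simp)
    have e : (fun y => velGradField c t y i) =ᶠ[𝓝 x]
        fun y => fderiv ℝ (velField c t) y (basisVec i) := by
      filter_upwards [eventually_tipCoord_mem hx] with y hy
      rw [← gradient_velField hy, gradient_coord]
    rw [e.fderiv_eq, fderiv_clm_apply hd (by fun_prop)]
    simp
  rw [key, key]

/-- The product rule for the divergence. Differentiability of Ψ(t) at the point is what confines the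
expanded form to almost every point, since Ψ is merely Lipschitz. -/
theorem crackForce_eq {c t : ℝ} {Ψ : ℝ → Plane → ℝ} {x : Plane}
    (hx : tipCoord c t x ∈ Complex.slitPlane) (hd : DifferentiableAt ℝ (Ψ t) x) :
    crackForce c Ψ t x = forceField c Ψ t x := by
  have e : (fun y => Ψ t y ^ 2 • gradient (timeDeriv (crackDisplacement c) t) y) =ᶠ[𝓝 x]
      fun y => Ψ t y ^ 2 • velGradField c t y := by
    filter_upwards [eventually_tipCoord_mem hx] with y hy
    rw [gradient_timeDeriv hy]
  have hV : DifferentiableAt ℝ (velGradField c t) x := by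
    rw [differentiableAt_euclidean]
    intro i
    fin_cases i
    · exact (fderiv_velGradField_zero hx).1
    · exact (fderiv_velGradField_one hx).1
  have hF : DifferentiableAt ℝ (fun y => Ψ t y ^ 2 • velGradField c t y) x := (hd.pow 2).smul hV
  have comp : ∀ i : Fin 2, fderiv ℝ (fun y => Ψ t y ^ 2 • velGradField c t y) x (basisVec i) i
      = 2 * Ψ t x * gradient (Ψ t) x i * velGradField c t x i
        + Ψ t x ^ 2 * fderiv ℝ (fun y => velGradField c t y i) x (basisVec i) := by
    intro i
    rw [fderiv_fun_smul (hd.fun_pow 2) hV, fderiv_fun_pow 2 hd, gradient_coord]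
    have h1 : fderiv ℝ (fun y => velGradField c t y i) x (basisVec i)
        = fderiv ℝ (velGradField c t) x (basisVec i) i := by
      have := ((EuclideanSpace.proj i : Plane →L[ℝ] ℝ).hasFDerivAt.comp x hV.hasFDerivAt).fderiv
      rw [show (fun y => velGradField c t y i)
        = (EuclideanSpace.proj i : Plane →L[ℝ] ℝ) ∘ velGradField c t from rfl, this]
      rfl
    rw [h1]
    simp
    ring
  rw [crackForce, divergence]
  simp_rw [e.fderiv_eq]
  rw [Fin.sum_univ_two, comp, comp, forceField, inner_plane, ← fderiv_velGradField_add hx]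
  simp only [PiLp.smul_apply, smul_eq_mul]
  ring

/-! ### Bounds away from the crack tip -/

theorem deriv_smoothTransition_of_neg {y : ℝ} (hy : y < 0) : deriv Real.smoothTransition y = 0 := by
  have : Real.smoothTransition =ᶠ[𝓝 y] fun _ => 0 := by
    filter_upwards [Iio_mem_nhds hy] with z hz
    exact Real.smoothTransition.zero_of_nonpos (le_of_lt hz)
  rw [this.deriv_eq]
  simp

theorem deriv_smoothTransition_of_one_lt {y : ℝ} (hy : 1 < y) :
    deriv Real.smoothTransition y = 0 := by
  have : Real.smoothTransition =ᶠ[𝓝 y] fun _ => 1 := by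
    filter_upwards [Ioi_mem_nhds hy] with z hz
    exact Real.smoothTransition.one_of_one_le (le_of_lt hz)
  rw [this.deriv_eq]
  simp

/-- Meant for y = n Re √z - 1, where y + 1 = n Re √z. The derivative lives on 0 ≤ y ≤ 1, so the
large factor n is harmless as soon as it comes with a factor Re √z. -/
theorem exists_bound_deriv_smoothTransition :
    ∃ M : ℝ, 0 ≤ M ∧ ∀ y : ℝ, |deriv Real.smoothTransition y * (y + 1)| ≤ M := by
  have hc : Continuous fun y : ℝ => deriv Real.smoothTransition y * (y + 1) :=
    ((Real.smoothTransition.contDiff (n := 1)).continuous_deriv le_rfl).mul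
      (continuous_id.add continuous_const)
  obtain ⟨M, hM⟩ := (isCompact_Icc (a := (0 : ℝ)) (b := 1)).exists_bound_of_continuousOn
    hc.continuousOn
  refine ⟨|M|, abs_nonneg _, fun y => ?_⟩
  by_cases h0 : y < 0
  · simp [deriv_smoothTransition_of_neg h0]
  by_cases h1 : 1 < y
  · simp [deriv_smoothTransition_of_one_lt h1]
  · exact (hM y ⟨not_lt.1 h0, not_lt.1 h1⟩).trans (le_abs_self M)

theorem re_sqrtD1 (z : ℂ) : (sqrtD1 z).re = (Complex.sqrt z).re / (2 * ‖z‖) := by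
  rw [sqrtD1, Complex.inv_re, Complex.normSq_eq_norm_sq, norm_mul, mul_pow, norm_sqrt_sq]
  simp
  by_cases h : ‖z‖ = 0
  · simp [h]
  · field_simp

/-- With w = √z one has Re w³ = Re w · ((Re w)² - 3 (Im w)²). The factor Re w is the Neumann
condition of the velocity in quantitative form: its normal derivative vanishes at the slit at the
rate of Re √z. The remaining factor is at most 3|z| in absolute value. -/
theorem abs_re_sqrtD2_le {z : ℂ} :
    |(sqrtD2 z).re| ≤ (Complex.sqrt z).re * (4 * ‖z‖) / (4 * ‖z‖ ^ 3) := by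
  set w := Complex.sqrt z with hw
  have hn : ‖w‖ ^ 2 = ‖z‖ := norm_sqrt_sq z
  have hre : 0 ≤ w.re := re_sqrt_nonneg z
  have h1 : (sqrtD2 z).re = - (w.re * (w.re ^ 2 - 3 * w.im ^ 2)) / (4 * ‖z‖ ^ 3) := by
    rw [sqrtD2, ← hw, Complex.neg_re, Complex.inv_re, Complex.normSq_eq_norm_sq, norm_mul, norm_pow]
    have : (‖(4 : ℂ)‖ * ‖w‖ ^ 3) ^ 2 = 16 * ‖z‖ ^ 3 := by
      rw [← hn]
      simp
      ring
    rw [this]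
    have : (4 * w ^ 3).re = 4 * (w.re * (w.re ^ 2 - 3 * w.im ^ 2)) := by
      simp [pow_succ]
      ring
    rw [this]
    by_cases h : ‖z‖ = 0
    · simp [h]
    · field_simp
      norm_num
      ring
  rw [h1, abs_div, abs_neg, abs_mul, abs_of_nonneg hre, abs_of_nonneg (by positivity : 0 ≤ 4 * ‖z‖ ^ 3)]
  gcongr
  have h2 : w.re ^ 2 + w.im ^ 2 = ‖z‖ := by
    rw [← hn, Complex.sq_norm, Complex.normSq_apply]
    ring
  rw [abs_le]
  constructor <;> nlinarith [sq_nonneg w.re, sq_nonneg w.im]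

/-- The gradients of the cutoff functions are almost orthogonal to the gradient of the velocity
away from the crack tip. -/
theorem exists_cutoff_cross_bound {ε : ℝ} (hε : 0 < ε) (A : ℝ) :
    ∃ K : ℝ, ∀ (n : ℕ) (z : ℂ), ε ≤ ‖z‖ →
      |deriv Real.smoothTransition (n * (Complex.sqrt z).re - 1) * n *
        ((sqrtD1 z).re * (sqrtD2 z).im * A - (sqrtD1 z).im * (sqrtD2 z).re)| ≤ K := by
  obtain ⟨M, hM0, hM⟩ := exists_bound_deriv_smoothTransition
  set K1 := 1 / (2 * ε) * (4 * √ε ^ 3)⁻¹ * |A| + (2 * √ε)⁻¹ * (1 / ε ^ 2) with hK1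
  refine ⟨M * K1, fun n z hz => ?_⟩
  have hz0 : 0 < ‖z‖ := hε.trans_le hz
  set C := (Complex.sqrt z).re with hC
  have hC0 : 0 ≤ C := re_sqrt_nonneg z
  have b1 : |(sqrtD1 z).re| ≤ C * (1 / (2 * ε)) := by
    rw [re_sqrtD1, abs_of_nonneg (by positivity), ← hC, mul_one_div]
    gcongr
  have b2 : |(sqrtD2 z).im| ≤ (4 * √ε ^ 3)⁻¹ :=
    (Complex.abs_im_le_norm _).trans (norm_sqrtD2_le hε hz)
  have b3 : |(sqrtD1 z).im| ≤ (2 * √ε)⁻¹ :=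
    (Complex.abs_im_le_norm _).trans (norm_sqrtD1_le hε hz)
  have b4 : |(sqrtD2 z).re| ≤ C * (1 / ε ^ 2) := by
    refine abs_re_sqrtD2_le.trans ?_
    rw [← hC]
    have : C * (4 * ‖z‖) / (4 * ‖z‖ ^ 3) = C * (1 / ‖z‖ ^ 2) := by
      field_simp
    rw [this]
    gcongr
  -- Each of the two products contains one factor that is O(C) with C = Re √z, the first through
  -- `sqrtD1` and the second through `sqrtD2`. This is the factor that absorbs n.
  have b5 : |(sqrtD1 z).re * (sqrtD2 z).im * A - (sqrtD1 z).im * (sqrtD2 z).re| ≤ C * K1 := by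
    refine (abs_sub _ _).trans ?_
    rw [abs_mul, abs_mul, abs_mul]
    calc _ ≤ C * (1 / (2 * ε)) * (4 * √ε ^ 3)⁻¹ * |A| + (2 * √ε)⁻¹ * (C * (1 / ε ^ 2)) := by
          gcongr
      _ = C * K1 := by rw [hK1]; ring
  have hK0 : 0 ≤ K1 := by positivity
  rw [abs_mul, abs_mul, Nat.abs_cast]
  have hM' := hM (n * C - 1)
  rw [sub_add_cancel, abs_mul, abs_of_nonneg (by positivity : 0 ≤ n * C)] at hM'
  calc _ ≤ |deriv Real.smoothTransition (n * C - 1)| * n * (C * K1) := by gcongr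
    _ = |deriv Real.smoothTransition (n * C - 1)| * (n * C) * K1 := by ring
    _ ≤ M * K1 := by gcongr

theorem deriv_cutoff_eventually_zero {z : ℂ} (hz : z ∈ Complex.slitPlane) :
    ∀ᶠ n : ℕ in atTop, deriv Real.smoothTransition (n * (Complex.sqrt z).re - 1) = 0 := by
  have h0 := re_sqrt_pos_iff.2 hz
  obtain ⟨N, hN⟩ := exists_nat_gt (2 / (Complex.sqrt z).re)
  filter_upwards [eventually_ge_atTop N] with n hn
  apply deriv_smoothTransition_of_one_lt
  have h1 : 2 / (Complex.sqrt z).re < n := hN.trans_le (by exact_mod_cast hn)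
  rw [div_lt_iff₀ h0] at h1
  linarith

section

variable {R T c ε : ℝ} {Ψ : ℝ → Plane → ℝ} (hΨ : IsAdmissibleViscosity R T c ε Ψ)
  (hc0 : 0 < c) (hc1 : c < 1) (hε : 0 < ε)
include hΨ hc0 hc1 hε

/-- Where |z| < ε the coefficient Ψ vanishes, and where |z| ≥ ε every derivative of √z is bounded.
The singularity of the displacement is therefore never seen by the flux, by the force or by Ψu̇. -/
theorem exists_viscous_bounds :
    ∃ B : ℝ, 0 ≤ B ∧ ∀ t ∈ Icc 0 T, ∀ x ∈ Metric.ball (0 : Plane) R,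
      ‖Ψ t x • velGradField c t x‖ ≤ B ∧ ‖Ψ t x ^ 2 • velGradField c t x‖ ≤ B ∧
      |forceField c Ψ t x| ≤ B ∧ |Ψ t x * velField c t x| ≤ B ∧
      ‖velField c t x • gradient (Ψ t) x‖ ≤ B * ‖sqrtD1 (tipCoord c t x)‖ := by
  obtain ⟨B, hB0, hB⟩ := hΨ.exists_bounds
  set N1 := |ampl * (c / alpha c)| * (2 * √ε)⁻¹ with hN1
  set N2 := (|-(ampl * (c / alpha c)) / alpha c| + |-(ampl * (c / alpha c))|) * (4 * √ε ^ 3)⁻¹ with hN2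
  set N3 := |-(ampl * (c / alpha c)) * ((alpha c)⁻¹ ^ 2 - 1)| * (3 * (8 * √ε ^ 5)⁻¹) with hN3
  have h1 : 0 ≤ N1 := by positivity
  have h2 : 0 ≤ N2 := by positivity
  have h3 : 0 ≤ N3 := by positivity
  set N4 := |ampl * (c / alpha c)| with hN4
  have h4 : 0 ≤ N4 := abs_nonneg _
  refine ⟨B * N2 + B ^ 2 * N2 + (2 * B * (B * N2) + B ^ 2 * N3) + B * N1 + B * N4,
    by positivity, fun t ht x hx => ?_⟩
  obtain ⟨hb, hg⟩ := hB t ht x hx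
  have p1 : 0 ≤ B * N2 := by positivity
  have p2 : 0 ≤ B ^ 2 * N2 := by positivity
  have p3 : 0 ≤ 2 * B * (B * N2) := by positivity
  have p4 : 0 ≤ B ^ 2 * N3 := by positivity
  have p5 : 0 ≤ B * N1 := by positivity
  have p6 : 0 ≤ B * N4 := by positivity
  have last : ‖velField c t x • gradient (Ψ t) x‖
      ≤ (B * N2 + B ^ 2 * N2 + (2 * B * (B * N2) + B ^ 2 * N3) + B * N1 + B * N4)
        * ‖sqrtD1 (tipCoord c t x)‖ := by
    rw [norm_smul]
    calc _ ≤ N4 * ‖sqrtD1 (tipCoord c t x)‖ * B :=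
          mul_le_mul (norm_velField_le c t x) hg (norm_nonneg _) (by positivity)
      _ = B * N4 * ‖sqrtD1 (tipCoord c t x)‖ := by ring
      _ ≤ _ := by
        gcongr
        linarith
  by_cases hz : ‖tipCoord c t x‖ < ε
  · have h0 := hΨ.eq_zero_of_norm_lt hc0 hc1 ht hx hz
    refine ⟨?_, ?_, ?_, ?_, last⟩
    · rw [h0, zero_smul, norm_zero]; positivity
    · rw [h0, zero_pow (by norm_num), zero_smul, norm_zero]; positivity
    · simp only [forceField, h0, mul_zero, zero_smul, inner_zero_right]
      simp
      positivity
    · rw [h0, zero_mul, abs_zero]; positivity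
  · have hz' := not_lt.1 hz
    have v1 : |velField c t x| ≤ N1 := by
      refine (norm_velField_le c t x).trans ?_
      exact mul_le_mul_of_nonneg_left (norm_sqrtD1_le hε hz') (abs_nonneg _)
    have v2 : ‖velGradField c t x‖ ≤ N2 := by
      refine (norm_velGradField_le c t x).trans ?_
      exact mul_le_mul_of_nonneg_left (norm_sqrtD2_le hε hz') (by positivity)
    have v3 : |velLapField c t x| ≤ N3 := by
      rw [velLapField, abs_mul]
      exact mul_le_mul_of_nonneg_left
        ((Complex.abs_im_le_norm _).trans (norm_sqrtD3_le hε hz')) (abs_nonneg _)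
    have e1 : ‖Ψ t x • velGradField c t x‖ ≤ B * N2 := by
      rw [norm_smul]
      exact mul_le_mul hb v2 (norm_nonneg _) hB0
    have hb2 : |Ψ t x ^ 2| ≤ B ^ 2 := by
      rw [abs_pow]
      gcongr
    have e2 : ‖Ψ t x ^ 2 • velGradField c t x‖ ≤ B ^ 2 * N2 := by
      rw [norm_smul]
      exact mul_le_mul hb2 v2 (norm_nonneg _) (by positivity)
    have e3 : |forceField c Ψ t x| ≤ 2 * B * (B * N2) + B ^ 2 * N3 := by
      rw [forceField]
      refine (abs_sub _ _).trans (add_le_add ?_ ?_)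
      · rw [abs_neg, mul_smul]
        refine (abs_real_inner_le_norm _ _).trans ?_
        rw [norm_smul, Real.norm_ofNat]
        calc ‖gradient (Ψ t) x‖ * (2 * ‖Ψ t x • velGradField c t x‖) ≤ B * (2 * (B * N2)) := by
              gcongr
          _ = _ := by ring
      · rw [abs_mul]
        exact mul_le_mul hb2 v3 (abs_nonneg _) (by positivity)
    have e4 : |Ψ t x * velField c t x| ≤ B * N1 := by
      rw [abs_mul]
      exact mul_le_mul hb v1 (abs_nonneg _) hB0
    exact ⟨by linarith, by linarith, by linarith, by linarith, last⟩

theorem memLp_forceField {p : ℝ≥0∞} :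
    MemLp (fun q : ℝ × Plane => forceField c Ψ q.1 q.2) p (cylMeasure T (Metric.ball 0 R)) := by
  obtain ⟨B, _, hB⟩ := exists_viscous_bounds hΨ hc0 hc1 hε
  refine memLp_cyl_of_bound ?_ B ?_
  · refine AEStronglyMeasurable.sub (AEStronglyMeasurable.neg ?_) ?_
    · exact hΨ.aestronglyMeasurable_gradient.inner ((hΨ.aestronglyMeasurable.const_mul 2).smul
        (measurable_velGradField c).aestronglyMeasurable)
    · exact (hΨ.aestronglyMeasurable.pow 2).mul (measurable_velLapField c).aestronglyMeasurable
  · filter_upwards [ae_cyl_mem Metric.isOpen_ball.measurableSet] with q hq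
    exact (hB q.1 (Ioo_subset_Icc_self hq.1) q.2 hq.2).2.2.1

theorem memLp_viscous {p : ℝ≥0∞} :
    MemLp (fun q : ℝ × Plane => Ψ q.1 q.2 • velGradField c q.1 q.2) p
      (cylMeasure T (Metric.ball 0 R)) := by
  obtain ⟨B, _, hB⟩ := exists_viscous_bounds hΨ hc0 hc1 hε
  refine memLp_cyl_of_bound ?_ B ?_
  · exact hΨ.aestronglyMeasurable.smul (measurable_velGradField c).aestronglyMeasurable
  · filter_upwards [ae_cyl_mem Metric.isOpen_ball.measurableSet] with q hq
    exact (hB q.1 (Ioo_subset_Icc_self hq.1) q.2 hq.2).1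

theorem memLp_viscosity_mul_velField {p : ℝ≥0∞} :
    MemLp (fun q : ℝ × Plane => Ψ q.1 q.2 * velField c q.1 q.2) p
      (cylMeasure T (Metric.ball 0 R)) := by
  obtain ⟨B, _, hB⟩ := exists_viscous_bounds hΨ hc0 hc1 hε
  refine memLp_cyl_of_bound ?_ B ?_
  · exact hΨ.aestronglyMeasurable.mul (measurable_velField c).aestronglyMeasurable
  · filter_upwards [ae_cyl_mem Metric.isOpen_ball.measurableSet] with q hq
    exact (hB q.1 (Ioo_subset_Icc_self hq.1) q.2 hq.2).2.2.2.1

end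

theorem IsAdmissibleViscosity.lipschitzOn_sq {R T c ε : ℝ} {Ψ : ℝ → Plane → ℝ}
    (hΨ : IsAdmissibleViscosity R T c ε Ψ) {t : ℝ} (ht : t ∈ Icc 0 T) :
    ∃ C : ℝ≥0, LipschitzOnWith C (fun x => Ψ t x ^ 2) (Metric.ball (0 : Plane) R) := by
  obtain ⟨L, Φ, hL, h⟩ := hΨ.exists_extension
  obtain ⟨B, hB0, hB⟩ := hΨ.exists_bounds
  refine ⟨⟨2 * B * L, by positivity⟩, LipschitzOnWith.of_dist_le_mul fun x hx y hy => ?_⟩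
  show _ ≤ 2 * B * L * dist x y
  have h1 := (lipschitzWith_slice hL t).dist_le_mul x y
  rw [← h t ht x (Metric.ball_subset_closedBall hx), ← h t ht y (Metric.ball_subset_closedBall hy),
    Real.dist_eq] at h1
  have hx' := (hB t ht x hx).1
  have hy' := (hB t ht y hy).1
  rw [Real.dist_eq, sq_sub_sq, abs_mul]
  calc |Ψ t x + Ψ t y| * |Ψ t x - Ψ t y| ≤ (B + B) * (L * dist x y) := by
        gcongr
        exact (abs_add_le _ _).trans (add_le_add hx' hy')
    _ = _ := by ring

theorem contDiff_slitCutoff_im2 (n : ℕ) :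
    ContDiff ℝ ∞ fun z => slitCutoff n z * (sqrtD2 z).im :=
  contDiff_slitCutoff_mul n (Complex.imCLM.contDiff.comp_contDiffOn contDiffOn_sqrtD2)

theorem contDiff_slitCutoff_re2 (n : ℕ) :
    ContDiff ℝ ∞ fun z => slitCutoff n z * (sqrtD2 z).re :=
  contDiff_slitCutoff_mul n (Complex.reCLM.contDiff.comp_contDiffOn contDiffOn_sqrtD2)

theorem contDiff_cutoff_velGradField (n : ℕ) (c t : ℝ) (i : Fin 2) :
    ContDiff ℝ ∞ fun x => slitCutoff n (tipCoord c t x) * velGradField c t x i := by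
  have h1 := (contDiff_slitCutoff_im2 n).comp (contDiff_tipCoord_space c t)
  have h2 := (contDiff_slitCutoff_re2 n).comp (contDiff_tipCoord_space c t)
  fin_cases i
  · have e : (fun x => slitCutoff n (tipCoord c t x) * velGradField c t x 0) = fun x =>
        -(ampl * (c / alpha c)) / alpha c *
          (slitCutoff n (tipCoord c t x) * (sqrtD2 (tipCoord c t x)).im) := by
      funext x
      simp only [velGradField, PiLp.toLp_apply, Matrix.cons_val_zero]
      ring
    exact e ▸ contDiff_const.mul h1
  · have e : (fun x => slitCutoff n (tipCoord c t x) * velGradField c t x 1) = fun x =>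
        -(ampl * (c / alpha c)) *
          (slitCutoff n (tipCoord c t x) * (sqrtD2 (tipCoord c t x)).re) := by
      funext x
      simp only [velGradField, PiLp.toLp_apply, Matrix.cons_val_one, Matrix.cons_val_zero]
      ring
    exact e ▸ contDiff_const.mul h2

theorem fderiv_slitCutoff_tipCoord {n : ℕ} {c t : ℝ} {x : Plane}
    (hx : tipCoord c t x ∈ Complex.slitPlane) (e : Plane) :
    fderiv ℝ (fun y => slitCutoff n (tipCoord c t y)) x e
      = deriv Real.smoothTransition (n * (Complex.sqrt (tipCoord c t x)).re - 1) * n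
        * (sqrtD1 (tipCoord c t x) * tipLin c e).re := by
  rw [fderiv_comp_tipCoord (contDiff_slitCutoff n), (hasFDerivAt_slitCutoff n hx).fderiv]
  simp

/-- The part of the divergence of the cut off viscous flux which comes from the cutoff. -/
def cutoffCross (n : ℕ) (c : ℝ) (Ψ : ℝ → Plane → ℝ) (t : ℝ) (x : Plane) : ℝ :=
  Ψ t x ^ 2 * (-(ampl * (c / alpha c)) *
    (deriv Real.smoothTransition (n * (Complex.sqrt (tipCoord c t x)).re - 1) * n *
      ((sqrtD1 (tipCoord c t x)).re * (sqrtD2 (tipCoord c t x)).im * (alpha c)⁻¹ ^ 2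
        - (sqrtD1 (tipCoord c t x)).im * (sqrtD2 (tipCoord c t x)).re)))

theorem measurable_cutoffCross_factor (n : ℕ) (c t : ℝ) : Measurable fun x : Plane =>
    -(ampl * (c / alpha c)) *
    (deriv Real.smoothTransition (n * (Complex.sqrt (tipCoord c t x)).re - 1) * n *
      ((sqrtD1 (tipCoord c t x)).re * (sqrtD2 (tipCoord c t x)).im * (alpha c)⁻¹ ^ 2
        - (sqrtD1 (tipCoord c t x)).im * (sqrtD2 (tipCoord c t x)).re)) := by
  have hZ : Measurable (tipCoord c t) := (contDiff_tipCoord_space c t).continuous.measurable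
  have h1 := measurable_sqrtD1.comp hZ
  have h2 := measurable_sqrtD2.comp hZ
  have h0 := measurable_sqrt.comp hZ
  have hd : Measurable (deriv Real.smoothTransition) := measurable_deriv _
  have e1 := Complex.measurable_re.comp h1
  have e2 := Complex.measurable_im.comp h1
  have e3 := Complex.measurable_re.comp h2
  have e4 := Complex.measurable_im.comp h2
  have e0 := hd.comp (((Complex.measurable_re.comp h0).const_mul (n : ℝ)).sub_const 1)
  exact ((e0.mul_const _).mul (((e1.mul e4).mul_const _).sub (e2.mul e3))).const_mul _

/-- The product rule for the cut-off flux: what falls on the cutoff is collected in `cutoffCross`,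
and what falls on Ψ² or on the velocity gradient reassembles into minus the cut-off force. -/
theorem viscous_divergence {c : ℝ} {Ψ : ℝ → Plane → ℝ} {t : ℝ} {n : ℕ} {x : Plane}
    (hx : tipCoord c t x ∈ Complex.slitPlane) :
    (fderiv ℝ (fun y => slitCutoff n (tipCoord c t y) * velGradField c t y 0) x (basisVec 0)
        * Ψ t x ^ 2
      + slitCutoff n (tipCoord c t x) * velGradField c t x 0 * (2 * Ψ t x * gradient (Ψ t) x 0))
    + (fderiv ℝ (fun y => slitCutoff n (tipCoord c t y) * velGradField c t y 1) x (basisVec 1)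
        * Ψ t x ^ 2
      + slitCutoff n (tipCoord c t x) * velGradField c t x 1 * (2 * Ψ t x * gradient (Ψ t) x 1))
    = cutoffCross n c Ψ t x - slitCutoff n (tipCoord c t x) * forceField c Ψ t x := by
  have hm : DifferentiableAt ℝ (fun y => slitCutoff n (tipCoord c t y)) x :=
    ((contDiff_slitCutoff n).comp (contDiff_tipCoord_space c t)).differentiable (by simp) x
  have p0 : fderiv ℝ (fun y => slitCutoff n (tipCoord c t y) * velGradField c t y 0) x (basisVec 0)
      = slitCutoff n (tipCoord c t x) * fderiv ℝ (fun y => velGradField c t y 0) x (basisVec 0)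
        + velGradField c t x 0 *
          fderiv ℝ (fun y => slitCutoff n (tipCoord c t y)) x (basisVec 0) := by
    rw [fderiv_fun_mul hm (fderiv_velGradField_zero hx).1]
    simp
  have p1 : fderiv ℝ (fun y => slitCutoff n (tipCoord c t y) * velGradField c t y 1) x (basisVec 1)
      = slitCutoff n (tipCoord c t x) * fderiv ℝ (fun y => velGradField c t y 1) x (basisVec 1)
        + velGradField c t x 1 *
          fderiv ℝ (fun y => slitCutoff n (tipCoord c t y)) x (basisVec 1) := by
    rw [fderiv_fun_mul hm (fderiv_velGradField_one hx).1]
    simp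
  rw [p0, p1, fderiv_slitCutoff_tipCoord hx, fderiv_slitCutoff_tipCoord hx, tipLin_basis_zero,
    tipLin_basis_one, forceField, inner_plane, ← fderiv_velGradField_add hx, cutoffCross]
  have r0 : (sqrtD1 (tipCoord c t x) * (((√(1 - c ^ 2))⁻¹ : ℝ) : ℂ)).re
      = (sqrtD1 (tipCoord c t x)).re * (alpha c)⁻¹ := by
    rw [Complex.re_mul_ofReal]
  have r1 : (sqrtD1 (tipCoord c t x) * Complex.I).re = - (sqrtD1 (tipCoord c t x)).im := by simp
  rw [r0, r1]
  have v0 : velGradField c t x 0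
      = -(ampl * (c / alpha c)) / alpha c * (sqrtD2 (tipCoord c t x)).im := by simp [velGradField]
  have v1 : velGradField c t x 1
      = -(ampl * (c / alpha c)) * (sqrtD2 (tipCoord c t x)).re := by simp [velGradField]
  simp only [PiLp.smul_apply, smul_eq_mul]
  rw [v0, v1]
  ring


/-! ### Balance of the viscous flux and the force -/

section ViscousIdentity

variable {R T c ε : ℝ} {Ψ : ℝ → Plane → ℝ} {t : ℝ} {v : Plane → ℝ} {G : Plane → Plane}

theorem IsAdmissibleViscosity.integrableOn_sq_mul (hΨ : IsAdmissibleViscosity R T c ε Ψ)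
    (ht : t ∈ Icc 0 T) (hv : IntegrableOn v (Metric.ball 0 R)) :
    IntegrableOn (fun x => Ψ t x ^ 2 * v x) (Metric.ball 0 R) := by
  obtain ⟨B, hB0, hB⟩ := hΨ.exists_bounds
  refine Integrable.bdd_mul (c := B ^ 2) hv ((hΨ.aestronglyMeasurable_at ht).pow 2) ?_
  filter_upwards [ae_restrict_mem Metric.isOpen_ball.measurableSet] with x hx
  rw [norm_pow]
  exact pow_le_pow_left₀ (norm_nonneg _) (hB t ht x hx).1 2

theorem IsAdmissibleViscosity.integrableOn_gradient_sq_mul (hΨ : IsAdmissibleViscosity R T c ε Ψ)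
    (ht : t ∈ Icc 0 T) (hv : IntegrableOn v (Metric.ball 0 R)) (i : Fin 2) :
    IntegrableOn (fun x => 2 * Ψ t x * gradient (Ψ t) x i * v x) (Metric.ball 0 R) := by
  obtain ⟨B, hB0, hB⟩ := hΨ.exists_bounds
  refine Integrable.bdd_mul (c := 2 * B * B) hv ?_ ?_
  · exact ((hΨ.aestronglyMeasurable_at ht).const_mul 2).mul
      ((EuclideanSpace.proj i : Plane →L[ℝ] ℝ).continuous.comp_aestronglyMeasurable
        (hΨ.aestronglyMeasurable_gradient_at ht))
  · filter_upwards [ae_restrict_mem Metric.isOpen_ball.measurableSet] with x hx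
    obtain ⟨h1, h2⟩ := hB t ht x hx
    rw [norm_mul, norm_mul, Real.norm_ofNat]
    gcongr
    · exact h1
    · exact (PiLp.norm_apply_le _ i).trans h2


theorem measurable_velGradField_at (c t : ℝ) : Measurable fun x => velGradField c t x :=
  Measurable.comp (g := fun p : ℝ × Plane => velGradField c p.1 p.2) (measurable_velGradField c)
    (f := fun x => (t, x)) measurable_prodMk_left

theorem measurable_velLapField_at (c t : ℝ) : Measurable fun x => velLapField c t x :=
  Measurable.comp (g := fun p : ℝ × Plane => velLapField c p.1 p.2) (measurable_velLapField c)
    (f := fun x => (t, x)) measurable_prodMk_left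

theorem IsAdmissibleViscosity.aestronglyMeasurable_forceField_at
    (hΨ : IsAdmissibleViscosity R T c ε Ψ) (ht : t ∈ Icc 0 T) :
    AEStronglyMeasurable (forceField c Ψ t) (volume.restrict (Metric.ball 0 R)) := by
  have hΨm := hΨ.aestronglyMeasurable_at ht
  refine AEStronglyMeasurable.sub (AEStronglyMeasurable.neg ?_) ?_
  · exact (hΨ.aestronglyMeasurable_gradient_at ht).inner
      ((hΨm.const_mul 2).smul (measurable_velGradField_at c t).aestronglyMeasurable)
  · exact (hΨm.pow 2).mul
      (measurable_velLapField_at c t).aestronglyMeasurable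

theorem IsAdmissibleViscosity.integrableOn_forceField_mul (hΨ : IsAdmissibleViscosity R T c ε Ψ)
    (hc0 : 0 < c) (hc1 : c < 1) (hε : 0 < ε)
    (ht : t ∈ Icc 0 T) (hv : IntegrableOn v (Metric.ball 0 R)) :
    IntegrableOn (fun x => forceField c Ψ t x * v x) (Metric.ball 0 R) := by
  obtain ⟨B', hB'0, hB'⟩ := exists_viscous_bounds hΨ hc0 hc1 hε
  refine Integrable.bdd_mul (c := B') hv (hΨ.aestronglyMeasurable_forceField_at ht) ?_
  filter_upwards [ae_restrict_mem Metric.isOpen_ball.measurableSet] with x hx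
  exact (hB' t ht x hx).2.2.1

theorem IsAdmissibleViscosity.integrableOn_inner_sq_smul (hΨ : IsAdmissibleViscosity R T c ε Ψ)
    (hc0 : 0 < c) (hc1 : c < 1) (hε : 0 < ε)
    (ht : t ∈ Icc 0 T) (hG : IntegrableOn G (Metric.ball 0 R)) :
    IntegrableOn (fun x => inner ℝ (Ψ t x ^ 2 • velGradField c t x) (G x)) (Metric.ball 0 R) := by
  obtain ⟨B', hB'0, hB'⟩ := exists_viscous_bounds hΨ hc0 hc1 hε
  refine Integrable.mono' (hG.norm.const_mul B')
    ((((hΨ.aestronglyMeasurable_at ht).pow 2).smul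
      (measurable_velGradField_at c t).aestronglyMeasurable).inner hG.1) ?_
  filter_upwards [ae_restrict_mem Metric.isOpen_ball.measurableSet] with x hx
  exact (norm_inner_le_norm _ _).trans
    (mul_le_mul_of_nonneg_right (hB' t ht x hx).2.1 (norm_nonneg _))

theorem IsAdmissibleViscosity.aestronglyMeasurable_cutoffCross
    (hΨ : IsAdmissibleViscosity R T c ε Ψ) (ht : t ∈ Icc 0 T) (n : ℕ) :
    AEStronglyMeasurable (cutoffCross n c Ψ t) (volume.restrict (Metric.ball 0 R)) :=
  ((hΨ.aestronglyMeasurable_at ht).pow 2).mul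
    (measurable_cutoffCross_factor n c t).aestronglyMeasurable

/-- Uniformity in `n` is the point: near the tip Ψ is zero, and away from it the near-orthogonality
of the cutoff gradient and the velocity gradient applies. -/
theorem IsAdmissibleViscosity.exists_cutoffCross_bound (hΨ : IsAdmissibleViscosity R T c ε Ψ)
    (hc0 : 0 < c) (hc1 : c < 1) (hε : 0 < ε) (ht : t ∈ Icc 0 T) :
    ∃ K, ∀ n, ∀ x ∈ Metric.ball (0 : Plane) R, ‖cutoffCross n c Ψ t x‖ ≤ K := by
  obtain ⟨B, hB0, hB⟩ := hΨ.exists_bounds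
  obtain ⟨K, hK⟩ := exists_cutoff_cross_bound hε ((alpha c)⁻¹ ^ 2)
  refine ⟨B ^ 2 * (|ampl * (c / alpha c)| * |K|), fun n x hx => ?_⟩
  by_cases hz : ‖tipCoord c t x‖ < ε
  · rw [cutoffCross, hΨ.eq_zero_of_norm_lt hc0 hc1 ht hx hz, zero_pow two_ne_zero, zero_mul,
      norm_zero]
    positivity
  · rw [cutoffCross, norm_mul, norm_pow, norm_mul, norm_neg]
    gcongr
    · exact (hB t ht x hx).1
    · exact (Real.norm_eq_abs _).le
    · exact (hK n _ (not_lt.1 hz)).trans (le_abs_self K)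

theorem IsAdmissibleViscosity.integrableOn_cutoffCross_mul (hΨ : IsAdmissibleViscosity R T c ε Ψ)
    (hc0 : 0 < c) (hc1 : c < 1) (hε : 0 < ε) (ht : t ∈ Icc 0 T)
    (hv : IntegrableOn v (Metric.ball 0 R)) (n : ℕ) :
    IntegrableOn (fun x => cutoffCross n c Ψ t x * v x) (Metric.ball 0 R) := by
  obtain ⟨K, hK⟩ := hΨ.exists_cutoffCross_bound hc0 hc1 hε ht
  refine Integrable.bdd_mul (c := K) hv (hΨ.aestronglyMeasurable_cutoffCross ht n) ?_
  filter_upwards [ae_restrict_mem Metric.isOpen_ball.measurableSet] with x hx using hK n x hx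

theorem viscous_test_coord (hR : 0 < R) (hΨ : IsAdmissibleViscosity R T c ε Ψ)
    (ht : t ∈ Icc 0 T) (h : WeakZeroTrace (Metric.ball 0 R) (crack R c t) v G)
    (hv : IntegrableOn v (Metric.ball 0 R)) (hG : IntegrableOn G (Metric.ball 0 R))
    {a : Plane → ℝ} (hac : ContDiff ℝ ∞ a) (has : tsupport a ⊆ (crack R c t)ᶜ) (i : Fin 2) :
    ∫ x in Metric.ball (0 : Plane) R, (fderiv ℝ a x (basisVec i) * (Ψ t x ^ 2 * v x)
        + a x * (2 * Ψ t x * gradient (Ψ t) x i * v x))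
      = - ∫ x in Metric.ball (0 : Plane) R, G x i * (a x * Ψ t x ^ 2) := by
  obtain ⟨C, hC⟩ := hΨ.lipschitzOn_sq ht
  rw [← h.test_mul hR (isClosed_crack R c t) hv hG (hac.of_le (by simp)) has hC i]
  apply integral_congr_ae
  filter_upwards [hΨ.ae_differentiable ht] with x hx
  rw [fderiv_fun_mul (hac.differentiable (by simp) x) (hx.fun_pow 2), fderiv_fun_pow 2 hx,
    gradient_coord]
  simp
  ring

/-- Each component of the cut-off velocity gradient is smooth and vanishes near the crack, and Ψ² is
Lipschitz, so their product is an admissible test function. The only error against the limiting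
identity is the cross term. -/
theorem viscous_identity_cutoff (hR : 0 < R) (hΨ : IsAdmissibleViscosity R T c ε Ψ)
    (hc0 : 0 < c) (hc1 : c < 1) (hε : 0 < ε) (ht : t ∈ Icc 0 T)
    (h : WeakZeroTrace (Metric.ball 0 R) (crack R c t) v G)
    (hv : IntegrableOn v (Metric.ball 0 R)) (hG : IntegrableOn G (Metric.ball 0 R)) (n : ℕ) :
    (∫ x in Metric.ball (0 : Plane) R,
        slitCutoff n (tipCoord c t x) * (forceField c Ψ t x * v x))
      - ∫ x in Metric.ball (0 : Plane) R, cutoffCross n c Ψ t x * v x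
      = ∫ x in Metric.ball (0 : Plane) R, slitCutoff n (tipCoord c t x) *
        inner ℝ (Ψ t x ^ 2 • velGradField c t x) (G x) := by
  have hac : ∀ i, ContDiff ℝ ∞ (fun x => slitCutoff n (tipCoord c t x) * velGradField c t x i) :=
    fun i => contDiff_cutoff_velGradField n c t i
  have has : ∀ i, tsupport (fun x => slitCutoff n (tipCoord c t x) * velGradField c t x i)
      ⊆ (crack R c t)ᶜ := fun i =>
    tsupport_mul_subset_left.trans (tsupport_comp_tipCoord_subset hc0 hc1 n)
  have test := fun i => viscous_test_coord hR hΨ ht h hv hG (hac i) (has i) i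
  have I1 : ∀ i, IntegrableOn (fun x =>
      fderiv ℝ (fun y => slitCutoff n (tipCoord c t y) * velGradField c t y i) x (basisVec i)
        * (Ψ t x ^ 2 * v x)
      + slitCutoff n (tipCoord c t x) * velGradField c t x i
        * (2 * Ψ t x * gradient (Ψ t) x i * v x)) (Metric.ball 0 R) := fun i =>
    (integrable_ball_mul (((hac i).continuous_fderiv (by simp)).clm_apply
      continuous_const) (hΨ.integrableOn_sq_mul ht hv)).add
      (integrable_ball_mul (hac i).continuous (hΨ.integrableOn_gradient_sq_mul ht hv i))
  have I2 : ∀ i : Fin 2, IntegrableOn (fun x => G x i *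
      (slitCutoff n (tipCoord c t x) * velGradField c t x i * Ψ t x ^ 2)) (Metric.ball 0 R) := by
    intro i
    have := hΨ.integrableOn_sq_mul ht ((EuclideanSpace.proj i : Plane →L[ℝ] ℝ).integrable_comp hG)
    refine (integrable_ball_mul (hac i).continuous this).congr (ae_of_all _ fun x => ?_)
    simp
    ring
  have hmv := integrable_ball_mul ((continuous_slitCutoff n).comp
    (contDiff_tipCoord_space c t).continuous) (hΨ.integrableOn_forceField_mul hc0 hc1 hε ht hv)
  have e1 : ∫ x in Metric.ball (0 : Plane) R, slitCutoff n (tipCoord c t x) *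
      inner ℝ (Ψ t x ^ 2 • velGradField c t x) (G x) = _ :=
    (integral_congr_ae (ae_of_all _ fun x => by
      rw [inner_plane]
      simp only [PiLp.smul_apply, smul_eq_mul]
      ring)).trans (integral_add (I2 0) (I2 1))
  have e2 := integral_sub (hΨ.integrableOn_cutoffCross_mul hc0 hc1 hε ht hv n) hmv
  have e3 := integral_add (I1 0) (I1 1)
  have e4 := test 0
  have e5 := test 1
  have e6 : ∫ x in Metric.ball (0 : Plane) R, (cutoffCross n c Ψ t x * v x
      - ((fun z => slitCutoff n z) ∘ fun x => tipCoord c t x) x * (forceField c Ψ t x * v x)) = _ :=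
    (integral_congr_ae ((ae_restrict_of_ae (ae_tipCoord_mem_slitPlane c t)).mono fun x hx => by
      have := congrArg (· * v x) (viscous_divergence (Ψ := Ψ) (n := n) hx)
      simp only [Function.comp] at this ⊢
      linear_combination -this)).trans e3
  rw [e1]
  have e7 := e2.symm.trans e6
  simp only [Function.comp] at e7
  linarith

/-- The viscous term and the forcing term balance each other at every time. -/
theorem viscous_identity (hR : 0 < R)
    (hΨ : IsAdmissibleViscosity R T c ε Ψ) (hc0 : 0 < c) (hc1 : c < 1) (hε : 0 < ε)
    (ht : t ∈ Icc 0 T)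
    (h : WeakZeroTrace (Metric.ball 0 R) (crack R c t) v G)
    (hv : IntegrableOn v (Metric.ball 0 R)) (hG : IntegrableOn G (Metric.ball 0 R)) :
    ∫ x in Metric.ball (0 : Plane) R, inner ℝ (Ψ t x ^ 2 • velGradField c t x) (G x)
      = ∫ x in Metric.ball (0 : Plane) R, forceField c Ψ t x * v x := by
  obtain ⟨K, hK⟩ := hΨ.exists_cutoffCross_bound hc0 hc1 hε ht
  have hslit : ∀ᵐ x ∂(volume.restrict (Metric.ball (0 : Plane) R)),
      tipCoord c t x ∈ Complex.slitPlane :=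
    ae_restrict_of_ae (ae_tipCoord_mem_slitPlane c t)
  have L1 := tendsto_integral_cutoff (hΨ.integrableOn_forceField_mul hc0 hc1 hε ht hv)
    (fun n => aestronglyMeasurable_cutoff_at n c t _)
    (fun n p => norm_slitCutoff_le n _) (hslit.mono fun x hx => slitCutoff_tendsto hx)
  have L2 := tendsto_integral_cutoff (hΨ.integrableOn_inner_sq_smul hc0 hc1 hε ht hG)
    (fun n => aestronglyMeasurable_cutoff_at n c t _)
    (fun n p => norm_slitCutoff_le n _) (hslit.mono fun x hx => slitCutoff_tendsto hx)
  -- The cross term is dominated by a multiple of |v| independent of n, and at each point off the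
  -- slit it is zero for all large n.
  have L3 : Tendsto (fun n => ∫ x in Metric.ball (0 : Plane) R, cutoffCross n c Ψ t x * v x)
      atTop (𝓝 (∫ x in Metric.ball (0 : Plane) R, (fun _ : Plane => (0 : ℝ)) x)) := by
    apply tendsto_integral_of_dominated_convergence (fun x => K * ‖v x‖)
    · exact fun n => (hΨ.aestronglyMeasurable_cutoffCross ht n).mul hv.1
    · exact hv.norm.const_mul _
    · intro n
      filter_upwards [ae_restrict_mem Metric.isOpen_ball.measurableSet] with x hx
      rw [norm_mul]
      exact mul_le_mul_of_nonneg_right (hK n x hx) (norm_nonneg _)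
    · filter_upwards [hslit] with x hx
      refine tendsto_const_nhds.congr' ?_
      filter_upwards [deriv_cutoff_eventually_zero hx] with n hn
      simp [cutoffCross, hn]
  rw [integral_zero] at L3
  refine tendsto_nhds_unique L2 ?_
  have := L1.sub L3
  rw [sub_zero] at this
  exact this.congr fun n => viscous_identity_cutoff hR hΨ hc0 hc1 hε ht h hv hG n

end ViscousIdentity

/-! ### Boundary values of time derivatives -/

theorem ae_eq_zero_of_forall_intervalIntegral {T : ℝ} (hT : 0 < T) {g : ℝ → ℝ}
    (hg : IntervalIntegrable g volume 0 T)
    (h : ∀ t ∈ Icc 0 T, ∫ s in (0 : ℝ)..t, g s = 0) :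
    ∀ᵐ s ∂(volume.restrict (Ioo 0 T)), g s = 0 := by
  filter_upwards [ae_restrict_of_ae hg.ae_hasDerivAt_integral,
    ae_restrict_mem measurableSet_Ioo] with s hs hm
  rw [uIcc_of_le hT.le] at hs
  have h1 := hs (Ioo_subset_Icc_self hm) 0 (left_mem_Icc.2 hT.le)
  have h2 : HasDerivAt (fun t => ∫ r in (0 : ℝ)..t, g r) 0 s := by
    refine (hasDerivAt_const s (0 : ℝ)).congr_of_eventuallyEq ?_
    filter_upwards [Icc_mem_nhds hm.1 hm.2] with t ht using h t ht
  exact h1.unique h2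

/-- A zero trace known for a large crack K' improves to a smaller one K. The function (1 - θ)η sees
K' only where it lies in K, while θη is compactly supported in Ω and is handled by the weak gradient
in Ω \ K, where no boundary is involved. -/
theorem WeakZeroTrace.of_partition {Ω K K' : Set Plane} {v : Plane → ℝ} {G : Plane → Plane}
    (h : WeakZeroTrace Ω K' v G) (hw : HasWeakGradient (Ω \ K) v G) (hK0 : volume K = 0)
    (hv : IntegrableOn v Ω) (hG : IntegrableOn G Ω) {θ : Plane → ℝ} (hθ : ContDiff ℝ ∞ θ)
    (hs : tsupport θ ⊆ Ω) (hK : K' ∩ tsupport (fun x => 1 - θ x) ⊆ K) :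
    WeakZeroTrace Ω K v G := by
  intro η hη hc hsη i
  have h1 := h (fun x => (1 - θ x) * η x) ((contDiff_const.sub hθ).mul hη) hc.mul_left
    (fun x hx hxK => hsη (tsupport_mul_subset_right hx)
      (hK ⟨hxK, tsupport_mul_subset_left hx⟩)) i
  have h2 := hw (fun x => θ x * η x) (hθ.mul hη) hc.mul_left
    (fun x hx => ⟨hs (tsupport_mul_subset_left hx), hsη (tsupport_mul_subset_right hx)⟩) i
  rw [restrict_diff_null hK0] at h2
  have hGi : IntegrableOn (fun x => G x i) Ω :=
    (EuclideanSpace.proj i : Plane →L[ℝ] ℝ).integrable_comp hG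
  have hc1 : HasCompactSupport (fun x => (1 - θ x) * η x) := hc.mul_left
  have hc2 : HasCompactSupport (fun x => θ x * η x) := hc.mul_left
  have d1 : ContDiff ℝ ∞ (fun x => (1 - θ x) * η x) := (contDiff_const.sub hθ).mul hη
  have d2 : ContDiff ℝ ∞ (fun x => θ x * η x) := hθ.mul hη
  have e : ∀ x, fderiv ℝ η x (basisVec i) = fderiv ℝ (fun x => (1 - θ x) * η x) x (basisVec i)
      + fderiv ℝ (fun x => θ x * η x) x (basisVec i) := by
    intro x
    have : η = fun x => (1 - θ x) * η x + θ x * η x := by funext x; ring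
    conv_lhs => rw [this]
    rw [fderiv_fun_add (d1.differentiable (by simp) x) (d2.differentiable (by simp) x)]
    rfl
  have e1 : ∫ x in Ω, v x * fderiv ℝ η x (basisVec i)
      = (∫ x in Ω, v x * fderiv ℝ (fun x => (1 - θ x) * η x) x (basisVec i))
        + ∫ x in Ω, v x * fderiv ℝ (fun x => θ x * η x) x (basisVec i) := by
    rw [← integral_add (test_fderiv_mul_integrable hv d1 hc1 _)
      (test_fderiv_mul_integrable hv d2 hc2 _)]
    exact integral_congr_ae (ae_of_all _ fun x => by simp only [e x]; ring)
  have e2 : ∫ x in Ω, G x i * η x = (∫ x in Ω, G x i * ((1 - θ x) * η x))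
      + ∫ x in Ω, G x i * (θ x * η x) := by
    rw [← integral_add (test_mul_integrable hGi d1.continuous hc1)
      (test_mul_integrable hGi d2.continuous hc2)]
    exact integral_congr_ae (ae_of_all _ fun x => by ring)
  rw [e1, e2, h1, h2]
  ring

/-- The pairs `(∂_i η, η)` in `L² × L²`, for test functions `η` vanishing near `K`. -/
def testPairs (Ω K : Set Plane) (i : Fin 2) :
    Set (Lp ℝ 2 (volume.restrict Ω) × Lp ℝ 2 (volume.restrict Ω)) :=
  {e | ∃ η : Plane → ℝ, ContDiff ℝ ∞ η ∧ HasCompactSupport η ∧ tsupport η ⊆ Kᶜ ∧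
    e.1 =ᵐ[volume.restrict Ω] (fun x => fderiv ℝ η x (basisVec i)) ∧ e.2 =ᵐ[volume.restrict Ω] η}

/-- An exchange of quantifiers: the exceptional set of times may depend on `η`. Since L² of the disc
is second countable, countably many pairs (∂ᵢη, η) are dense among all of them, and at a fixed time
the tested identity is a closed condition on the pair. -/
theorem ae_weakZeroTrace_of_tested {T R : ℝ} {K : Set Plane} {v : ℝ → Plane → ℝ}
    {G : ℝ → Plane → Plane}
    (hv : MemLp (fun p : ℝ × Plane => v p.1 p.2) 2 (cylMeasure T (Metric.ball 0 R)))
    (hG : MemLp (fun p : ℝ × Plane => G p.1 p.2) 2 (cylMeasure T (Metric.ball 0 R)))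
    (h : ∀ η : Plane → ℝ, ContDiff ℝ ∞ η → HasCompactSupport η → tsupport η ⊆ Kᶜ →
      ∀ i : Fin 2, ∀ᵐ s ∂(volume.restrict (Ioo 0 T)),
        ∫ x in Metric.ball 0 R, v s x * fderiv ℝ η x (basisVec i)
          = - ∫ x in Metric.ball 0 R, G s x i * η x) :
    ∀ᵐ s ∂(volume.restrict (Ioo 0 T)), WeakZeroTrace (Metric.ball 0 R) K (v s) (G s) := by
  have main : ∀ i : Fin 2, ∀ᵐ s ∂(volume.restrict (Ioo 0 T)),
      ∀ η : Plane → ℝ, ContDiff ℝ ∞ η → HasCompactSupport η → tsupport η ⊆ Kᶜ →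
        ∫ x in Metric.ball 0 R, v s x * fderiv ℝ η x (basisVec i)
          = - ∫ x in Metric.ball 0 R, G s x i * η x := by
    intro i
    have : Fact ((2 : ℝ≥0∞) ≠ ⊤) := ⟨by simp⟩
    have : SecondCountableTopology (Lp ℝ 2 (volume.restrict (Metric.ball (0 : Plane) R))) :=
      Lp.SecondCountableTopology
    obtain ⟨D, hD, hDc, hDd⟩ := (TopologicalSpace.IsSeparable.of_separableSpace
      (testPairs (Metric.ball 0 R) K i)).exists_countable_dense_subset
    have hae : ∀ᵐ s ∂(volume.restrict (Ioo 0 T)), ∀ e ∈ D,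
        ∫ x in Metric.ball 0 R, v s x * e.1 x = - ∫ x in Metric.ball 0 R, G s x i * e.2 x := by
      rw [ae_ball_iff hDc]
      intro e he
      obtain ⟨η, h1, h2, h3, h4, h5⟩ := hD he
      filter_upwards [h η h1 h2 h3 i] with s hs
      rw [integral_congr_ae (h4.mono fun x hx => by simp only [hx] :
          (fun x => v s x * e.1 x) =ᵐ[_] fun x => v s x * fderiv ℝ η x (basisVec i)), hs,
        integral_congr_ae (h5.mono fun x hx => by simp only [hx] :
          (fun x => G s x i * e.2 x) =ᵐ[_] fun x => G s x i * η x)]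
    filter_upwards [hae, ae_memLp_slice hv, ae_memLp_slice hG] with s hs hvs hGs
    intro η h1 h2 h3
    have hGi := memLp_coord hGs i
    have hm1 : MemLp (fun x => fderiv ℝ η x (basisVec i)) 2 (volume.restrict (Metric.ball 0 R)) :=
      (((h1.continuous_fderiv (by simp)).clm_apply continuous_const).memLp_of_hasCompactSupport
        (h2.fderiv_apply ℝ (basisVec i))).restrict _
    have hm2 : MemLp η 2 (volume.restrict (Metric.ball 0 R)) :=
      (h1.continuous.memLp_of_hasCompactSupport h2).restrict _
    have hcl : IsClosed {e : Lp ℝ 2 (volume.restrict (Metric.ball (0 : Plane) R)) ×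
        Lp ℝ 2 (volume.restrict (Metric.ball (0 : Plane) R)) |
        inner ℝ (hvs.toLp) e.1 + inner ℝ (hGi.toLp) e.2 = 0} :=
      isClosed_eq (by fun_prop) continuous_const
    have conv : ∀ e : Lp ℝ 2 (volume.restrict (Metric.ball (0 : Plane) R)) ×
        Lp ℝ 2 (volume.restrict (Metric.ball (0 : Plane) R)),
        inner ℝ (hvs.toLp) e.1 + inner ℝ (hGi.toLp) e.2
        = (∫ x in Metric.ball 0 R, v s x * e.1 x) + ∫ x in Metric.ball 0 R, G s x i * e.2 x := by
      intro e
      rw [L2.inner_def, L2.inner_def]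
      congr 1
      · refine integral_congr_ae (hvs.coeFn_toLp.mono fun x hx => ?_)
        simp only [hx, RCLike.inner_apply, conj_trivial]
        ring
      · refine integral_congr_ae (hGi.coeFn_toLp.mono fun x hx => ?_)
        simp only [hx, RCLike.inner_apply, conj_trivial]
        ring
    have hmem : (hm1.toLp, hm2.toLp) ∈ closure D :=
      hDd ⟨η, h1, h2, h3, hm1.coeFn_toLp, hm2.coeFn_toLp⟩
    have := hcl.closure_subset_iff.2 (fun e he => by
      show _ = _
      rw [conv, hs e he]
      ring) hmem
    have h0 := (conv _).symm.trans this
    have r1 : ∫ x in Metric.ball (0 : Plane) R, v s x * hm1.toLp (fun x => fderiv ℝ η x (basisVec i)) x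
        = ∫ x in Metric.ball (0 : Plane) R, v s x * fderiv ℝ η x (basisVec i) :=
      integral_congr_ae (hm1.coeFn_toLp.mono fun x hx => by simp only [hx])
    have r2 : ∫ x in Metric.ball (0 : Plane) R, G s x i * hm2.toLp η x
        = ∫ x in Metric.ball (0 : Plane) R, G s x i * η x :=
      integral_congr_ae (hm2.coeFn_toLp.mono fun x hx => by simp only [hx])
    simp only at h0
    rw [r1, r2] at h0
    linarith
  filter_upwards [ae_all_iff.2 main] with s hs
  exact fun η h1 h2 h3 i => hs i η h1 h2 h3

theorem IsH1Time.integral_mul_sub {T R t : ℝ} (hT : 0 < T) (ht : t ∈ Icc 0 T)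
    {v v' : ℝ → Plane → ℝ} (h : IsH1Time T (Metric.ball 0 R) v v') {a : Plane → ℝ}
    (ha : Continuous a) :
    ∫ s in (0 : ℝ)..t, ∫ x in Metric.ball (0 : Plane) R, v' s x * a x
      = (∫ x in Metric.ball (0 : Plane) R, v t x * a x)
        - ∫ x in Metric.ball (0 : Plane) R, v 0 x * a x := by
  have := h.integral_mul_deriv hT ht (a := fun _ x => a x) (a' := fun _ _ => 0)
    (ha.comp continuous_snd) continuous_const (fun x s => hasDerivAt_const s (a x))
  simp only [zero_mul, integral_zero, intervalIntegral.integral_zero, sub_zero] at this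
  simpa only [mul_comm] using this

theorem integral_sub_grad_of_test {T R t : ℝ} (hT : 0 < T) (ht : t ∈ Icc 0 T) {K : Set Plane}
    {d d' : ℝ → Plane → ℝ} (hd : IsH1Time T (Metric.ball 0 R) d d') {Gt G0 : Plane → Plane}
    (hGt : MemLp Gt 2 (volume.restrict (Metric.ball 0 R)))
    (hG0 : MemLp G0 2 (volume.restrict (Metric.ball 0 R)))
    (hWt : WeakZeroTrace (Metric.ball 0 R) K (d t) Gt)
    (hW0 : WeakZeroTrace (Metric.ball 0 R) K (d 0) G0)
    {η : Plane → ℝ} (h1 : ContDiff ℝ ∞ η) (h2 : HasCompactSupport η) (h3 : tsupport η ⊆ Kᶜ)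
    (i : Fin 2) :
    ∫ x in Metric.ball (0 : Plane) R, (Gt x i - G0 x i) * η x
      = - ∫ s in (0 : ℝ)..t, ∫ x in Metric.ball (0 : Plane) R,
          d' s x * fderiv ℝ η x (basisVec i) := by
  rw [hd.integral_mul_sub hT ht ((h1.continuous_fderiv (by simp)).clm_apply continuous_const),
    hWt η h1 h2 h3 i, hW0 η h1 h2 h3 i]
  have e := integral_sub
    (test_mul_integrable (memLp_two_integrableOn (memLp_coord hGt i)) h1.continuous h2)
    (test_mul_integrable (memLp_two_integrableOn (memLp_coord hG0 i)) h1.continuous h2)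
  simp only [sub_mul]
  linarith

/-- If all the values of a time dependent function vanish on the boundary, then so do almost all
the values of its time derivative. -/
theorem ae_weakZeroTrace_deriv {T R : ℝ} (hT : 0 < T) {K K0 : Set Plane} (hK : IsClosed K)
    (hKn : volume K = 0) (hK0 : K0 ⊆ K) {d d' : ℝ → Plane → ℝ} {Dd' : ℝ → Plane → Plane}
    (hd : IsH1Time T (Metric.ball 0 R) d d')
    (hZ : ∀ t ∈ Icc 0 T, ∃ G : Plane → Plane, MemLp G 2 (volume.restrict (Metric.ball 0 R)) ∧
      WeakZeroTrace (Metric.ball 0 R) K (d t) G)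
    (hs : IsL2Sobolev T (Metric.ball 0 R) (fun _ => K0) d' Dd') :
    ∀ᵐ s ∂(volume.restrict (Ioo 0 T)), WeakZeroTrace (Metric.ball 0 R) K (d' s) (Dd' s) := by
  obtain ⟨G0, hG0, hW0⟩ := hZ 0 (left_mem_Icc.2 hT.le)
  have hη2 : ∀ η : Plane → ℝ, ContDiff ℝ ∞ η → ∀ i : Fin 2,
      Integrable (fun p : ℝ × Plane => Dd' p.1 p.2 i * η p.2) (cylMeasure T (Metric.ball 0 R)) := by
    intro η h1 i
    have := integrable_cyl_mul (a := fun p => η p.2) (h1.continuous.comp continuous_snd)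
      (((EuclideanSpace.proj i : Plane →L[ℝ] ℝ).comp_memLp' hs.memLp_grad).integrable (by simp))
    exact this.congr (ae_of_all _ fun p => mul_comm _ _)
  have hη1 : ∀ η : Plane → ℝ, ContDiff ℝ ∞ η → ∀ i : Fin 2,
      Integrable (fun p : ℝ × Plane => d' p.1 p.2 * fderiv ℝ η p.2 (basisVec i))
        (cylMeasure T (Metric.ball 0 R)) := by
    intro η h1 i
    have := integrable_cyl_mul (a := fun p => fderiv ℝ η p.2 (basisVec i))
      (((h1.continuous_fderiv (by simp)).clm_apply continuous_const).comp continuous_snd)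
      (hs.memLp.integrable (by simp))
    simpa only [mul_comm] using this
  -- the gradients are primitives of `Dd'`
  have hprim : ∀ t ∈ Icc 0 T, ∀ Gt : Plane → Plane,
      MemLp Gt 2 (volume.restrict (Metric.ball 0 R)) →
      WeakZeroTrace (Metric.ball 0 R) K (d t) Gt → ∀ i : Fin 2,
      ∀ᵐ x ∂(volume.restrict (Metric.ball (0 : Plane) R)),
        Gt x i - G0 x i - ∫ s in (0 : ℝ)..t, Dd' s x i = 0 := by
    intro t ht Gt hGt hWt i
    have hI := memLp_time_integral ht (g := fun s x => Dd' s x i)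
      ((EuclideanSpace.proj i : Plane →L[ℝ] ℝ).comp_memLp' hs.memLp_grad)
    have hU : IsOpen (Metric.ball (0 : Plane) R \ K) := Metric.isOpen_ball.sdiff hK
    have hg := memLp_two_integrableOn
      (((memLp_coord hGt i).sub (memLp_coord hG0 i)).sub hI)
    rw [← restrict_diff_null hKn]
    -- The gradients `Gt` are given for each time separately, without measurability in time. Testing
    -- inside the disc identifies `Gt - G0` with the time integral of `Dd'`, which is jointly
    -- measurable up to null sets.
    refine ae_eq_zero_of_forall_test hU (hg.mono_set sdiff_subset) fun η h1 h2 h3 => ?_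
    rw [restrict_diff_null hKn]
    have h3' : tsupport η ⊆ Kᶜ := fun x hx => (h3 hx).2
    have a1 := integral_sub_grad_of_test hT ht hd hGt hG0 hWt hW0 h1 h2 h3' i
    have a2 : ∫ x in Metric.ball (0 : Plane) R, (∫ s in (0 : ℝ)..t, Dd' s x i) * η x
        = ∫ s in (0 : ℝ)..t, ∫ x in Metric.ball (0 : Plane) R, Dd' s x i * η x := by
      rw [integral_time_space (F := fun s x => Dd' s x i * η x) ht (hη2 η h1 i),
        ← integral_space_time (F := fun s x => Dd' s x i * η x) ht (hη2 η h1 i)]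
      simp only [intervalIntegral.integral_mul_const]
    have a3 : ∫ s in (0 : ℝ)..t, ∫ x in Metric.ball (0 : Plane) R,
          d' s x * fderiv ℝ η x (basisVec i)
        = ∫ s in (0 : ℝ)..t, -∫ x in Metric.ball (0 : Plane) R, Dd' s x i * η x := by
      rw [intervalIntegral_eq_Ioo ht.1, intervalIntegral_eq_Ioo ht.1]
      refine integral_congr_ae ?_
      filter_upwards [ae_restrict_of_ae_restrict_of_subset (Ioo_subset_Ioo_right ht.2)
        hs.sobolev] with s hsob
      have := (hsob.weak.mono (sdiff_subset_sdiff_right hK0)) η h1 h2 h3 i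
      rwa [restrict_diff_null hKn] at this
    rw [intervalIntegral.integral_neg] at a3
    have a4 := integral_sub (μ := volume.restrict (Metric.ball (0 : Plane) R))
      (f := fun x => (Gt x i - G0 x i) * η x)
      (g := fun x => (∫ s in (0 : ℝ)..t, Dd' s x i) * η x)
      (test_mul_integrable (memLp_two_integrableOn
        ((memLp_coord hGt i).sub (memLp_coord hG0 i))) h1.continuous h2)
      (test_mul_integrable (memLp_two_integrableOn hI) h1.continuous h2)
    simp only [sub_mul] at a4 a1 ⊢
    linarith
  refine ae_weakZeroTrace_of_tested hs.memLp hs.memLp_grad fun η h1 h2 h3 i => ?_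
  have hint1 := intervalIntegrable_space
      (F := fun s x => d' s x * fderiv ℝ η x (basisVec i)) (right_mem_Icc.2 hT.le) (hη1 η h1 i)
  have hint2 := intervalIntegrable_space
      (F := fun s x => Dd' s x i * η x) (right_mem_Icc.2 hT.le) (hη2 η h1 i)
  -- Now `η` may reach the boundary circle. The zero traces at times 0 and t, with the gradients
  -- just identified, say that the defect of the integration by parts formula for d' has zero
  -- integral over every interval (0, t); so it vanishes at almost every time.
  have := ae_eq_zero_of_forall_intervalIntegral hT (hint1.add hint2) fun t ht => by
    obtain ⟨Gt, hGt, hWt⟩ := hZ t ht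
    have j1 := intervalIntegrable_space (F := fun s x => d' s x * fderiv ℝ η x (basisVec i)) ht (hη1 η h1 i)
    have j2 := intervalIntegrable_space (F := fun s x => Dd' s x i * η x) ht (hη2 η h1 i)
    have a1 := integral_sub_grad_of_test hT ht hd hGt hG0 hWt hW0 h1 h2 h3 i
    have a2 : ∫ x in Metric.ball (0 : Plane) R, (∫ s in (0 : ℝ)..t, Dd' s x i) * η x
        = ∫ s in (0 : ℝ)..t, ∫ x in Metric.ball (0 : Plane) R, Dd' s x i * η x := by
      rw [integral_time_space (F := fun s x => Dd' s x i * η x) ht (hη2 η h1 i),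
        ← integral_space_time (F := fun s x => Dd' s x i * η x) ht (hη2 η h1 i)]
      simp only [intervalIntegral.integral_mul_const]
    have a3 : ∫ x in Metric.ball (0 : Plane) R, (Gt x i - G0 x i) * η x
        = ∫ x in Metric.ball (0 : Plane) R, (∫ s in (0 : ℝ)..t, Dd' s x i) * η x :=
      integral_congr_ae ((hprim t ht Gt hGt hWt i).mono fun x hx => by
        simp only [sub_eq_zero.1 hx])
    have a4 := intervalIntegral.integral_add j1 j2
    linarith
  filter_upwards [this] with s hs0
  linarith

/-! ### Change of variables to the tip and the flux integral -/

theorem tipLin_re_im (c : ℝ) (x : Plane) : tipLin c x = ⟨(√(1 - c ^ 2))⁻¹ * x 0, x 1⟩ := by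
  apply Complex.ext <;> simp [tipLin, -Complex.ofReal_mul, -Complex.ofReal_inv]

theorem tipCoord_eq_tipLin_sub (c t : ℝ) (x : Plane) :
    tipCoord c t x = tipLin c (x - !₂[c * t, 0]) := by
  rw [tipLin_re_im]
  apply Complex.ext <;> simp [tipCoord]
  ring

/-- The coordinate change has determinant 1/α. To speak of a determinant, ℂ is first identified
isometrically with the Euclidean plane. -/
theorem integral_comp_tipLin {c : ℝ} (hc0 : 0 < c) (hc1 : c < 1) (g : ℂ → ℝ) :
    ∫ x : Plane, g (tipLin c x) = alpha c * ∫ z, g z := by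
  have hα := alpha_pos hc0 hc1
  set A : Plane →ₗ[ℝ] Plane :=
    Complex.orthonormalBasisOneI.repr.toLinearEquiv.toLinearMap ∘ₗ (tipLin c).toLinearMap with hA
  have hAx : ∀ x, A x = !₂[(√(1 - c ^ 2))⁻¹ * x 0, x 1] := by
    intro x
    ext i
    fin_cases i <;> simp [hA, tipLin_re_im, Complex.orthonormalBasisOneI_repr_apply]
  have hdet : LinearMap.det A = (√(1 - c ^ 2))⁻¹ := by
    rw [← LinearMap.det_toMatrix (EuclideanSpace.basisFun (Fin 2) ℝ).toBasis, Matrix.det_fin_two]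
    simp [LinearMap.toMatrix_apply, hAx]
  have hdet0 : LinearMap.det A ≠ 0 := by rw [hdet]; positivity
  have hmap := Measure.map_linearMap_addHaar_eq_smul_addHaar (volume : Measure Plane) hdet0
  have hinj : Function.Injective A := (LinearMap.equivOfDetNeZero A hdet0).injective
  have hemb : MeasurableEmbedding A :=
    A.continuous_of_finiteDimensional.measurableEmbedding hinj
  have h1 : ∫ z, g z = ∫ x : Plane, g (Complex.orthonormalBasisOneI.repr.symm x) :=
    ((Complex.orthonormalBasisOneI.repr.symm.measurePreserving).integral_comp
      Complex.orthonormalBasisOneI.repr.symm.toHomeomorph.measurableEmbedding g).symm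
  have h2 : ∫ x : Plane, g (tipLin c x)
      = ∫ x : Plane, g (Complex.orthonormalBasisOneI.repr.symm (A x)) := by
    simp [hA]
  rw [h2, ← hemb.integral_map (μ := volume)
    (fun x => g (Complex.orthonormalBasisOneI.repr.symm x)), hmap, integral_smul_measure, h1, hdet]
  rw [ENNReal.toReal_ofReal (abs_nonneg _), inv_inv, abs_of_pos hα, smul_eq_mul]

theorem integral_comp_tipCoord {c : ℝ} (hc0 : 0 < c) (hc1 : c < 1) (t : ℝ) (g : ℂ → ℝ) :
    ∫ x : Plane, g (tipCoord c t x) = alpha c * ∫ z, g z := by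
  rw [← integral_comp_tipLin hc0 hc1]
  simp only [tipCoord_eq_tipLin_sub]
  exact integral_sub_right_eq_self (fun x => g (tipLin c x)) (!₂[c * t, 0] : Plane)

/-- The radial derivative of a compactly supported function, integrated against the fundamental
weight. -/
theorem integral_radial_deriv {Θ : ℂ → ℝ} (hΘ : ContDiff ℝ 1 Θ) (hc : HasCompactSupport Θ) :
    ∫ z, fderiv ℝ Θ z z / ‖z‖ ^ 2 = -(2 * Real.pi * Θ 0) := by
  obtain ⟨M, hM⟩ := hc.isCompact.isBounded.subset_ball (0 : ℂ)
  rw [← Complex.integral_comp_polarCoord_symm]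
  have hcont : Continuous fun p : ℝ × ℝ =>
      fderiv ℝ Θ ((p.1 : ℂ) * (Real.cos p.2 + Real.sin p.2 * Complex.I))
        (Real.cos p.2 + Real.sin p.2 * Complex.I) :=
    ((hΘ.continuous_fderiv (by simp)).comp (by fun_prop)).clm_apply (by fun_prop)
  -- One factor r comes from the area element and one from the linearity of DΘ(z) in z; together
  -- they cancel |z|², and the bare radial derivative remains. In particular the singularity at the
  -- origin disappears.
  have hval : ∀ p ∈ polarCoord.target,
      p.1 • (fderiv ℝ Θ (Complex.polarCoord.symm p) (Complex.polarCoord.symm p)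
        / ‖Complex.polarCoord.symm p‖ ^ 2)
      = fderiv ℝ Θ ((p.1 : ℂ) * (Real.cos p.2 + Real.sin p.2 * Complex.I))
        (Real.cos p.2 + Real.sin p.2 * Complex.I) := by
    intro p hp
    have hp1 : 0 < p.1 := hp.1
    rw [Complex.norm_polarCoord_symm, Complex.polarCoord_symm_apply, abs_of_pos hp1]
    have : ((p.1 : ℂ) * (Real.cos p.2 + Real.sin p.2 * Complex.I))
        = p.1 • ((Real.cos p.2 : ℂ) + Real.sin p.2 * Complex.I) := by
      rw [Complex.real_smul]
    nth_rw 2 [this]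
    rw [map_smul, smul_eq_mul, smul_eq_mul]
    field_simp
  rw [setIntegral_congr_fun polarCoord.open_target.measurableSet hval, polarCoord_target]
  have hnorm : ∀ r φ : ℝ, ‖(r : ℂ) * (Real.cos φ + Real.sin φ * Complex.I)‖ = |r| := by
    intro r φ
    have := Complex.norm_polarCoord_symm (r, φ)
    rwa [Complex.polarCoord_symm_apply] at this
  have hzero : ∀ r φ : ℝ, M ≤ r →
      fderiv ℝ Θ ((r : ℂ) * (Real.cos φ + Real.sin φ * Complex.I)) = 0 := by
    intro r φ hr
    by_contra h0
    have := hM (support_fderiv_subset ℝ h0)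
    rw [mem_ball_zero_iff, hnorm] at this
    exact absurd this (not_lt.2 (hr.trans (le_abs_self r)))
  have hzero' : ∀ r φ : ℝ, M ≤ r → Θ ((r : ℂ) * (Real.cos φ + Real.sin φ * Complex.I)) = 0 := by
    intro r φ hr
    by_contra h0
    have := hM (subset_tsupport _ h0)
    rw [mem_ball_zero_iff, hnorm] at this
    exact absurd this (not_lt.2 (hr.trans (le_abs_self r)))
  have hint : IntegrableOn (fun p : ℝ × ℝ =>
      fderiv ℝ Θ ((p.1 : ℂ) * (Real.cos p.2 + Real.sin p.2 * Complex.I))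
        (Real.cos p.2 + Real.sin p.2 * Complex.I)) (Ioi 0 ×ˢ Ioo (-Real.pi) Real.pi) := by
    have hI : IntegrableOn (fun p : ℝ × ℝ =>
      fderiv ℝ Θ ((p.1 : ℂ) * (Real.cos p.2 + Real.sin p.2 * Complex.I))
        (Real.cos p.2 + Real.sin p.2 * Complex.I)) (Icc 0 M ×ˢ Icc (-Real.pi) Real.pi) :=
      hcont.continuousOn.integrableOn_compact (isCompact_Icc.prod isCompact_Icc)
    refine hI.of_forall_sdiff_eq_zero
      (measurableSet_Ioi.prod measurableSet_Ioo) fun p hp => ?_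
    have : M ≤ p.1 := by
      by_contra! h
      exact hp.2 ⟨⟨le_of_lt hp.1.1, h.le⟩, Ioo_subset_Icc_self hp.1.2⟩
    rw [hzero _ _ this]
    rfl
  -- Along every ray the radial derivative integrates to -Θ(0), independently of the angle; the
  -- angles contribute 2π.
  have hinner : ∀ φ : ℝ, ∫ r in Ioi (0 : ℝ),
      fderiv ℝ Θ ((r : ℂ) * (Real.cos φ + Real.sin φ * Complex.I))
        (Real.cos φ + Real.sin φ * Complex.I) = - Θ 0 := by
    intro φ
    have hd : ∀ r : ℝ, HasDerivAt
        (fun r : ℝ => Θ ((r : ℂ) * (Real.cos φ + Real.sin φ * Complex.I)))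
        (fderiv ℝ Θ ((r : ℂ) * (Real.cos φ + Real.sin φ * Complex.I))
          (Real.cos φ + Real.sin φ * Complex.I)) r := by
      intro r
      have h1 : HasDerivAt (fun r : ℝ => (r : ℂ) * (Real.cos φ + Real.sin φ * Complex.I))
          (Real.cos φ + Real.sin φ * Complex.I) r := by
        simpa using (Complex.ofRealCLM.hasDerivAt (x := r)).mul_const
          ((Real.cos φ : ℂ) + Real.sin φ * Complex.I)
      exact ((hΘ.differentiable (by simp) _).hasFDerivAt).comp_hasDerivAt r h1
    have hcr : Continuous fun r : ℝ =>
        fderiv ℝ Θ ((r : ℂ) * (Real.cos φ + Real.sin φ * Complex.I))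
          (Real.cos φ + Real.sin φ * Complex.I) := hcont.comp (by fun_prop : Continuous fun r : ℝ => (r, φ))
    have hir : IntegrableOn (fun r : ℝ =>
        fderiv ℝ Θ ((r : ℂ) * (Real.cos φ + Real.sin φ * Complex.I))
          (Real.cos φ + Real.sin φ * Complex.I)) (Ioi 0) := by
      refine (hcr.continuousOn.integrableOn_compact
        (isCompact_Icc (a := 0) (b := M))).of_forall_sdiff_eq_zero measurableSet_Ioi fun r hr => ?_
      have : M ≤ r := by
        by_contra! h
        exact hr.2 ⟨le_of_lt hr.1, h.le⟩
      rw [hzero _ _ this]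
      rfl
    rw [integral_Ioi_of_hasDerivAt_of_tendsto' (fun r _ => hd r) hir
      (tendsto_const_nhds.congr' ?_ : Tendsto _ atTop (𝓝 (0 : ℝ)))]
    · simp
    · filter_upwards [eventually_ge_atTop M] with r hr using (hzero' r φ hr).symm
  rw [IntegrableOn, Measure.volume_eq_prod, ← Measure.prod_restrict] at hint
  rw [Measure.volume_eq_prod, ← Measure.prod_restrict, integral_prod_symm _ hint]
  simp only [hinner]
  rw [integral_const, Measure.real, Measure.restrict_apply_univ, Real.volume_Ioo,
    ENNReal.toReal_ofReal (by linarith [Real.pi_pos]), smul_eq_mul]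
  ring

/-- The inverse of `tipCoord c t`. -/
def tipInv (c t : ℝ) (z : ℂ) : Plane := !₂[c * t + alpha c * z.re, z.im]

theorem tipInv_tipCoord {c : ℝ} (hc0 : 0 < c) (hc1 : c < 1) (t : ℝ) (x : Plane) :
    tipInv c t (tipCoord c t x) = x := by
  have hα := alpha_pos hc0 hc1
  ext i
  fin_cases i <;> simp [tipInv, tipCoord]
  field_simp
  ring

/-- The linear part of `tipInv`. -/
def tipInvLin (c : ℝ) : ℂ →L[ℝ] Plane :=
  (alpha c) • (Complex.reCLM.smulRight (basisVec 0)) + Complex.imCLM.smulRight (basisVec 1)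

theorem tipInv_eq (c t : ℝ) (z : ℂ) : tipInv c t z = (c * t) • basisVec 0 + tipInvLin c z := by
  ext i
  fin_cases i <;> simp [tipInv, tipInvLin]

theorem hasFDerivAt_tipInv (c t : ℝ) (z : ℂ) : HasFDerivAt (tipInv c t) (tipInvLin c) z := by
  have : tipInv c t = fun z => (c * t) • basisVec 0 + tipInvLin c z := funext (tipInv_eq c t)
  rw [this]
  exact (tipInvLin c).hasFDerivAt.const_add _

theorem continuous_tipInv (c : ℝ) : Continuous fun p : ℝ × ℂ => tipInv c p.1 p.2 := by
  simp only [tipInv_eq]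
  fun_prop

theorem contDiff_tipInv (c t : ℝ) : ContDiff ℝ ∞ (tipInv c t) := by
  have : tipInv c t = fun z => (c * t) • basisVec 0 + tipInvLin c z := funext (tipInv_eq c t)
  rw [this]
  exact contDiff_const.add (tipInvLin c).contDiff

/-- The energy density of the displacement. -/
def energyDensity (c t : ℝ) (x : Plane) : ℝ :=
  1 / 2 * (velField c t x ^ 2 + ‖gradField c t x‖ ^ 2)

/-- The energy density in tip coordinates. -/
def tipEnergyDensity (c : ℝ) (z : ℂ) : ℝ :=
  ampl ^ 2 / 2 * ((1 + c ^ 2) / alpha c ^ 2 * (sqrtD1 z).im ^ 2 + (sqrtD1 z).re ^ 2)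

theorem energyDensity_eq {c : ℝ} (hc0 : 0 < c) (hc1 : c < 1) (t : ℝ) (x : Plane) :
    energyDensity c t x = tipEnergyDensity c (tipCoord c t x) := by
  have hα := alpha_pos hc0 hc1
  rw [energyDensity, tipEnergyDensity, EuclideanSpace.norm_sq_eq, Fin.sum_univ_two]
  simp only [velField, gradField, PiLp.toLp_apply, Matrix.cons_val_zero, Matrix.cons_val_one,
    Real.norm_eq_abs, sq_abs]
  field_simp
  ring

theorem sqrtD1_sq (z : ℂ) : sqrtD1 z * sqrtD1 z = (4 * z)⁻¹ := by
  have h : (2 * Complex.sqrt z) * (2 * Complex.sqrt z) = 4 * z := by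
    linear_combination 4 * sqrt_mul_self z
  rw [sqrtD1, ← mul_inv, h]

/-- The boundary flux of the energy release, in tip coordinates. -/
theorem tip_flux_eq {c : ℝ} (hc0 : 0 < c) (hc1 : c < 1) (t : ℝ) (x : Plane) {θ : Plane → ℝ}
    (hθ : DifferentiableAt ℝ θ x) :
    velField c t x * inner ℝ (gradField c t x) (gradient θ x)
      + c * (fderiv ℝ θ x (basisVec 0) * energyDensity c t x)
    = c / alpha c * (ampl ^ 2 / 8) *
      (fderiv ℝ (fun z => θ (tipInv c t z)) (tipCoord c t x) (tipCoord c t x)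
        / ‖tipCoord c t x‖ ^ 2) := by
  have hα := alpha_pos hc0 hc1
  rw [energyDensity_eq hc0 hc1, inner_plane, gradient_coord, gradient_coord]
  set z := tipCoord c t x with hz
  have hd : fderiv ℝ (fun z => θ (tipInv c t z)) z z
      = fderiv ℝ θ x (basisVec 0) * (alpha c * z.re) + fderiv ℝ θ x (basisVec 1) * z.im := by
    have h1 := (hasFDerivAt_tipInv c t z)
    have h2 : HasFDerivAt θ (fderiv ℝ θ x) (tipInv c t z) := by
      rw [hz, tipInv_tipCoord hc0 hc1]
      exact hθ.hasFDerivAt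
    have h3 : HasFDerivAt (fun z => θ (tipInv c t z)) ((fderiv ℝ θ x).comp (tipInvLin c)) z :=
      h2.comp z h1
    rw [h3.fderiv]
    simp only [tipInvLin, ContinuousLinearMap.comp_apply, add_apply,
      smul_apply, ContinuousLinearMap.smulRight_apply, map_add, map_smul,
      smul_eq_mul, Complex.reCLM_apply, Complex.imCLM_apply]
    ring
  rw [hd]
  have hsq := sqrtD1_sq z
  -- From h² = 1/(4z), with h = `sqrtD1 z`, both Re² - Im² and 2 Re Im become components of the
  -- conjugate of z divided by 4|z|². In the energy flux, α² = 1 - c² leaves exactly these two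
  -- combinations.
  have hre : (sqrtD1 z).re ^ 2 - (sqrtD1 z).im ^ 2 = z.re / (4 * ‖z‖ ^ 2) := by
    have := congrArg Complex.re hsq
    rw [Complex.mul_re, mul_inv, Complex.mul_re, Complex.inv_re, Complex.normSq_eq_norm_sq] at this
    norm_num at this
    rw [sq, sq, this, Complex.normSq_eq_norm_sq]
    ring
  have him : 2 * (sqrtD1 z).re * (sqrtD1 z).im = - z.im / (4 * ‖z‖ ^ 2) := by
    have := congrArg Complex.im hsq
    rw [Complex.mul_im, mul_inv, Complex.mul_im, Complex.inv_im, Complex.normSq_eq_norm_sq] at this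
    norm_num at this
    try rw [Complex.normSq_eq_norm_sq] at this
    linear_combination this
  have ha2 := alpha_sq hc0 hc1
  simp only [velField, gradField, tipEnergyDensity, PiLp.toLp_apply, Matrix.cons_val_zero,
    Matrix.cons_val_one, ← hz]
  have e1 : fderiv ℝ θ x (basisVec 0) * (alpha c * z.re) + fderiv ℝ θ x (basisVec 1) * z.im
      = ‖z‖ ^ 2 * 4 * (fderiv ℝ θ x (basisVec 0) * alpha c *
          ((sqrtD1 z).re ^ 2 - (sqrtD1 z).im ^ 2)
        - fderiv ℝ θ x (basisVec 1) * (2 * (sqrtD1 z).re * (sqrtD1 z).im)) := by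
    rw [hre, him]
    rcases eq_or_ne z 0 with h0 | h0
    · simp [h0]
    · have : ‖z‖ ≠ 0 := norm_ne_zero_iff.2 h0
      field_simp
      ring
  rw [e1]
  -- At the tip itself both sides are zero by the conventions for inverses, so the identity needs no
  -- exceptional point.
  have key : ∀ A : ℝ, c / alpha c * (ampl ^ 2 / 8) * (‖z‖ ^ 2 * 4 * A / ‖z‖ ^ 2)
      = if z = 0 then 0 else c / alpha c * (ampl ^ 2 / 2) * A := by
    intro A
    split_ifs with h0
    · simp [h0]
    · have : ‖z‖ ≠ 0 := norm_ne_zero_iff.2 h0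
      field_simp
      ring
  rw [key]
  split_ifs with h0
  · simp [h0, sqrtD1]
  · field_simp
    linear_combination (fderiv ℝ θ x (basisVec 0) * (sqrtD1 z).im ^ 2) * ha2

theorem tipCoord_tipInv {c : ℝ} (hc0 : 0 < c) (hc1 : c < 1) (t : ℝ) (z : ℂ) :
    tipCoord c t (tipInv c t z) = z := by
  have hα := alpha_pos hc0 hc1
  apply Complex.ext <;> simp [tipInv, tipCoord]
  field_simp

theorem tipInv_zero (c t : ℝ) : tipInv c t 0 = !₂[c * t, 0] := by simp [tipInv]

theorem HasCompactSupport.comp_tipInv {c : ℝ} (hc0 : 0 < c) (hc1 : c < 1) (t : ℝ)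
    {θ : Plane → ℝ} (hc : HasCompactSupport θ) : HasCompactSupport fun z => θ (tipInv c t z) := by
  refine HasCompactSupport.intro (hc.isCompact.image (contDiff_tipCoord_space c t).continuous)
    fun z hz => ?_
  by_contra h
  exact hz ⟨tipInv c t z, subset_tsupport _ h, tipCoord_tipInv hc0 hc1 t z⟩

theorem ampl_sq : ampl ^ 2 = 4 / Real.pi := by
  rw [ampl, div_pow, Real.sq_sqrt Real.pi_pos.le]
  norm_num

/-- The normalization 2/√π is chosen for this: the density constant (c/α)(4/π)/8, the Jacobian α and
the angular factor 2π multiply to c. It says that one unit of energy is released per unit length of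
crack. -/
theorem integral_tip_flux {c : ℝ} (hc0 : 0 < c) (hc1 : c < 1) (t : ℝ) {θ : Plane → ℝ}
    (hθ : ContDiff ℝ 1 θ) (hc : HasCompactSupport θ) :
    ∫ x : Plane, (velField c t x * inner ℝ (gradField c t x) (gradient θ x)
      + c * (fderiv ℝ θ x (basisVec 0) * energyDensity c t x)) = - (c * θ !₂[c * t, 0]) := by
  have hα := alpha_pos hc0 hc1
  simp only [tip_flux_eq hc0 hc1 t _ (hθ.differentiable (by simp) _)]
  have hd : ContDiff ℝ 1 fun z => θ (tipInv c t z) :=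
    hθ.comp ((contDiff_tipInv c t).of_le (by simp))
  rw [integral_comp_tipCoord hc0 hc1 t fun z => c / alpha c * (ampl ^ 2 / 8) *
      (fderiv ℝ (fun z => θ (tipInv c t z)) z z / ‖z‖ ^ 2), integral_const_mul,
    integral_radial_deriv hd (hc.comp_tipInv hc0 hc1 t), ampl_sq, tipInv_zero]
  have := Real.pi_pos
  field_simp
  ring

theorem measurable_tipEnergyDensity (c : ℝ) : Measurable (tipEnergyDensity c) := by
  have h1 := Complex.measurable_im.comp measurable_sqrtD1
  have h2 := Complex.measurable_re.comp measurable_sqrtD1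
  exact (((h1.pow_const 2).const_mul _).add (h2.pow_const 2)).const_mul _

theorem integrableOn_tipEnergyDensity {c : ℝ} (hc0 : 0 < c) (hc1 : c < 1) (ρ : ℝ) :
    IntegrableOn (tipEnergyDensity c) (Metric.ball 0 ρ) := by
  have hα := alpha_pos hc0 hc1
  refine integrableOn_ball_of_norm_le_rpow (α := 1)
    (C := ampl ^ 2 / 2 * ((1 + c ^ 2) / alpha c ^ 2 + 1) / 4) (by simp) (by simp)
    (ae_of_all _ fun z => ?_) (measurable_tipEnergyDensity c).aestronglyMeasurable
  have h1 : (sqrtD1 z).im ^ 2 ≤ ‖sqrtD1 z‖ ^ 2 := by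
    rw [← sq_abs]
    exact pow_le_pow_left₀ (abs_nonneg _) (Complex.abs_im_le_norm _) 2
  have h2 : (sqrtD1 z).re ^ 2 ≤ ‖sqrtD1 z‖ ^ 2 := by
    rw [← sq_abs]
    exact pow_le_pow_left₀ (abs_nonneg _) (Complex.abs_re_le_norm _) 2
  rw [Real.rpow_neg_one, Real.norm_of_nonneg (by unfold tipEnergyDensity; positivity),
    tipEnergyDensity]
  have h3 := norm_sqrtD1_sq z
  calc ampl ^ 2 / 2 * ((1 + c ^ 2) / alpha c ^ 2 * (sqrtD1 z).im ^ 2 + (sqrtD1 z).re ^ 2)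
      ≤ ampl ^ 2 / 2 * ((1 + c ^ 2) / alpha c ^ 2 * ‖sqrtD1 z‖ ^ 2 + ‖sqrtD1 z‖ ^ 2) := by gcongr
    _ = _ := by rw [h3]; ring

theorem norm_tipCoord_le {c : ℝ} (hc0 : 0 < c) (hc1 : c < 1) {t T : ℝ} (ht : t ∈ Icc 0 T)
    {x : Plane} {R : ℝ} (hx : ‖x‖ < R) : ‖tipCoord c t x‖ ≤ (R + c * T) / alpha c + R := by
  have hα := alpha_pos hc0 hc1
  refine (Complex.norm_le_abs_re_add_abs_im _).trans ?_
  have h0 := (PiLp.norm_apply_le x 0).trans hx.le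
  have h1 := (PiLp.norm_apply_le x 1).trans hx.le
  rw [Real.norm_eq_abs] at h0 h1
  simp only [tipCoord]
  rw [abs_div, abs_of_pos hα]
  have h2 : |x 0 - c * t| ≤ R + c * T := by
    refine (abs_sub _ _).trans ?_
    rw [abs_of_nonneg (mul_nonneg hc0.le ht.1)]
    exact add_le_add h0 (mul_le_mul_of_nonneg_left ht.2 hc0.le)
  gcongr

theorem integral_mul_energyDensity {R c : ℝ} (hc0 : 0 < c) (hc1 : c < 1) (t : ℝ) {η : Plane → ℝ}
    (hs : tsupport η ⊆ Metric.ball 0 R) :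
    ∫ x in Metric.ball (0 : Plane) R, η x * energyDensity c t x
      = alpha c * ∫ z, η (tipInv c t z) * tipEnergyDensity c z := by
  rw [← integral_comp_tipCoord hc0 hc1 t]
  simp only [tipInv_tipCoord hc0 hc1, energyDensity_eq hc0 hc1]
  have := setIntegral_eq_of_tsupport (v := fun x => tipEnergyDensity c (tipCoord c t x)) hs
  simpa only [mul_comm] using this

/-- Transport of the energy density with the crack tip. -/
theorem energyDensity_transport {R T c t : ℝ} (hc0 : 0 < c) (hc1 : c < 1) (ht : t ∈ Icc 0 T)
    {θ : Plane → ℝ} (hθ : ContDiff ℝ 1 θ) (hc : HasCompactSupport θ)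
    (hs : tsupport θ ⊆ Metric.ball 0 R) :
    (∫ x in Metric.ball (0 : Plane) R, θ x * energyDensity c t x)
      - ∫ x in Metric.ball (0 : Plane) R, θ x * energyDensity c 0 x
      = ∫ s in (0 : ℝ)..t, ∫ x in Metric.ball (0 : Plane) R,
          c * (fderiv ℝ θ x (basisVec 0) * energyDensity c s x) := by
  -- This exceeds the norm in tip coordinates of every point of the disc at every time, so a single
  -- fixed ball in the z plane contains the supports of all the transported weights.
  set ρ : ℝ := (R + c * T) / alpha c + R + 1 with hρ
  have hcf : Continuous fun x => fderiv ℝ θ x (basisVec 0) :=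
    (hθ.continuous_fderiv (by simp)).clm_apply continuous_const
  have hsf : tsupport (fun x => fderiv ℝ θ x (basisVec 0)) ⊆ Metric.ball 0 R :=
    (tsupport_fderiv_apply_subset ℝ (basisVec 0)).trans hs
  have hout : ∀ {η : Plane → ℝ}, tsupport η ⊆ Metric.ball 0 R → ∀ s ∈ Icc 0 T, ∀ z : ℂ,
      z ∉ Metric.ball (0 : ℂ) ρ → η (tipInv c s z) = 0 := by
    intro η hη s hs z hz
    by_contra h0
    have h1 := mem_ball_zero_iff.1 (hη (subset_tsupport _ h0))
    have h2 := norm_tipCoord_le hc0 hc1 hs h1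
    rw [tipCoord_tipInv hc0 hc1] at h2
    exact hz (mem_ball_zero_iff.2 (by linarith))
  have hE := integrableOn_tipEnergyDensity hc0 hc1 ρ
  have hint : ∀ {η : Plane → ℝ}, Continuous η → HasCompactSupport η →
      tsupport η ⊆ Metric.ball 0 R → ∀ s ∈ Icc 0 T,
      Integrable fun z => η (tipInv c s z) * tipEnergyDensity c z := by
    intro η h1 h2 h3 s hs
    obtain ⟨C, hC⟩ := h1.bounded_above_of_compact_support h2
    have := (hE.integrable_indicator Metric.isOpen_ball.measurableSet).bdd_mul (c := C)
      ((h1.comp (contDiff_tipInv c s).continuous).aestronglyMeasurable)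
      (ae_of_all _ fun z => hC (tipInv c s z))
    refine this.congr (ae_of_all _ fun z => ?_)
    by_cases hz : z ∈ Metric.ball (0 : ℂ) ρ
    · simp [indicator_of_mem hz]
    · simp [hout h3 s hs z hz]
  have h0 : (0 : ℝ) ∈ Icc 0 T := ⟨le_rfl, ht.1.trans ht.2⟩
  -- In tip coordinates the singular density is independent of time, and only the smooth weight
  -- moves. The fundamental theorem of calculus therefore applies for each fixed z, followed by
  -- Fubini.
  rw [integral_mul_energyDensity hc0 hc1 t hs, integral_mul_energyDensity hc0 hc1 0 hs, ← mul_sub,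
    ← integral_sub (hint hθ.continuous hc hs t ht) (hint hθ.continuous hc hs 0 h0)]
  have hR : ∀ s, ∫ x in Metric.ball (0 : Plane) R,
      c * (fderiv ℝ θ x (basisVec 0) * energyDensity c s x)
      = alpha c * ∫ z, c * (fderiv ℝ θ (tipInv c s z) (basisVec 0) * tipEnergyDensity c z) := by
    intro s
    rw [integral_const_mul, integral_mul_energyDensity hc0 hc1 s hsf, integral_const_mul]
    ring
  simp only [hR]
  rw [intervalIntegral.integral_const_mul, intervalIntegral_eq_Ioo ht.1]
  congr 1
  have hprod : Integrable (fun p : ℝ × ℂ => c * (fderiv ℝ θ (tipInv c p.1 p.2) (basisVec 0)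
      * tipEnergyDensity c p.2)) ((volume.restrict (Ioo 0 t)).prod volume) := by
    obtain ⟨C, hC⟩ := hcf.bounded_above_of_compact_support (hc.fderiv_apply ℝ (basisVec 0))
    refine Integrable.const_mul ?_ c
    have := ((hE.integrable_indicator Metric.isOpen_ball.measurableSet).comp_snd
      (volume.restrict (Ioo 0 t))).bdd_mul (c := C)
      ((hcf.comp (continuous_tipInv c)).aestronglyMeasurable)
      (ae_of_all _ fun p => hC (tipInv c p.1 p.2))
    refine this.congr ?_
    have hm : ∀ᵐ p ∂((volume.restrict (Ioo 0 t)).prod (volume : Measure ℂ)), p.1 ∈ Ioo 0 t :=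
      Measure.quasiMeasurePreserving_fst.ae (ae_restrict_mem measurableSet_Ioo)
    filter_upwards [hm] with p hp
    by_cases hz : p.2 ∈ Metric.ball (0 : ℂ) ρ
    · simp [indicator_of_mem hz]
    · have := hout hsf p.1 ⟨hp.1.le, hp.2.le.trans ht.2⟩ p.2 hz
      simp [this]
  rw [integral_integral_swap hprod]
  refine integral_congr_ae (ae_of_all _ fun z => ?_)
  simp only
  have hd : ∀ s, HasDerivAt (fun s => θ (tipInv c s z) * tipEnergyDensity c z)
      (c * (fderiv ℝ θ (tipInv c s z) (basisVec 0) * tipEnergyDensity c z)) s := by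
    intro s
    have h1 : HasDerivAt (fun s => tipInv c s z) (c • basisVec 0) s := by
      simp only [tipInv_eq]
      refine HasDerivAt.add_const _ ?_
      simpa using ((hasDerivAt_id s).const_mul c).smul_const (basisVec 0)
    have h2 := ((hθ.differentiable (by simp) _).hasFDerivAt.comp_hasDerivAt s h1).mul_const
      (tipEnergyDensity c z)
    refine h2.congr_deriv ?_
    rw [map_smul, smul_eq_mul]
    ring
  rw [← intervalIntegral_eq_Ioo ht.1, intervalIntegral.integral_eq_sub_of_hasDerivAt
    (fun s _ => hd s)]
  exact (((hcf.comp ((continuous_tipInv c).comp (Continuous.prodMk_left z))).mul_const _).const_mul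
    c).intervalIntegrable _ _

/-- `θ` is a smooth cutoff, equal to one in the disc of radius `ρ` and supported in the disc of
radius `R`. -/
structure IsInnerCutoff (R ρ : ℝ) (θ : Plane → ℝ) : Prop where
  contDiff : ContDiff ℝ ∞ θ
  tsupport_subset : tsupport θ ⊆ Metric.ball 0 R
  eq_one : ∀ x ∈ Metric.ball (0 : Plane) ρ, θ x = 1

theorem exists_isInnerCutoff {R ρ : ℝ} (h0 : 0 < ρ) (hρ : ρ < R) : ∃ θ, IsInnerCutoff R ρ θ := by
  let b : ContDiffBump (0 : Plane) := ⟨ρ, (ρ + R) / 2, h0, by linarith⟩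
  refine ⟨b, b.contDiff, ?_, fun x hx => b.one_of_mem_closedBall (Metric.ball_subset_closedBall hx)⟩
  rw [b.tsupport_eq]
  exact Metric.closedBall_subset_ball (by show (ρ + R) / 2 < R; linarith)

theorem IsInnerCutoff.hasCompactSupport {R ρ : ℝ} {θ : Plane → ℝ} (h : IsInnerCutoff R ρ θ) :
    HasCompactSupport θ :=
  (isCompact_closedBall (0 : Plane) R).of_isClosed_subset (isClosed_tsupport θ)
    (h.tsupport_subset.trans Metric.ball_subset_closedBall)

/-! ### Energy released at the crack tip -/

section Energy

variable {R T c t : ℝ}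

theorem integrable_energyDensity (hR : 0 < R) (hc0 : 0 < c) (hc1 : c < 1) (hcT : c * T < R) :
    Integrable (fun p : ℝ × Plane => energyDensity c p.1 p.2) (cylMeasure T (Metric.ball 0 R)) := by
  have h1 := (memLp_velField hR hc0 hc1 hcT).integrable_sq
  have h2 := (memLp_gradField hR hc0 hc1 hcT).integrable_norm_pow (by norm_num)
  exact (h1.add h2).const_mul _

theorem integrable_energyDensity_at (hR : 0 < R) (hc0 : 0 < c) (hc1 : c < 1) (hcT : c * T < R)
    (ht : t ∈ Icc 0 T) : IntegrableOn (energyDensity c t) (Metric.ball 0 R) := by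
  have h1 := (memLp_velField_at hR hc0 hc1 hcT ht).integrable_sq
  have h2 := (memLp_gradField_at hR hc0 hc1 hcT ht).integrable_norm_pow (by norm_num)
  exact (h1.add h2).const_mul _

theorem gradient_eq_zero_of_tsupport_subset {θ : Plane → ℝ} (hs : tsupport θ ⊆ Metric.ball 0 R) :
    ∀ x ∉ Metric.ball (0 : Plane) R, gradient θ x = 0 := fun _ hx =>
  gradient_eq_zero_of_notMem_tsupport fun h => hx (hs h)

theorem continuous_gradient {θ : Plane → ℝ} (hθ : ContDiff ℝ 1 θ) :
    Continuous fun x => gradient θ x :=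
  (InnerProductSpace.toDual ℝ Plane).symm.continuous.comp (hθ.continuous_fderiv (by simp))

theorem integrable_velField_mul_inner (hR : 0 < R) (hc0 : 0 < c) (hc1 : c < 1) (hcT : c * T < R)
    {θ : Plane → ℝ} (hθ : ContDiff ℝ 1 θ) :
    Integrable (fun p : ℝ × Plane =>
      velField c p.1 p.2 * inner ℝ (gradField c p.1 p.2) (gradient θ p.2))
      (cylMeasure T (Metric.ball 0 R)) := by
  have hG := memLp_gradField hR hc0 hc1 hcT (T := T)
  have hV := memLp_velField hR hc0 hc1 hcT (T := T)
  have hi : ∀ i : Fin 2, Integrable (fun p : ℝ × Plane => gradient θ p.2 i *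
      (velField c p.1 p.2 * gradField c p.1 p.2 i)) (cylMeasure T (Metric.ball 0 R)) := fun i =>
    integrable_cyl_mul (a := fun p => gradient θ p.2 i)
      ((EuclideanSpace.proj i : Plane →L[ℝ] ℝ).continuous.comp
        ((continuous_gradient hθ).comp continuous_snd))
      (hV.integrable_mul ((EuclideanSpace.proj i : Plane →L[ℝ] ℝ).comp_memLp' hG))
  refine ((hi 0).add (hi 1)).congr (ae_of_all _ fun p => ?_)
  simp only [Pi.add_apply, inner_plane]
  ring

/-- The balance of the energy in the region seen by the cutoff, with the energy released at the
crack tip. -/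
theorem energy_release (hR : 0 < R) (hc0 : 0 < c) (hc1 : c < 1) (hcT : c * T < R)
    (ht : t ∈ Icc 0 T) {θ : Plane → ℝ} (hθ : ContDiff ℝ ∞ θ)
    (hs : tsupport θ ⊆ Metric.ball 0 R) (hc : HasCompactSupport θ)
    (h1 : ∀ s ∈ Icc 0 T, θ !₂[c * s, 0] = 1) :
    (∫ x in Metric.ball (0 : Plane) R, θ x * energyDensity c t x)
      - (∫ x in Metric.ball (0 : Plane) R, θ x * energyDensity c 0 x)
      + (∫ s in (0 : ℝ)..t, ∫ x in Metric.ball (0 : Plane) R,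
          velField c s x * inner ℝ (gradField c s x) (gradient θ x))
      = - (c * t) := by
  have hθ1 : ContDiff ℝ 1 θ := hθ.of_le (by simp)
  have hcf : Continuous fun x => fderiv ℝ θ x (basisVec 0) :=
    (hθ1.continuous_fderiv (by simp)).clm_apply continuous_const
  rw [energyDensity_transport hc0 hc1 ht hθ1 hc hs]
  have i1 : Integrable (fun p : ℝ × Plane =>
      c * (fderiv ℝ θ p.2 (basisVec 0) * energyDensity c p.1 p.2))
      (cylMeasure T (Metric.ball 0 R)) :=
    (integrable_cyl_mul (a := fun p => fderiv ℝ θ p.2 (basisVec 0)) (hcf.comp continuous_snd)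
      (integrable_energyDensity hR hc0 hc1 hcT)).const_mul c
  have i2 := integrable_velField_mul_inner hR hc0 hc1 hcT hθ1
  rw [← intervalIntegral.integral_add
    (intervalIntegrable_space
      (F := fun s x => c * (fderiv ℝ θ x (basisVec 0) * energyDensity c s x)) ht i1)
    (intervalIntegrable_space
      (F := fun s x => velField c s x * inner ℝ (gradField c s x) (gradient θ x)) ht i2)]
  -- At each time the transport term and the flux term are singular only through the tip, and their
  -- sum is the integral of `integral_tip_flux`, with θ equal to one at the tip.
  have key : ∀ s ∈ Icc 0 T, (∫ x in Metric.ball (0 : Plane) R,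
        c * (fderiv ℝ θ x (basisVec 0) * energyDensity c s x))
      + (∫ x in Metric.ball (0 : Plane) R,
        velField c s x * inner ℝ (gradField c s x) (gradient θ x)) = -c := by
    intro s hs'
    have k1 : IntegrableOn (fun x => c * (fderiv ℝ θ x (basisVec 0) * energyDensity c s x))
        (Metric.ball 0 R) :=
      (integrable_ball_mul hcf (integrable_energyDensity_at hR hc0 hc1 hcT hs')).const_mul c
    have hGs := memLp_gradField_at hR hc0 hc1 hcT hs'
    have hVs := memLp_velField_at hR hc0 hc1 hcT hs'
    have k2 : IntegrableOn (fun x => velField c s x * inner ℝ (gradField c s x) (gradient θ x))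
        (Metric.ball 0 R) := by
      have hi : ∀ i : Fin 2, IntegrableOn (fun x => gradient θ x i *
          (velField c s x * gradField c s x i)) (Metric.ball 0 R) := fun i =>
        integrable_ball_mul ((EuclideanSpace.proj i : Plane →L[ℝ] ℝ).continuous.comp
          (continuous_gradient hθ1)) (hVs.integrable_mul (memLp_coord hGs i))
      refine ((hi 0).add (hi 1)).congr (ae_of_all _ fun p => ?_)
      simp only [Pi.add_apply, inner_plane]
      ring
    rw [← integral_add k1 k2, setIntegral_eq_integral_of_forall_compl_eq_zero]
    · have := integral_tip_flux hc0 hc1 s hθ1 hc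
      rw [h1 s hs', mul_one] at this
      rw [← this]
      exact integral_congr_ae (ae_of_all _ fun x => add_comm _ _)
    · intro x hx
      have h0 := gradient_eq_zero_of_tsupport_subset hs x hx
      rw [← gradient_coord, h0]
      simp
  rw [intervalIntegral.integral_congr (g := fun _ => -c)
    (fun _ hs' => key _ (by
      rw [uIcc_of_le ht.1] at hs'
      exact ⟨hs'.1, hs'.2.trans ht.2⟩))]
  simp
  ring

/-- Integration of a time derivative over the cylinder. -/
theorem integral_time_deriv (ht : t ∈ Icc 0 T) {g g' : ℝ → Plane → ℝ}
    (hi : Integrable (fun p : ℝ × Plane => g' p.1 p.2) (cylMeasure T (Metric.ball 0 R)))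
    (hd : ∀ x : Plane, x 1 ≠ 0 → ∀ s, HasDerivAt (fun s => g s x) (g' s x) s)
    (hc : ∀ x : Plane, x 1 ≠ 0 → Continuous fun s => g' s x)
    (hg : IntegrableOn (g t) (Metric.ball 0 R)) (hg0 : IntegrableOn (g 0) (Metric.ball 0 R)) :
    ∫ s in (0 : ℝ)..t, ∫ x in Metric.ball (0 : Plane) R, g' s x
      = (∫ x in Metric.ball (0 : Plane) R, g t x) - ∫ x in Metric.ball (0 : Plane) R, g 0 x := by
  rw [integral_time_space ht hi, ← integral_space_time ht hi, ← integral_sub hg hg0]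
  refine integral_congr_ae (ae_restrict_of_ae ?_)
  filter_upwards [ae_coord_ne_zero] with x hx
  exact intervalIntegral.integral_eq_sub_of_hasDerivAt (fun _ _ => hd x hx _)
    ((hc x hx).intervalIntegrable _ _)

end Energy

/-! ### Time regularity of the explicit fields -/

section TimeDerivatives

variable {c : ℝ} {x : Plane}

theorem continuous_comp_tipCoord {h h' : ℂ → ℂ}
    (H : ∀ z ∈ Complex.slitPlane, HasDerivAt h (h' z) z) (hx : x 1 ≠ 0) :
    Continuous fun s => h (tipCoord c s x) :=
  continuous_iff_continuousAt.2 fun s => ContinuousAt.comp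
    (H _ (tipCoord_mem_slitPlane hx)).continuousAt
    ((continuous_tipCoord c).comp (Continuous.prodMk_left x)).continuousAt

theorem continuous_velField_time (hx : x 1 ≠ 0) : Continuous fun s => velField c s x :=
  (Complex.continuous_im.comp (continuous_comp_tipCoord (fun _ h => hasDerivAt_sqrtD1 h) hx)).const_mul _

theorem continuous_accField_time (hx : x 1 ≠ 0) : Continuous fun s => accField c s x :=
  (Complex.continuous_im.comp (continuous_comp_tipCoord (fun _ h => hasDerivAt_sqrtD2 h) hx)).const_mul _

theorem continuous_toLp_pair {X : Type*} [TopologicalSpace X] {f g : X → ℝ} (hf : Continuous f)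
    (hg : Continuous g) : Continuous fun x => (!₂[f x, g x] : Plane) := by
  refine (PiLp.continuous_toLp 2 _).comp (continuous_pi fun i => ?_)
  fin_cases i
  · exact hf
  · exact hg

theorem continuous_gradField_time (hx : x 1 ≠ 0) : Continuous fun s => gradField c s x :=
  continuous_toLp_pair
    ((Complex.continuous_im.comp (continuous_comp_tipCoord (fun _ h => hasDerivAt_sqrtD1 h) hx)).const_mul _)
    ((Complex.continuous_re.comp (continuous_comp_tipCoord (fun _ h => hasDerivAt_sqrtD1 h) hx)).const_mul _)

theorem continuous_velGradField_time (hx : x 1 ≠ 0) : Continuous fun s => velGradField c s x :=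
  continuous_toLp_pair
    ((Complex.continuous_im.comp (continuous_comp_tipCoord (fun _ h => hasDerivAt_sqrtD2 h) hx)).const_mul _)
    ((Complex.continuous_re.comp (continuous_comp_tipCoord (fun _ h => hasDerivAt_sqrtD2 h) hx)).const_mul _)

theorem hasDerivAt_comp_tipCoord_re {h : ℂ → ℂ} {h' : ℂ} {t : ℝ}
    (H : HasDerivAt h h' (tipCoord c t x)) :
    HasDerivAt (fun s => (h (tipCoord c s x)).re) (-(c / alpha c) * h'.re) t := by
  have h1 := H.comp_of_eq t (hasDerivAt_tipCoord c t x) rfl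
  have h2 := Complex.reCLM.hasFDerivAt.comp_hasDerivAt t h1
  refine h2.congr_deriv ?_
  simp [-Complex.ofReal_div]
  ring

theorem hasDerivAt_energyDensity (hx : x 1 ≠ 0) (t : ℝ) :
    HasDerivAt (fun s => energyDensity c s x)
      (inner ℝ (gradField c t x) (velGradField c t x) + velField c t x * accField c t x) t := by
  have hz := tipCoord_mem_slitPlane (c := c) (t := t) hx
  have h1 := hasDerivAt_comp_tipCoord_im (hasDerivAt_sqrtD1 hz)
  have h2 := hasDerivAt_comp_tipCoord_re (hasDerivAt_sqrtD1 hz)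
  have e : (fun s => energyDensity c s x) = fun s => 1 / 2 * ((velField c s x) ^ 2
      + ((ampl / alpha c * (sqrtD1 (tipCoord c s x)).im) ^ 2
        + (ampl * (sqrtD1 (tipCoord c s x)).re) ^ 2)) := by
    funext s
    rw [energyDensity, EuclideanSpace.norm_sq_eq, Fin.sum_univ_two]
    simp only [gradField, PiLp.toLp_apply, Matrix.cons_val_zero, Matrix.cons_val_one,
      Real.norm_eq_abs, sq_abs]
  rw [e]
  refine ((((hasDerivAt_velField hz).fun_pow 2).fun_add (((h1.const_mul (ampl / alpha c)).fun_pow 2).fun_add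
    ((h2.const_mul ampl).fun_pow 2))).const_mul (1 / 2)).congr_deriv ?_
  rw [inner_plane]
  simp only [gradField, velGradField, PiLp.toLp_apply, Matrix.cons_val_zero, Matrix.cons_val_one]
  ring

end TimeDerivatives

/-! ### Smoothness of the displacement off the slit -/

theorem HasWeakGradient.congr {U : Set Plane} {v : Plane → ℝ} {G G' : Plane → Plane}
    (h : HasWeakGradient U v G) (hG : ∀ᵐ x ∂(volume.restrict U), G x = G' x) :
    HasWeakGradient U v G' := by
  intro η h1 h2 h3 i
  rw [h η h1 h2 h3 i]
  congr 1
  exact integral_congr_ae (hG.mono fun x hx => by simp only [hx])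

theorem contDiffOn_im_comp_tipCoord {h : ℂ → ℂ} (hh : ContDiffOn ℝ ∞ h Complex.slitPlane)
    (b c t : ℝ) :
    ContDiffOn ℝ ∞ (fun x => b * (h (tipCoord c t x)).im) (tipCoord c t ⁻¹' Complex.slitPlane) :=
  contDiffOn_const.mul ((Complex.imCLM.contDiff.comp_contDiffOn hh).comp
    (contDiff_tipCoord_space c t).contDiffOn fun _ hx => hx)

theorem contDiffOn_crackDisplacement (c t : ℝ) :
    ContDiffOn ℝ ∞ (crackDisplacement c t) (tipCoord c t ⁻¹' Complex.slitPlane) := by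
  have : crackDisplacement c t = fun x => ampl * (Complex.sqrt (tipCoord c t x)).im :=
    funext (crackDisplacement_eq c t)
  rw [this]
  exact contDiffOn_im_comp_tipCoord contDiffOn_sqrt _ c t

theorem contDiffOn_velField (c t : ℝ) :
    ContDiffOn ℝ ∞ (velField c t) (tipCoord c t ⁻¹' Complex.slitPlane) :=
  contDiffOn_im_comp_tipCoord contDiffOn_sqrtD1 _ c t

theorem isOpen_preimage_slitPlane (c t : ℝ) : IsOpen (tipCoord c t ⁻¹' Complex.slitPlane) :=
  Complex.isOpen_slitPlane.preimage (contDiff_tipCoord_space c t).continuous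

theorem differentiableAt_velField {c t : ℝ} {x : Plane}
    (hx : tipCoord c t x ∈ Complex.slitPlane) : DifferentiableAt ℝ (velField c t) x :=
  ((contDiffOn_velField c t).differentiableOn (by simp)).differentiableAt
    ((isOpen_preimage_slitPlane c t).mem_nhds hx)

theorem measurable_crackDisplacement (c : ℝ) :
    Measurable fun p : ℝ × Plane => crackDisplacement c p.1 p.2 := by
  simp only [crackDisplacement_eq]
  exact (Complex.measurable_im.comp (measurable_sqrt.comp
    (continuous_tipCoord c).measurable)).const_mul _

theorem gradient_fun_mul {f g : Plane → ℝ} {x : Plane} (hf : DifferentiableAt ℝ f x)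
    (hg : DifferentiableAt ℝ g x) :
    gradient (fun y => f y * g y) x = f x • gradient g x + g x • gradient f x := by
  ext i
  simp only [gradient_coord, PiLp.add_apply, PiLp.smul_apply, smul_eq_mul]
  rw [fderiv_fun_mul hf hg]
  simp

/-! ### Uniform bounds away from the path of the tip -/

section Bounds

variable {R T c ρ : ℝ}

theorem exists_bound_crackDisplacement (hR : 0 < R) (hT : 0 < T) (hc0 : 0 < c) (hc1 : c < 1) :
    ∃ C : ℝ, 0 ≤ C ∧ ∀ t ∈ Icc 0 T, ∀ x ∈ Metric.ball (0 : Plane) R,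
      |crackDisplacement c t x| ≤ C := by
  have hα := alpha_pos hc0 hc1
  refine ⟨ampl * √((R + c * T) / alpha c + R), by positivity, fun t ht x hx => ?_⟩
  rw [crackDisplacement_eq, abs_mul, abs_of_nonneg (by positivity)]
  gcongr
  refine (Complex.abs_im_le_norm _).trans ?_
  rw [norm_sqrt_eq]
  exact Real.sqrt_le_sqrt (norm_tipCoord_le hc0 hc1 ht (mem_ball_zero_iff.1 hx))

theorem norm_tip (hc0 : 0 < c) {t : ℝ} (ht : 0 ≤ t) : ‖(!₂[c * t, 0] : Plane)‖ = c * t := by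
  rw [EuclideanSpace.norm_eq, Fin.sum_univ_two]
  simp only [Matrix.cons_val_zero, Matrix.cons_val_one, norm_zero]
  rw [zero_pow (by norm_num), add_zero, Real.sqrt_sq (norm_nonneg _), Real.norm_eq_abs,
    abs_of_nonneg (mul_nonneg hc0.le ht)]

theorem le_norm_tipCoord (hc0 : 0 < c) (hc1 : c < 1) {t : ℝ} (ht : t ∈ Icc 0 T) {x : Plane}
    (hx : ρ ≤ ‖x‖) : ρ - c * T ≤ ‖tipCoord c t x‖ := by
  refine le_trans ?_ (norm_sub_tip_le hc0 hc1 x)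
  have h1 := norm_sub_norm_le x !₂[c * t, 0]
  rw [norm_tip hc0 ht.1] at h1
  have := mul_le_mul_of_nonneg_left ht.2 hc0.le
  linarith

/-- During the whole evolution the tip stays in the disc of radius cT, so points with ‖x‖ ≥ ρ remain
at distance at least ρ - cT from it, where all derivatives of √z are bounded. -/
theorem exists_outer_bounds (hR : 0 < R) (hT : 0 < T) (hc0 : 0 < c) (hc1 : c < 1)
    (hρ : c * T < ρ) :
    ∃ C : ℝ, 0 ≤ C ∧ ∀ t ∈ Icc 0 T, ∀ x ∈ Metric.ball (0 : Plane) R, ρ ≤ ‖x‖ →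
      |crackDisplacement c t x| ≤ C ∧ |velField c t x| ≤ C ∧ ‖gradField c t x‖ ≤ C ∧
      |accField c t x| ≤ C ∧ ‖velGradField c t x‖ ≤ C := by
  obtain ⟨C0, hC0, h0⟩ := exists_bound_crackDisplacement hR hT hc0 hc1
  have hδ : 0 < ρ - c * T := by linarith
  set B1 := (2 * √(ρ - c * T))⁻¹
  set B2 := (4 * √(ρ - c * T) ^ 3)⁻¹
  set C1 := |ampl * (c / alpha c)| * B1
  set C2 := (|ampl / alpha c| + |ampl|) * B1
  set C3 := |ampl * (c / alpha c) ^ 2| * B2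
  set C4 := (|-(ampl * (c / alpha c)) / alpha c| + |-(ampl * (c / alpha c))|) * B2
  have p1 : 0 ≤ C1 := by positivity
  have p2 : 0 ≤ C2 := by positivity
  have p3 : 0 ≤ C3 := by positivity
  have p4 : 0 ≤ C4 := by positivity
  refine ⟨C0 + C1 + C2 + C3 + C4, by positivity, fun t ht x hx hxρ => ?_⟩
  have hz := le_norm_tipCoord hc0 hc1 ht hxρ
  have b1 := norm_sqrtD1_le hδ hz
  have b2 := norm_sqrtD2_le hδ hz
  have e0 := h0 t ht x hx
  have e1 : |velField c t x| ≤ C1 :=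
    (norm_velField_le c t x).trans (mul_le_mul_of_nonneg_left b1 (abs_nonneg _))
  have e2 : ‖gradField c t x‖ ≤ C2 :=
    (norm_gradField_le c t x).trans (mul_le_mul_of_nonneg_left b1 (by positivity))
  have e3 : |accField c t x| ≤ C3 := by
    rw [accField, abs_mul]
    exact mul_le_mul_of_nonneg_left ((Complex.abs_im_le_norm _).trans b2) (abs_nonneg _)
  have e4 : ‖velGradField c t x‖ ≤ C4 :=
    (norm_velGradField_le c t x).trans (mul_le_mul_of_nonneg_left b2 (by positivity))
  refine ⟨?_, ?_, ?_, ?_, ?_⟩ <;> linarith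

theorem memLp_outer {E : Type*} [NormedAddCommGroup E] {F : ℝ → Plane → E} {p : ℝ≥0∞}
    (hm : AEStronglyMeasurable (fun q : ℝ × Plane => F q.1 q.2) (cylMeasure T (Metric.ball 0 R)))
    {C : ℝ} (hC0 : 0 ≤ C)
    (hC : ∀ t ∈ Icc 0 T, ∀ x ∈ Metric.ball (0 : Plane) R, ρ ≤ ‖x‖ → ‖F t x‖ ≤ C)
    (h0 : ∀ t x, ‖x‖ < ρ → F t x = 0) :
    MemLp (fun q : ℝ × Plane => F q.1 q.2) p (cylMeasure T (Metric.ball 0 R)) := by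
  refine memLp_cyl_of_bound hm C ?_
  filter_upwards [ae_cyl_mem Metric.isOpen_ball.measurableSet] with q hq
  rcases lt_or_ge ‖q.2‖ ρ with h | h
  · rw [h0 _ _ h, norm_zero]
    exact hC0
  · exact hC _ (Ioo_subset_Icc_self hq.1) _ hq.2 h

end Bounds

/-! ### Products with a cutoff that removes the path of the tip -/

section Cutoff

variable {R T c ρ : ℝ} {θ : Plane → ℝ}

theorem IsInnerCutoff.exists_bounds (h : IsInnerCutoff R ρ θ) :
    ∃ C : ℝ, 0 ≤ C ∧ ∀ x, |θ x| ≤ C ∧ |1 - θ x| ≤ C ∧ ‖gradient θ x‖ ≤ C := by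
  obtain ⟨C1, h1⟩ := h.contDiff.continuous.bounded_above_of_compact_support h.hasCompactSupport
  obtain ⟨C2, h2⟩ := (h.contDiff.continuous_fderiv (by simp)).bounded_above_of_compact_support
    (h.hasCompactSupport.fderiv ℝ)
  have p1 : 0 ≤ C1 := (norm_nonneg _).trans (h1 0)
  have p2 : 0 ≤ C2 := (norm_nonneg _).trans (h2 0)
  refine ⟨1 + C1 + C2, by positivity, fun x => ?_⟩
  have e1 := h1 x
  have e2 := h2 x
  rw [Real.norm_eq_abs] at e1
  rw [norm_gradient]
  have e3 : |1 - θ x| ≤ 1 + |θ x| := (abs_sub _ _).trans (by simp)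
  refine ⟨?_, ?_, ?_⟩ <;> linarith

theorem IsInnerCutoff.gradient_eq_zero (h : IsInnerCutoff R ρ θ) {x : Plane} (hx : ‖x‖ < ρ) :
    gradient θ x = 0 := by
  have : θ =ᶠ[𝓝 x] fun _ => 1 := by
    filter_upwards [Metric.isOpen_ball.mem_nhds (mem_ball_zero_iff.2 hx)] with y hy
    exact h.eq_one y hy
  rw [gradient_congr this]
  simp [gradient]

/-- The product rule for an outer cutoff of a function which is regular away from the tip. -/
theorem IsInnerCutoff.gradient_outer (h : IsInnerCutoff R ρ θ) {g : Plane → ℝ} {G : Plane}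
    {x : Plane} (hg : ρ ≤ ‖x‖ → DifferentiableAt ℝ g x ∧ gradient g x = G) :
    gradient (fun y => (1 - θ y) * g y) x = (1 - θ x) • G - g x • gradient θ x := by
  rcases lt_or_ge ‖x‖ ρ with hx | hx
  · have : (fun y => (1 - θ y) * g y) =ᶠ[𝓝 x] fun _ => 0 := by
      filter_upwards [Metric.isOpen_ball.mem_nhds (mem_ball_zero_iff.2 hx)] with y hy
      rw [h.eq_one y hy]
      ring
    rw [gradient_congr this, h.gradient_eq_zero hx, h.eq_one x (mem_ball_zero_iff.2 hx)]
    simp [gradient]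
  · obtain ⟨h1, h2⟩ := hg hx
    have hd : DifferentiableAt ℝ θ x := h.contDiff.differentiable (by simp) x
    rw [gradient_fun_mul (hd.const_sub 1) h1, h2]
    ext i
    simp only [PiLp.add_apply, PiLp.sub_apply, PiLp.smul_apply, gradient_coord]
    rw [fderiv_const_sub]
    simp
    ring

/-- A point of Γ_t with norm at least ρ > cT cannot have positive first coordinate, so it already
lies in Γ_0. Hence (1 - θ)u jumps across the initial crack only, as a datum with values in V_0 must.
-/
theorem tipCoord_mem_slitPlane_of_outer (hc0 : 0 < c) (hc1 : c < 1) (hρ : c * T < ρ) {t : ℝ}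
    (ht : t ∈ Icc 0 T) {x : Plane} (hx : x ∈ Metric.ball (0 : Plane) R \ crack R c 0)
    (hxρ : ρ ≤ ‖x‖) : tipCoord c t x ∈ Complex.slitPlane := by
  rw [tipCoord_mem_slitPlane_iff hc0 hc1]
  rintro ⟨h1, h2⟩
  refine hx.2 ⟨Metric.ball_subset_closedBall hx.1, h1, ?_⟩
  have hn : ‖x‖ = |x 0| := by
    rw [EuclideanSpace.norm_eq, Fin.sum_univ_two, h1]
    simp [Real.sqrt_sq_eq_abs]
  have h3 : c * t ≤ c * T := mul_le_mul_of_nonneg_left ht.2 hc0.le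
  rw [mul_zero]
  by_contra! h4
  rw [abs_of_pos h4] at hn
  linarith

theorem IsInnerCutoff.contDiffOn_outer (h : IsInnerCutoff R ρ θ) (hc0 : 0 < c) (hc1 : c < 1)
    (hρ : c * T < ρ) {t : ℝ} (ht : t ∈ Icc 0 T) {g : Plane → ℝ}
    (hg : ContDiffOn ℝ ∞ g (tipCoord c t ⁻¹' Complex.slitPlane)) :
    ContDiffOn ℝ 1 (fun x => (1 - θ x) * g x) (Metric.ball (0 : Plane) R \ crack R c 0) := by
  intro x hx
  apply ContDiffAt.contDiffWithinAt
  rcases lt_or_ge ‖x‖ ρ with hxρ | hxρ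
  · have : (fun y => (1 - θ y) * g y) =ᶠ[𝓝 x] fun _ => 0 := by
      filter_upwards [Metric.isOpen_ball.mem_nhds (mem_ball_zero_iff.2 hxρ)] with y hy
      rw [h.eq_one y hy]
      ring
    exact contDiffAt_const.congr_of_eventuallyEq this
  · have hz := tipCoord_mem_slitPlane_of_outer hc0 hc1 hρ ht hx hxρ
    exact ((contDiff_const.sub h.contDiff).contDiffAt.mul (hg.contDiffAt
      ((isOpen_preimage_slitPlane c t).mem_nhds hz))).of_le (by simp)

theorem IsInnerCutoff.weakGradient_outer (h : IsInnerCutoff R ρ θ) (hc0 : 0 < c) (hc1 : c < 1)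
    (hρ : c * T < ρ) {t : ℝ} (ht : t ∈ Icc 0 T) {g : Plane → ℝ} {G : Plane → Plane}
    (hg : ContDiffOn ℝ ∞ g (tipCoord c t ⁻¹' Complex.slitPlane))
    (hG : ∀ x, tipCoord c t x ∈ Complex.slitPlane → gradient g x = G x) :
    HasWeakGradient (Metric.ball (0 : Plane) R \ crack R c 0) (fun x => (1 - θ x) * g x)
      (fun x => (1 - θ x) • G x - g x • gradient θ x) := by
  have hU : IsOpen (Metric.ball (0 : Plane) R \ crack R c 0) :=
    Metric.isOpen_ball.sdiff (isClosed_crack R c 0)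
  refine (hasWeakGradient_of_contDiffOn hU (h.contDiffOn_outer hc0 hc1 hρ ht hg)).congr ?_
  filter_upwards [ae_restrict_mem hU.measurableSet] with x hx
  refine h.gradient_outer fun hxρ => ?_
  have hz := tipCoord_mem_slitPlane_of_outer hc0 hc1 hρ ht hx hxρ
  exact ⟨(hg.differentiableOn (by simp)).differentiableAt
    ((isOpen_preimage_slitPlane c t).mem_nhds hz), hG x hz⟩

end Cutoff

theorem isL2Sobolev_of_weakGradient {T R : ℝ} {Γ : ℝ → Set Plane} (hΓ : ∀ t, volume (Γ t) = 0)
    {v : ℝ → Plane → ℝ} {Dv : ℝ → Plane → Plane}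
    (hv : MemLp (fun p : ℝ × Plane => v p.1 p.2) 2 (cylMeasure T (Metric.ball 0 R)))
    (hD : MemLp (fun p : ℝ × Plane => Dv p.1 p.2) 2 (cylMeasure T (Metric.ball 0 R)))
    (hw : ∀ᵐ t ∂(volume.restrict (Ioo 0 T)),
      HasWeakGradient (Metric.ball (0 : Plane) R \ Γ t) (v t) (Dv t)) :
    IsL2Sobolev T (Metric.ball 0 R) Γ v Dv := by
  refine ⟨hv, hD, ?_⟩
  filter_upwards [hw, ae_memLp_slice hv, ae_memLp_slice hD] with t h1 h2 h3
  rw [← restrict_diff_null (hΓ t)] at h2 h3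
  exact ⟨h2, h3, h1⟩

theorem ae_restrict_Ioo_mem_Icc (T : ℝ) : ∀ᵐ t ∂(volume.restrict (Ioo (0 : ℝ) T)), t ∈ Icc 0 T :=
  (ae_restrict_mem measurableSet_Ioo).mono fun _ h => Ioo_subset_Icc_self h

/-! ### An explicit Dirichlet datum -/

section Datum

variable {R T c ρ : ℝ} {θ : Plane → ℝ}

theorem IsInnerCutoff.memLp_mul (h : IsInnerCutoff R ρ θ) {g : ℝ → Plane → ℝ}
    (hm : Measurable fun p : ℝ × Plane => g p.1 p.2) {C : ℝ}
    (hC : ∀ t ∈ Icc 0 T, ∀ x ∈ Metric.ball (0 : Plane) R, ρ ≤ ‖x‖ → |g t x| ≤ C) {p : ℝ≥0∞} :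
    MemLp (fun q : ℝ × Plane => (1 - θ q.2) * g q.1 q.2) p (cylMeasure T (Metric.ball 0 R)) := by
  obtain ⟨B, hB0, hB⟩ := h.exists_bounds
  refine memLp_outer (F := fun t x => (1 - θ x) * g t x) (C := B * |C|) (ρ := ρ)
    (((continuous_const.sub (h.contDiff.continuous.comp continuous_snd)).measurable.mul
      hm).aestronglyMeasurable) (by positivity) (fun t ht x hx hxρ => ?_) fun t x hx => ?_
  · rw [Real.norm_eq_abs, abs_mul]
    have := hC t ht x hx hxρ
    exact mul_le_mul (hB x).2.1 (this.trans (le_abs_self C)) (abs_nonneg _) hB0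
  · rw [h.eq_one x (mem_ball_zero_iff.2 hx)]
    ring

theorem IsInnerCutoff.memLp_outer_gradient (h : IsInnerCutoff R ρ θ) {g : ℝ → Plane → ℝ}
    {G : ℝ → Plane → Plane} (hm : Measurable fun p : ℝ × Plane => g p.1 p.2)
    (hM : Measurable fun p : ℝ × Plane => G p.1 p.2) {C : ℝ}
    (hC : ∀ t ∈ Icc 0 T, ∀ x ∈ Metric.ball (0 : Plane) R, ρ ≤ ‖x‖ → |g t x| ≤ C ∧ ‖G t x‖ ≤ C)
    {p : ℝ≥0∞} :
    MemLp (fun q : ℝ × Plane => (1 - θ q.2) • G q.1 q.2 - g q.1 q.2 • gradient θ q.2) p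
      (cylMeasure T (Metric.ball 0 R)) := by
  obtain ⟨B, hB0, hB⟩ := h.exists_bounds
  have hcg : Continuous fun q : ℝ × Plane => gradient θ q.2 :=
    (continuous_gradient (h.contDiff.of_le (by simp))).comp continuous_snd
  refine memLp_outer (F := fun t x => (1 - θ x) • G t x - g t x • gradient θ x)
    (C := B * |C| + |C| * B) (ρ := ρ)
    (((continuous_const.sub (h.contDiff.continuous.comp continuous_snd)).measurable.smul
      hM).sub (hm.smul hcg.measurable)).aestronglyMeasurable (by positivity)
      (fun t ht x hx hxρ => ?_) fun t x hx => ?_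
  · have := hC t ht x hx hxρ
    refine (norm_sub_le _ _).trans ?_
    rw [norm_smul, norm_smul]
    refine add_le_add ?_ ?_
    · exact mul_le_mul (hB x).2.1 (this.2.trans (le_abs_self C)) (norm_nonneg _) hB0
    · exact mul_le_mul (this.1.trans (le_abs_self C)) (hB x).2.2 (norm_nonneg _) (abs_nonneg _)
  · rw [h.eq_one x (mem_ball_zero_iff.2 hx), h.gradient_eq_zero hx]
    simp

/-- The displacement, cut off near the crack tip, is an admissible Dirichlet datum. -/
theorem IsInnerCutoff.isDirichletDatum (h : IsInnerCutoff R ρ θ) (hR : 0 < R) (hT : 0 < T)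
    (hc0 : 0 < c) (hc1 : c < 1) (hρ : c * T < ρ) :
    IsDirichletDatum T (Metric.ball 0 R) (crack R c 0)
      (fun t x => (1 - θ x) * crackDisplacement c t x) (fun t x => (1 - θ x) * velField c t x)
      (fun t x => (1 - θ x) * accField c t x)
      (fun t x => (1 - θ x) • gradField c t x - crackDisplacement c t x • gradient θ x)
      (fun t x => (1 - θ x) • velGradField c t x - velField c t x • gradient θ x) := by
  obtain ⟨C, hC0, hC⟩ := exists_outer_bounds hR hT hc0 hc1 hρ
  have m0 := h.memLp_mul (p := 2) (measurable_crackDisplacement c)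
    fun t ht x hx hxρ => (hC t ht x hx hxρ).1
  have m1 := h.memLp_mul (p := 2) (measurable_velField c)
    fun t ht x hx hxρ => (hC t ht x hx hxρ).2.1
  have m2 := h.memLp_mul (p := 2) (measurable_accField c)
    fun t ht x hx hxρ => (hC t ht x hx hxρ).2.2.2.1
  have g0 := h.memLp_outer_gradient (p := 2) (measurable_crackDisplacement c)
    (measurable_gradField c)
    fun t ht x hx hxρ => ⟨(hC t ht x hx hxρ).1, (hC t ht x hx hxρ).2.2.1⟩
  have g1 := h.memLp_outer_gradient (p := 2) (measurable_velField c) (measurable_velGradField c)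
    fun t ht x hx hxρ => ⟨(hC t ht x hx hxρ).2.1, (hC t ht x hx hxρ).2.2.2.2⟩
  refine ⟨isH1Time_of_hasDerivAt m0 m1 (fun x hx t => ?_) (fun x hx => ?_),
    isH1Time_of_hasDerivAt m1 m2 (fun x hx t => ?_) (fun x hx => ?_),
    isL2Sobolev_of_weakGradient (fun _ => volume_crack R c 0) m0 g0 ?_,
    isL2Sobolev_of_weakGradient (fun _ => volume_crack R c 0) m1 g1 ?_⟩
  · exact (hasDerivAt_crackDisplacement (tipCoord_mem_slitPlane hx)).const_mul _
  · exact (continuous_velField_time hx).const_mul _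
  · exact (hasDerivAt_velField (tipCoord_mem_slitPlane hx)).const_mul _
  · exact (continuous_accField_time hx).const_mul _
  · filter_upwards [ae_restrict_Ioo_mem_Icc T] with t ht
    exact h.weakGradient_outer hc0 hc1 hρ ht (contDiffOn_crackDisplacement c t)
      fun x hx => gradient_crackDisplacement hx
  · filter_upwards [ae_restrict_Ioo_mem_Icc T] with t ht
    exact h.weakGradient_outer hc0 hc1 hρ ht (contDiffOn_velField c t)
      fun x hx => gradient_velField hx

theorem memLp_crackDisplacement {p : ℝ≥0∞} (hR : 0 < R) (hT : 0 < T) (hc0 : 0 < c) (hc1 : c < 1) :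
    MemLp (fun q : ℝ × Plane => crackDisplacement c q.1 q.2) p
      (cylMeasure T (Metric.ball 0 R)) := by
  obtain ⟨C, _, hC⟩ := exists_bound_crackDisplacement hR hT hc0 hc1
  refine memLp_cyl_of_bound (measurable_crackDisplacement c).aestronglyMeasurable C ?_
  filter_upwards [ae_cyl_mem Metric.isOpen_ball.measurableSet] with q hq
  exact hC _ (Ioo_subset_Icc_self hq.1) _ hq.2

theorem memLp_crackDisplacement_at {p : ℝ≥0∞} (hR : 0 < R) (hT : 0 < T) (hc0 : 0 < c)
    (hc1 : c < 1) {t : ℝ} (ht : t ∈ Icc 0 T) :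
    MemLp (crackDisplacement c t) p (volume.restrict (Metric.ball 0 R)) := by
  obtain ⟨C, _, hC⟩ := exists_bound_crackDisplacement hR hT hc0 hc1
  have hm : Measurable fun x => crackDisplacement c t x :=
    Measurable.comp (g := fun p : ℝ × Plane => crackDisplacement c p.1 p.2)
      (measurable_crackDisplacement c) (f := fun x => (t, x)) measurable_prodMk_left
  refine MemLp.of_bound hm.aestronglyMeasurable C ?_
  filter_upwards [ae_restrict_mem Metric.isOpen_ball.measurableSet] with x hx
  exact hC _ ht _ hx

theorem weakGradient_crackDisplacement (hc0 : 0 < c) (hc1 : c < 1) (t : ℝ) :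
    HasWeakGradient (Metric.ball (0 : Plane) R \ crack R c t) (crackDisplacement c t)
      (gradField c t) := by
  have hU : IsOpen (Metric.ball (0 : Plane) R \ crack R c t) :=
    Metric.isOpen_ball.sdiff (isClosed_crack R c t)
  refine (hasWeakGradient_of_contDiffOn hU (((contDiffOn_crackDisplacement c t).mono
    fun x hx => tipCoord_mem_of_notMem_crack hc0 hc1 hx).of_le (by simp))).congr ?_
  filter_upwards [ae_restrict_mem hU.measurableSet] with x hx
  exact gradient_crackDisplacement (tipCoord_mem_of_notMem_crack hc0 hc1 hx)

theorem isSobolev_crackDisplacement (hR : 0 < R) (hT : 0 < T) (hc0 : 0 < c) (hc1 : c < 1)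
    (hcT : c * T < R) {t : ℝ} (ht : t ∈ Icc 0 T) :
    IsSobolev (Metric.ball 0 R \ crack R c t) (crackDisplacement c t) (gradField c t) := by
  refine ⟨?_, ?_, weakGradient_crackDisplacement hc0 hc1 t⟩
  · rw [restrict_diff_null (volume_crack R c t)]
    exact memLp_crackDisplacement_at hR hT hc0 hc1 ht
  · rw [restrict_diff_null (volume_crack R c t)]
    exact memLp_gradField_at hR hc0 hc1 hcT ht

theorem HasWeakGradient.sub {U : Set Plane} {v v' : Plane → ℝ} {G G' : Plane → Plane}
    (h : HasWeakGradient U v G) (h' : HasWeakGradient U v' G')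
    (hv : IntegrableOn v U) (hv' : IntegrableOn v' U) (hG : IntegrableOn G U)
    (hG' : IntegrableOn G' U) :
    HasWeakGradient U (fun x => v x - v' x) (fun x => G x - G' x) := by
  intro η h1 h2 h3 i
  have c1 : IntegrableOn (fun x => G x i) U :=
    (EuclideanSpace.proj i : Plane →L[ℝ] ℝ).integrable_comp hG
  have c2 : IntegrableOn (fun x => G' x i) U :=
    (EuclideanSpace.proj i : Plane →L[ℝ] ℝ).integrable_comp hG'
  have e1 := integral_sub (test_fderiv_mul_integrable hv h1 h2 (basisVec i))
    (test_fderiv_mul_integrable hv' h1 h2 (basisVec i))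
  have e2 := integral_sub (test_mul_integrable c1 h1.continuous h2)
    (test_mul_integrable c2 h1.continuous h2)
  simp only [sub_mul, PiLp.sub_apply]
  rw [e1, e2, h η h1 h2 h3 i, h' η h1 h2 h3 i]
  ring

theorem IsSobolev.sub {U : Set Plane} {v v' : Plane → ℝ} {G G' : Plane → Plane}
    (h : IsSobolev U v G) (h' : IsSobolev U v' G') (hU : volume U ≠ ⊤) :
    IsSobolev U (fun x => v x - v' x) (fun x => G x - G' x) := by
  have : IsFiniteMeasure (volume.restrict U) := ⟨by
    rw [Measure.restrict_apply_univ]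
    exact hU.lt_top⟩
  exact ⟨h.memLp.sub h'.memLp, h.memLp_grad.sub h'.memLp_grad, h.weak.sub h'.weak
    (h.memLp.integrable (by simp)) (h'.memLp.integrable (by simp))
    (h.memLp_grad.integrable (by simp)) (h'.memLp_grad.integrable (by simp))⟩

theorem volume_ball_diff_ne_top (R : ℝ) (K : Set Plane) :
    volume (Metric.ball (0 : Plane) R \ K) ≠ ⊤ :=
  ((measure_mono sdiff_subset).trans_lt measure_ball_lt_top).ne

theorem IsInnerCutoff.isSobolev_outer (h : IsInnerCutoff R ρ θ) (hR : 0 < R) (hT : 0 < T)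
    (hc0 : 0 < c) (hc1 : c < 1) (hρ : c * T < ρ) {t : ℝ} (ht : t ∈ Icc 0 T) :
    IsSobolev (Metric.ball 0 R \ crack R c t) (fun x => (1 - θ x) * crackDisplacement c t x)
      (fun x => (1 - θ x) • gradField c t x - crackDisplacement c t x • gradient θ x) := by
  obtain ⟨C, hC0, hC⟩ := exists_outer_bounds hR hT hc0 hc1 hρ
  obtain ⟨B, hB0, hB⟩ := h.exists_bounds
  have hmem := ae_restrict_mem (μ := (volume : Measure Plane))
    (Metric.isOpen_ball (x := (0 : Plane)) (ε := R)).measurableSet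
  have hmu : Measurable fun x => crackDisplacement c t x :=
    Measurable.comp (g := fun p : ℝ × Plane => crackDisplacement c p.1 p.2)
      (measurable_crackDisplacement c) (f := fun x => (t, x)) measurable_prodMk_left
  have hmg : Measurable fun x => gradField c t x :=
    Measurable.comp (g := fun p : ℝ × Plane => gradField c p.1 p.2)
      (measurable_gradField c) (f := fun x => (t, x)) measurable_prodMk_left
  have hχ : Continuous fun x => 1 - θ x := continuous_const.sub h.contDiff.continuous
  have hcg := continuous_gradient (h.contDiff.of_le (by simp) : ContDiff ℝ 1 θ)
  refine ⟨?_, ?_, (h.weakGradient_outer hc0 hc1 hρ ht (contDiffOn_crackDisplacement c t)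
      fun x hx => gradient_crackDisplacement hx).mono
        (sdiff_subset_sdiff_right (crack_mono hc0 ht.1))⟩
  · rw [restrict_diff_null (volume_crack R c t)]
    refine MemLp.of_bound (hχ.measurable.mul hmu).aestronglyMeasurable (B * C) ?_
    filter_upwards [hmem] with x hx
    rcases lt_or_ge ‖x‖ ρ with hxρ | hxρ
    · rw [h.eq_one x (mem_ball_zero_iff.2 hxρ)]
      simp
      positivity
    · rw [Real.norm_eq_abs, abs_mul]
      exact mul_le_mul (hB x).2.1 (hC t ht x hx hxρ).1 (abs_nonneg _) hB0
  · rw [restrict_diff_null (volume_crack R c t)]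
    refine MemLp.of_bound ((hχ.measurable.smul hmg).sub
      (hmu.smul hcg.measurable)).aestronglyMeasurable (B * C + C * B) ?_
    filter_upwards [hmem] with x hx
    rcases lt_or_ge ‖x‖ ρ with hxρ | hxρ
    · rw [h.eq_one x (mem_ball_zero_iff.2 hxρ), h.gradient_eq_zero hxρ]
      simp
      positivity
    · refine (norm_sub_le _ _).trans ?_
      have := hC t ht x hx hxρ
      rw [norm_smul, norm_smul]
      refine add_le_add ?_ ?_
      · exact mul_le_mul (hB x).2.1 this.2.2.1 (norm_nonneg _) hB0
      · exact mul_le_mul this.1 (hB x).2.2 (norm_nonneg _) hC0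

/-- The difference is θu, which vanishes near the boundary circle and so approximates itself in the
definition of zero trace. -/
theorem IsInnerCutoff.zeroTrace_sub (h : IsInnerCutoff R ρ θ) (hR : 0 < R) (hT : 0 < T)
    (hc0 : 0 < c) (hc1 : c < 1) (hcT : c * T < R) (hρ : c * T < ρ) {t : ℝ} (ht : t ∈ Icc 0 T) :
    IsSobolevZeroTrace (Metric.ball 0 R) (crack R c t)
      (fun x => crackDisplacement c t x - (1 - θ x) * crackDisplacement c t x)
      (fun x => gradField c t x
        - ((1 - θ x) • gradField c t x - crackDisplacement c t x • gradient θ x)) := by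
  refine ((isSobolev_crackDisplacement hR hT hc0 hc1 hcT ht).sub
    (h.isSobolev_outer hR hT hc0 hc1 hρ ht) (volume_ball_diff_ne_top R _)).zeroTrace_of_tsupport
    hR ?_
  have : (fun x => crackDisplacement c t x - (1 - θ x) * crackDisplacement c t x)
      = fun x => θ x * crackDisplacement c t x := by
    funext x
    ring
  rw [this]
  exact tsupport_mul_subset_left.trans h.tsupport_subset

theorem IsInnerCutoff.sameTrace (h : IsInnerCutoff R ρ θ) (hR : 0 < R) (hT : 0 < T)
    (hc0 : 0 < c) (hc1 : c < 1) (hcT : c * T < R) (hρ : c * T < ρ) :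
    SameTrace T (Metric.ball 0 R) (crack R c) (crackDisplacement c)
      (fun t x => (1 - θ x) * crackDisplacement c t x) := fun _ ht =>
  ⟨_, h.zeroTrace_sub hR hT hc0 hc1 hcT hρ ht⟩

end Datum

/-! ### Energy identity for the explicit datum -/

section EnergyOuter

variable {R T c ρ t : ℝ} {θ : Plane → ℝ}

/-- The energy identity tested with the displacement cut off near the crack tip. -/
theorem IsInnerCutoff.energy_identity (h : IsInnerCutoff R ρ θ) (hR : 0 < R) (hT : 0 < T)
    (hc0 : 0 < c) (hc1 : c < 1) (hcT : c * T < R) (hρ : c * T < ρ) (ht : t ∈ Icc 0 T) :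
    (∫ x in Metric.ball (0 : Plane) R, energyDensity c t x)
      - (∫ x in Metric.ball (0 : Plane) R, energyDensity c 0 x) + c * t
    = (∫ s in (0 : ℝ)..t, ∫ x in Metric.ball (0 : Plane) R, inner ℝ (gradField c s x)
        ((1 - θ x) • velGradField c s x - velField c s x • gradient θ x))
      - (∫ s in (0 : ℝ)..t, ∫ x in Metric.ball (0 : Plane) R,
          velField c s x * ((1 - θ x) * accField c s x))
      + (∫ x in Metric.ball (0 : Plane) R, velField c t x * ((1 - θ x) * velField c t x))
      - ∫ x in Metric.ball (0 : Plane) R, velField c 0 x * ((1 - θ x) * velField c 0 x) := by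
  obtain ⟨C, hC0, hC⟩ := exists_outer_bounds hR hT hc0 hc1 hρ
  obtain ⟨B, hB0, hB⟩ := h.exists_bounds
  have hθ1 : ContDiff ℝ 1 θ := h.contDiff.of_le (by simp)
  have hχ : Continuous fun x => 1 - θ x := continuous_const.sub h.contDiff.continuous
  have h0 : (0 : ℝ) ∈ Icc 0 T := ⟨le_rfl, hT.le⟩
  -- integrability on the cylinder
  have i1 : Integrable (fun p : ℝ × Plane => (1 - θ p.2) *
      inner ℝ (gradField c p.1 p.2) (velGradField c p.1 p.2)) (cylMeasure T (Metric.ball 0 R)) := by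
    refine memLp_one_iff_integrable.1 (h.memLp_mul
      (g := fun s x => inner ℝ (gradField c s x) (velGradField c s x)) (C := C * C)
      ((measurable_gradField c).inner (measurable_velGradField c)) fun t ht x hx hxρ => ?_)
    have := hC t ht x hx hxρ
    exact (abs_real_inner_le_norm _ _).trans
      (mul_le_mul this.2.2.1 this.2.2.2.2 (norm_nonneg _) hC0)
  have i3 : Integrable (fun p : ℝ × Plane => (1 - θ p.2) *
      (velField c p.1 p.2 * accField c p.1 p.2)) (cylMeasure T (Metric.ball 0 R)) := by
    refine memLp_one_iff_integrable.1 (h.memLp_mul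
      (g := fun s x => velField c s x * accField c s x) (C := C * C)
      ((measurable_velField c).mul (measurable_accField c)) fun t ht x hx hxρ => ?_)
    have := hC t ht x hx hxρ
    rw [abs_mul]
    exact mul_le_mul this.2.1 this.2.2.2.1 (abs_nonneg _) hC0
  have i2 := integrable_velField_mul_inner hR hc0 hc1 hcT hθ1
  have hE : ∀ s ∈ Icc 0 T, IntegrableOn (energyDensity c s) (Metric.ball 0 R) := fun s hs =>
    integrable_energyDensity_at hR hc0 hc1 hcT hs
  have hV : ∀ s ∈ Icc 0 T, IntegrableOn (fun x => velField c s x ^ 2) (Metric.ball 0 R) :=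
    fun s hs => (memLp_velField_at hR hc0 hc1 hcT hs).integrable_sq
  -- the two time derivatives
  have A := integral_time_deriv (g := fun s x => (1 - θ x) * energyDensity c s x)
    (g' := fun s x => (1 - θ x) * inner ℝ (gradField c s x) (velGradField c s x)
      + (1 - θ x) * (velField c s x * accField c s x)) ht (i1.add i3)
    (fun x hx s => ((hasDerivAt_energyDensity hx s).const_mul (1 - θ x)).congr_deriv (by ring))
    (fun x hx => (((continuous_gradField_time hx).inner (continuous_velGradField_time hx)).const_mul
      _).add (((continuous_velField_time hx).mul (continuous_accField_time hx)).const_mul _))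
    (integrable_ball_mul hχ (hE t ht)) (integrable_ball_mul hχ (hE 0 h0))
  have Bk := integral_time_deriv (g := fun s x => (1 - θ x) * velField c s x ^ 2)
    (g' := fun s x => 2 * ((1 - θ x) * (velField c s x * accField c s x))) ht (i3.const_mul 2)
    (fun x hx s => (((hasDerivAt_velField (tipCoord_mem_slitPlane hx)).fun_pow 2).const_mul
      (1 - θ x)).congr_deriv (by simp; ring))
    (fun x hx => (((continuous_velField_time hx).mul
      (continuous_accField_time hx)).const_mul _).const_mul _)
    (integrable_ball_mul hχ (hV t ht)) (integrable_ball_mul hχ (hV 0 h0))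
  -- With P, Q and F the space-time integrals of (1 - θ)∇u·∇u̇, (1 - θ)u̇ü and u̇∇u·∇θ, the
  -- increment of the outer energy is P + Q, that of the inner energy is -ct - F, and the end terms
  -- in the velocity give 2Q. These three relations yield the claim without spatial integration by
  -- parts on the outer part.
  have Rl := energy_release hR hc0 hc1 hcT ht h.contDiff h.tsupport_subset h.hasCompactSupport
    fun s hs => h.eq_one _ (by
      rw [mem_ball_zero_iff, norm_tip hc0 hs.1]
      exact (mul_le_mul_of_nonneg_left hs.2 hc0.le).trans_lt hρ)
  have hle := cylMeasure_mono ht.2 (Metric.ball (0 : Plane) R)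
  have split : ∀ s ∈ Icc 0 T, ∫ x in Metric.ball (0 : Plane) R, energyDensity c s x
      = (∫ x in Metric.ball (0 : Plane) R, (1 - θ x) * energyDensity c s x)
        + ∫ x in Metric.ball (0 : Plane) R, θ x * energyDensity c s x := by
    intro s hs
    rw [← integral_add (integrable_ball_mul hχ (hE s hs))
      (integrable_ball_mul h.contDiff.continuous (hE s hs))]
    exact integral_congr_ae (ae_of_all _ fun x => by ring)
  rw [split t ht, split 0 h0]
  have e1 : ∫ s in (0 : ℝ)..t, ∫ x in Metric.ball (0 : Plane) R, inner ℝ (gradField c s x)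
        ((1 - θ x) • velGradField c s x - velField c s x • gradient θ x)
      = (∫ p, (1 - θ p.2) * inner ℝ (gradField c p.1 p.2) (velGradField c p.1 p.2)
          ∂(cylMeasure t (Metric.ball 0 R)))
        - ∫ p, velField c p.1 p.2 * inner ℝ (gradField c p.1 p.2) (gradient θ p.2)
          ∂(cylMeasure t (Metric.ball 0 R)) := by
    have e : ∀ s x, inner ℝ (gradField c s x)
        ((1 - θ x) • velGradField c s x - velField c s x • gradient θ x)
        = (1 - θ x) * inner ℝ (gradField c s x) (velGradField c s x)
          - velField c s x * inner ℝ (gradField c s x) (gradient θ x) := by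
      intro s x
      rw [inner_sub_right, inner_smul_right, inner_smul_right]
    simp only [e]
    rw [← integral_sub (i1.mono_measure hle) (i2.mono_measure hle)]
    exact integral_time_space (F := fun s x =>
      (1 - θ x) * inner ℝ (gradField c s x) (velGradField c s x)
        - velField c s x * inner ℝ (gradField c s x) (gradient θ x)) ht (i1.sub i2)
  have e2 : ∫ s in (0 : ℝ)..t, ∫ x in Metric.ball (0 : Plane) R,
        velField c s x * ((1 - θ x) * accField c s x)
      = ∫ p, (1 - θ p.2) * (velField c p.1 p.2 * accField c p.1 p.2)
          ∂(cylMeasure t (Metric.ball 0 R)) := by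
    have e : ∀ s x, velField c s x * ((1 - θ x) * accField c s x)
        = (1 - θ x) * (velField c s x * accField c s x) := fun s x => by ring
    simp only [e]
    exact integral_time_space (F := fun s x => (1 - θ x) * (velField c s x * accField c s x)) ht i3
  rw [integral_time_space (F := fun s x =>
      (1 - θ x) * inner ℝ (gradField c s x) (velGradField c s x)
        + (1 - θ x) * (velField c s x * accField c s x)) ht (i1.add i3),
    integral_add (i1.mono_measure hle) (i3.mono_measure hle)] at A
  rw [integral_time_space (F := fun s x => 2 * ((1 - θ x) * (velField c s x * accField c s x))) ht
    (i3.const_mul 2), integral_const_mul] at Bk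
  rw [integral_time_space (F := fun s x =>
    velField c s x * inner ℝ (gradField c s x) (gradient θ x)) ht i2] at Rl
  have e3 : ∀ s x, velField c s x * ((1 - θ x) * velField c s x)
      = (1 - θ x) * velField c s x ^ 2 := fun s x => by ring
  simp only [e3]
  rw [e1, e2]
  linarith

end EnergyOuter

/-! ### Boundary values of the velocity of a general datum -/

section Datum

variable {R T c ρ : ℝ} {θ : Plane → ℝ}

theorem isClosed_outer (ρ : ℝ) : IsClosed {x : Plane | ρ ≤ ‖x‖} :=
  isClosed_le continuous_const continuous_norm

theorem IsInnerCutoff.tsupport_one_sub (h : IsInnerCutoff R ρ θ) :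
    tsupport (fun x => 1 - θ x) ⊆ {x | ρ ≤ ‖x‖} := by
  refine closure_minimal (fun x hx => ?_) (isClosed_outer ρ)
  by_contra hlt
  exact hx (by
    simp only [h.eq_one x (mem_ball_zero_iff.2 (not_le.1 hlt)), sub_self])

theorem crack_inter_outer (hρ : c * T < ρ) :
    crack R c T ∩ {x | ρ ≤ ‖x‖} ⊆ crack R c 0 := by
  rintro x ⟨⟨h1, h2, h3⟩, h4⟩
  refine ⟨h1, h2, ?_⟩
  have h4' : ρ ≤ ‖x‖ := h4
  have hn : ‖x‖ = |x 0| := by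
    rw [EuclideanSpace.norm_eq, Fin.sum_univ_two, h2]
    simp [Real.sqrt_sq_eq_abs]
  rw [mul_zero]
  by_contra! h5
  rw [hn, abs_of_pos h5] at h4'
  linarith

theorem IsL2Sobolev.sub_const {K : Set Plane} {v v' : ℝ → Plane → ℝ} {G G' : ℝ → Plane → Plane}
    (h : IsL2Sobolev T (Metric.ball 0 R) (fun _ => K) v G)
    (h' : IsL2Sobolev T (Metric.ball 0 R) (fun _ => K) v' G') :
    IsL2Sobolev T (Metric.ball 0 R) (fun _ => K) (fun t x => v t x - v' t x)
      (fun t x => G t x - G' t x) := by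
  refine ⟨h.memLp.sub h'.memLp, h.memLp_grad.sub h'.memLp_grad, ?_⟩
  filter_upwards [h.sobolev, h'.sobolev] with t h1 h2
  exact h1.sub h2 (volume_ball_diff_ne_top R K)

/-- The velocities of two data with the same trace have the same trace at almost every time. -/
theorem IsInnerCutoff.ae_weakZeroTrace (h : IsInnerCutoff R ρ θ) (hR : 0 < R) (hT : 0 < T)
    (hc0 : 0 < c) (hc1 : c < 1) (hcT : c * T < R) (hρ : c * T < ρ)
    {w w' w'' : ℝ → Plane → ℝ} {Dw Dw' : ℝ → Plane → Plane}
    (hw : IsDirichletDatum T (Metric.ball 0 R) (crack R c 0) w w' w'' Dw Dw')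
    (htr : SameTrace T (Metric.ball 0 R) (crack R c) (crackDisplacement c) w) :
    ∀ᵐ s ∂(volume.restrict (Ioo 0 T)), WeakZeroTrace (Metric.ball 0 R) (crack R c s)
      (fun x => w' s x - (1 - θ x) * velField c s x)
      (fun x => Dw' s x - ((1 - θ x) • velGradField c s x - velField c s x • gradient θ x)) := by
  have hχ := h.isDirichletDatum hR hT hc0 hc1 hρ
  have hd := hw.time.sub hχ.time
  have hs := hw.space'.sub_const hχ.space'
  -- The traces are known in Ω \ Γ_t, a domain that changes with time. A common crack is needed to
  -- differentiate in time, and the final one contains all the others.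
  have hA := ae_weakZeroTrace_deriv hT (isClosed_crack R c T) (volume_crack R c T)
    (crack_mono hc0 hT.le) hd (fun t ht => ?_) hs
  · filter_upwards [hA, hs.sobolev, ae_restrict_Ioo_mem_Icc T] with s h1 h2 hsI
    have h3 := h2.memLp
    have h4 := h2.memLp_grad
    rw [restrict_diff_null (volume_crack R c 0)] at h3 h4
    -- Both velocities are Sobolev functions off Γ_0, and outside the inner disc Γ_T is contained in
    -- Γ_0. The trace statement therefore descends from Γ_T to Γ_0 and then holds for every Γ_s.
    exact (h1.of_partition h2.weak (volume_crack R c 0) (memLp_two_integrableOn h3)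
      (memLp_two_integrableOn h4) h.contDiff h.tsupport_subset
      (fun x hx => crack_inter_outer hρ ⟨hx.1, h.tsupport_one_sub hx.2⟩)).mono
        (crack_mono hc0 hsI.1)
  · obtain ⟨G, hG⟩ := htr t ht
    have k1 := h.zeroTrace_sub hR hT hc0 hc1 hcT hρ ht
    have a1 := k1.sobolev.memLp
    have a2 := k1.sobolev.memLp_grad
    have b1 := hG.sobolev.memLp
    have b2 := hG.sobolev.memLp_grad
    rw [restrict_diff_null (volume_crack R c t)] at a1 a2 b1 b2
    refine ⟨_, a2.sub b2, ?_⟩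
    have := (k1.weakZeroTrace hR (isClosed_crack R c t) (volume_crack R c t)).sub
      (hG.weakZeroTrace hR (isClosed_crack R c t) (volume_crack R c t))
      (memLp_two_integrableOn a1) (memLp_two_integrableOn b1)
      (memLp_two_integrableOn a2) (memLp_two_integrableOn b2)
    exact (this.congr (ae_of_all _ fun x => by ring) (ae_of_all _ fun x => rfl)).mono
      (crack_mono hc0 ht.2)

end Datum

/-- The gradient of the velocity grows like |z|^(-3/2), which is integrable in the plane although
its square is not. The viscous balance is for this reason carried out with L¹ gradients. -/
theorem integrableOn_velGradField {R c : ℝ} (hc0 : 0 < c) (hc1 : c < 1) (t : ℝ) :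
    IntegrableOn (velGradField c t) (Metric.ball 0 R) := by
  set p : Plane := !₂[c * t, 0] with hp
  have hi : IntegrableOn (fun x : Plane => 1 / 4 * ‖x‖ ^ (-(3 / 2) : ℝ))
      (Metric.ball 0 (R + ‖p‖)) := by
    refine integrableOn_ball_of_norm_le_rpow (C := 1 / 4) (α := 3 / 2)
      (μ := (volume : Measure Plane)) (by simp) (by simp; norm_num) (ae_of_all _ fun x => ?_) ?_
    · rw [Real.norm_of_nonneg (by positivity)]
    · exact ((measurable_norm.pow_const _).const_mul _).aestronglyMeasurable
  have hi2 := (hi.integrable_indicator Metric.isOpen_ball.measurableSet).comp_sub_right p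
  set K := |-(ampl * (c / alpha c)) / alpha c| + |-(ampl * (c / alpha c))|
  refine Integrable.mono' (hi2.integrableOn.const_mul K)
    (measurable_velGradField_at c t).aestronglyMeasurable ?_
  filter_upwards [ae_restrict_mem Metric.isOpen_ball.measurableSet, ae_restrict_of_ae
    (measure_eq_zero_iff_ae_notMem.1 (measure_singleton p) : ∀ᵐ x : Plane, x ∉ ({p} : Set Plane))]
    with x hx hxp
  refine (norm_velGradField_le c t x).trans (mul_le_mul_of_nonneg_left ?_ (by positivity))
  have hmem : x - p ∈ Metric.ball (0 : Plane) (R + ‖p‖) := by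
    rw [mem_ball_zero_iff] at *
    linarith [norm_sub_le x p]
  have h2 : 0 < ‖x - p‖ := norm_pos_iff.2 (sub_ne_zero.2 (by simpa using hxp))
  rw [indicator_of_mem hmem]
  refine (norm_sqrtD2_le h2 (norm_sub_tip_le hc0 hc1 x)).trans (le_of_eq ?_)
  rw [mul_inv, Real.rpow_neg h2.le, Real.sqrt_eq_rpow, ← Real.rpow_natCast, ← Real.rpow_mul h2.le]
  norm_num

/-! ### Energy balances for a general datum -/

section

variable {R T c ε ρ : ℝ} {Ψ : ℝ → Plane → ℝ} {θ : Plane → ℝ}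

/-- Supplies the singular half of the difference u̇ - ẇ: it is supported inside Ω and smooth off the
crack, so classical derivatives suffice. -/
theorem IsInnerCutoff.weakZeroTrace_velField (h : IsInnerCutoff R ρ θ) (hc0 : 0 < c) (hc1 : c < 1)
    (t : ℝ) :
    WeakZeroTrace (Metric.ball 0 R) (crack R c t) (fun x => θ x * velField c t x)
      (fun x => θ x • velGradField c t x + velField c t x • gradient θ x) := by
  have hslit : ∀ x ∈ (crack R c t)ᶜ, x ∈ tsupport θ → tipCoord c t x ∈ Complex.slitPlane :=
    fun x hx hxs => tipCoord_mem_of_notMem_crack hc0 hc1 ⟨h.tsupport_subset hxs, hx⟩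
  have hv : ContDiffOn ℝ 1 (fun x => θ x * velField c t x) (crack R c t)ᶜ := by
    intro x hx
    apply ContDiffAt.contDiffWithinAt
    by_cases hxs : x ∈ tsupport θ
    · exact (h.contDiff.contDiffAt.mul ((contDiffOn_velField c t).contDiffAt
        ((isOpen_preimage_slitPlane c t).mem_nhds (hslit x hx hxs)))).of_le (by simp)
    · refine (contDiffAt_const (c := (0 : ℝ))).congr_of_eventuallyEq ?_
      filter_upwards [(isClosed_tsupport θ).isOpen_compl.mem_nhds hxs] with y hy
      rw [image_eq_zero_of_notMem_tsupport hy, zero_mul]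
  refine (weakZeroTrace_of_contDiffOn (isClosed_crack R c t) hv
    (tsupport_mul_subset_left.trans h.tsupport_subset)).congr (ae_of_all _ fun _ => rfl) ?_
  refine ae_restrict_of_ae ((ae_tipCoord_mem_slitPlane c t).mono fun x hx => ?_)
  rw [gradient_fun_mul (h.contDiff.differentiable (by simp) x) (differentiableAt_velField hx),
    gradient_velField hx]

/-- The balance of the viscous dissipation, at almost every time. -/
theorem ae_viscous_balance (hR : 0 < R) (hT : 0 < T) (hc0 : 0 < c) (hc1 : c < 1)
    (hcT : c * T < R) (hε : 0 < ε) (hΨ : IsAdmissibleViscosity R T c ε Ψ)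
    {w w' w'' : ℝ → Plane → ℝ} {Dw Dw' : ℝ → Plane → Plane}
    (hw : IsDirichletDatum T (Metric.ball 0 R) (crack R c 0) w w' w'' Dw Dw')
    (htr : SameTrace T (Metric.ball 0 R) (crack R c) (crackDisplacement c) w) :
    ∀ᵐ s ∂(volume.restrict (Ioo 0 T)),
      ∫ x in Metric.ball (0 : Plane) R, ‖Ψ s x • velGradField c s x‖ ^ 2
      = (∫ x in Metric.ball (0 : Plane) R, forceField c Ψ s x * (velField c s x - w' s x))
        + ∫ x in Metric.ball (0 : Plane) R,
          inner ℝ (Ψ s x • velGradField c s x) (Ψ s x • Dw' s x) := by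
  obtain ⟨ρ, hρ1, hρ2⟩ : ∃ ρ, c * T < ρ ∧ ρ < R := exists_between hcT
  obtain ⟨θ, hθ⟩ := exists_isInnerCutoff ((mul_pos hc0 hT).trans hρ1) hρ2
  filter_upwards [hθ.ae_weakZeroTrace hR hT hc0 hc1 hcT hρ1 hw htr, hw.space'.sobolev,
    ae_restrict_Ioo_mem_Icc T] with s h1 h2 hs
  have m1 := h2.memLp
  have m2 := h2.memLp_grad
  rw [restrict_diff_null (volume_crack R c 0)] at m1 m2
  have hw'1 := memLp_two_integrableOn m1
  have hDw1 := memLp_two_integrableOn m2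
  have hV := memLp_two_integrableOn (memLp_velField_at hR hc0 hc1 hcT hs)
  have hVG : IntegrableOn (velGradField c s) (Metric.ball 0 R) :=
    integrableOn_velGradField hc0 hc1 s
  have hθ1 : ContDiff ℝ 1 θ := hθ.contDiff.of_le (by simp)
  have bddθ : ∀ {E : Type} [NormedAddCommGroup E] [NormedSpace ℝ E] {g : Plane → E},
      IntegrableOn g (Metric.ball 0 R) → IntegrableOn (fun x => θ x • g x) (Metric.ball 0 R) := by
    intro E _ _ g hg
    obtain ⟨B, hB0, hB⟩ := hθ.exists_bounds
    exact hg.bdd_smul B hθ.contDiff.continuous.aestronglyMeasurable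
      (ae_of_all _ fun x => (hB x).1)
  have bddg : ∀ {g : Plane → ℝ}, IntegrableOn g (Metric.ball 0 R) →
      IntegrableOn (fun x => g x • gradient θ x) (Metric.ball 0 R) := by
    intro g hg
    obtain ⟨B, hB0, hB⟩ := hθ.exists_bounds
    exact Integrable.smul_bdd hg B (continuous_gradient hθ1).aestronglyMeasurable
      (ae_of_all _ fun x => (hB x).2.2)
  have hv1 : IntegrableOn (fun x => θ x * velField c s x) (Metric.ball 0 R) := bddθ hV
  have hG1 := (bddθ hVG).add (bddg hV)
  have hv2 : IntegrableOn (fun x => w' s x - (1 - θ x) * velField c s x) (Metric.ball 0 R) := by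
    refine ((hw'1.sub hV).add hv1).congr (ae_of_all _ fun x => ?_)
    simp only [Pi.add_apply, Pi.sub_apply]
    ring
  have hG2 : IntegrableOn (fun x => Dw' s x - ((1 - θ x) • velGradField c s x
      - velField c s x • gradient θ x)) (Metric.ball 0 R) := by
    refine ((hDw1.sub hVG).add hG1).congr (ae_of_all _ fun x => ?_)
    simp only [Pi.add_apply, Pi.sub_apply]
    module
  -- The formal test function is recovered as u̇ - ẇ = θu̇ - (ẇ - (1 - θ)u̇), a difference of two
  -- functions with weak zero trace.
  have hsub := ((hθ.weakZeroTrace_velField hc0 hc1 s).sub h1 hv1 hv2 hG1 hG2).congr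
    (v' := fun x => velField c s x - w' s x) (G' := fun x => velGradField c s x - Dw' s x)
    (ae_of_all _ fun x => by ring) (ae_of_all _ fun x => by module)
  have key := viscous_identity hR hΨ hc0 hc1 hε hs hsub (hV.sub hw'1) (hVG.sub hDw1)
  have e1 := integral_sub (hΨ.integrableOn_inner_sq_smul hc0 hc1 hε hs hVG)
    (hΨ.integrableOn_inner_sq_smul hc0 hc1 hε hs hDw1)
  simp only [inner_sub_right] at key
  rw [e1] at key
  have e2 : ∀ x, inner ℝ (Ψ s x ^ 2 • velGradField c s x) (velGradField c s x)
      = ‖Ψ s x • velGradField c s x‖ ^ 2 := by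
    intro x
    rw [← real_inner_self_eq_norm_sq, inner_smul_left, inner_smul_left, inner_smul_right]
    simp
    ring
  have e3 : ∀ x, inner ℝ (Ψ s x ^ 2 • velGradField c s x) (Dw' s x)
      = inner ℝ (Ψ s x • velGradField c s x) (Ψ s x • Dw' s x) := by
    intro x
    rw [inner_smul_left, inner_smul_left, inner_smul_right]
    simp
    ring
  simp only [e2, e3] at key
  linarith

/-- The energy balance of the displacement, without the viscous terms. -/
theorem wave_energy_balance (hR : 0 < R) (hT : 0 < T) (hc0 : 0 < c) (hc1 : c < 1)
    (hcT : c * T < R)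
    {w w' w'' : ℝ → Plane → ℝ} {Dw Dw' : ℝ → Plane → Plane}
    (hw : IsDirichletDatum T (Metric.ball 0 R) (crack R c 0) w w' w'' Dw Dw')
    (htr : SameTrace T (Metric.ball 0 R) (crack R c) (crackDisplacement c) w) {t : ℝ}
    (ht : t ∈ Icc 0 T) :
    (∫ x in Metric.ball (0 : Plane) R, energyDensity c t x)
      - (∫ x in Metric.ball (0 : Plane) R, energyDensity c 0 x) + c * t
    = (∫ s in (0 : ℝ)..t, ∫ x in Metric.ball (0 : Plane) R, inner ℝ (gradField c s x) (Dw' s x))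
      - (∫ s in (0 : ℝ)..t, ∫ x in Metric.ball (0 : Plane) R, velField c s x * w'' s x)
      + (∫ x in Metric.ball (0 : Plane) R, velField c t x * w' t x)
      - ∫ x in Metric.ball (0 : Plane) R, velField c 0 x * w' 0 x := by
  obtain ⟨ρ, hρ1, hρ2⟩ : ∃ ρ, c * T < ρ ∧ ρ < R := exists_between hcT
  obtain ⟨θ, hθ⟩ := exists_isInnerCutoff ((mul_pos hc0 hT).trans hρ1) hρ2
  have hχ := hθ.isDirichletDatum hR hT hc0 hc1 hρ1
  -- The test function is ẇ - (1 - θ)u̇, with time derivative ẅ - (1 - θ)ü. It contains no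
  -- singularity at the tip. The terms with (1 - θ)u̇ are then evaluated by the explicit energy
  -- identity, which contributes the crack length.
  have hW := wave_identity hR hT hc0 hc1 hcT ht (hw.time'.sub hχ.time')
    (hw.space'.memLp_grad.sub hχ.space'.memLp_grad)
    (hθ.ae_weakZeroTrace hR hT hc0 hc1 hcT hρ1 hw htr)
  rw [hθ.energy_identity hR hT hc0 hc1 hcT hρ1 ht]
  have h0 : (0 : ℝ) ∈ Icc 0 T := ⟨le_rfl, hT.le⟩
  have mV := memLp_velField hR hc0 hc1 hcT (T := T)
  have mG := memLp_gradField hR hc0 hc1 hcT (T := T)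
  -- splitting of the four terms
  have s1 := intervalIntegral.integral_sub
    (intervalIntegrable_space (F := fun s x => velField c s x * w'' s x) ht
      (mV.integrable_mul hw.time'.memLp_deriv))
    (intervalIntegrable_space (F := fun s x => velField c s x * ((1 - θ x) * accField c s x)) ht
      (mV.integrable_mul hχ.time'.memLp_deriv))
  have s2 := intervalIntegral.integral_sub
    (intervalIntegrable_space (F := fun s x => inner ℝ (gradField c s x) (Dw' s x)) ht
      (integrable_inner_of_memLp mG hw.space'.memLp_grad))
    (intervalIntegrable_space (F := fun s x => inner ℝ (gradField c s x)
        ((1 - θ x) • velGradField c s x - velField c s x • gradient θ x)) ht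
      (integrable_inner_of_memLp mG hχ.space'.memLp_grad))
  have a1 : ∫ s in (0 : ℝ)..t, ∫ x in Metric.ball (0 : Plane) R,
        velField c s x * (w'' s x - (1 - θ x) * accField c s x)
      = ∫ s in (0 : ℝ)..t, ((∫ x in Metric.ball (0 : Plane) R, velField c s x * w'' s x)
        - ∫ x in Metric.ball (0 : Plane) R, velField c s x * ((1 - θ x) * accField c s x)) := by
    rw [intervalIntegral_eq_Ioo ht.1, intervalIntegral_eq_Ioo ht.1]
    refine integral_congr_ae (ae_restrict_of_ae_restrict_of_subset (Ioo_subset_Ioo_right ht.2) ?_)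
    filter_upwards [ae_memLp_slice mV, ae_memLp_slice hw.time'.memLp_deriv,
      ae_memLp_slice (F := fun s x => (1 - θ x) * accField c s x) hχ.time'.memLp_deriv] with s k1 k2 k3
    have := integral_sub (k1.integrable_mul k2) (k1.integrable_mul k3)
    simp only [Pi.mul_apply] at this
    simp only [mul_sub]
    exact this
  have a2 : ∫ s in (0 : ℝ)..t, ∫ x in Metric.ball (0 : Plane) R, inner ℝ (gradField c s x)
        (Dw' s x - ((1 - θ x) • velGradField c s x - velField c s x • gradient θ x))
      = ∫ s in (0 : ℝ)..t, ((∫ x in Metric.ball (0 : Plane) R,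
          inner ℝ (gradField c s x) (Dw' s x))
        - ∫ x in Metric.ball (0 : Plane) R, inner ℝ (gradField c s x)
          ((1 - θ x) • velGradField c s x - velField c s x • gradient θ x)) := by
    rw [intervalIntegral_eq_Ioo ht.1, intervalIntegral_eq_Ioo ht.1]
    refine integral_congr_ae (ae_restrict_of_ae_restrict_of_subset (Ioo_subset_Ioo_right ht.2) ?_)
    filter_upwards [ae_memLp_slice mG, ae_memLp_slice hw.space'.memLp_grad,
      ae_memLp_slice (F := fun s x => (1 - θ x) • velGradField c s x
        - velField c s x • gradient θ x) hχ.space'.memLp_grad] with s k1 k2 k3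
    have := integral_sub (integrable_inner_of_memLp k1 k2) (integrable_inner_of_memLp k1 k3)
    simp only [← inner_sub_right] at this
    exact this
  have a3 : ∀ s ∈ Icc 0 T, ∫ x in Metric.ball (0 : Plane) R,
        velField c s x * (w' s x - (1 - θ x) * velField c s x)
      = (∫ x in Metric.ball (0 : Plane) R, velField c s x * w' s x)
        - ∫ x in Metric.ball (0 : Plane) R, velField c s x * ((1 - θ x) * velField c s x) := by
    intro s hs
    have k1 := memLp_velField_at hR hc0 hc1 hcT hs
    have := integral_sub (k1.integrable_mul (hw.time'.memLp_at hT hs))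
      (k1.integrable_mul (hχ.time'.memLp_at hT hs))
    simp only [Pi.mul_apply] at this
    simp only [mul_sub]
    exact this
  rw [a1, a2, a3 t ht, a3 0 h0, s1, s2] at hW
  linarith

end

/-! ### Products with Lipschitz functions -/

theorem contDiff_mul_of_tsupport_subset {U : Set Plane} (hU : IsOpen U) {η v : Plane → ℝ}
    (hη : ContDiff ℝ ∞ η) (hs : tsupport η ⊆ U) (hv : ContDiffOn ℝ ∞ v U) :
    ContDiff ℝ ∞ fun x => η x * v x :=
  contDiff_iff_contDiffAt.2 fun x => by
    by_cases hx : x ∈ tsupport η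
    · exact hη.contDiffAt.mul (hv.contDiffAt (hU.mem_nhds (hs hx)))
    · refine (contDiffAt_const (c := (0 : ℝ))).congr_of_eventuallyEq ?_
      filter_upwards [notMem_tsupport_iff_eventuallyEq.1 hx] with y hy
      rw [hy, Pi.zero_apply, zero_mul]

/-- Only `g` is nonsmooth. Since `η` is supported in `U`, the product ηv is smooth with compact
support, and it can be used as the test function for the Lipschitz function `g`. -/
theorem hasWeakGradient_lipschitz_mul {U : Set Plane} (hU : IsOpen U) {g v : Plane → ℝ}
    {L : ℝ≥0} (hg : LipschitzWith L g) (hv : ContDiffOn ℝ ∞ v U) :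
    HasWeakGradient U (fun x => g x * v x) (fun x => v x • gradient g x + g x • gradient v x) := by
  intro η hη hc hs i
  set e := basisVec i
  have hvd : ∀ x ∈ U, DifferentiableAt ℝ v x := fun x hx =>
    (hv.contDiffAt (hU.mem_nhds hx)).differentiableAt (by simp)
  have hsm := contDiff_mul_of_tsupport_subset hU hη hs hv
  have hcm : HasCompactSupport fun x => η x * v x := hc.mul_right
  obtain ⟨D, hD⟩ := hsm.lipschitzWith_of_hasCompactSupport hcm (by simp)
  have hdη : Continuous fun x => fderiv ℝ η x e :=
    (hη.continuous_fderiv (by simp)).clm_apply continuous_const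
  have hcη : HasCompactSupport fun x => fderiv ℝ η x e := hc.fderiv_apply ℝ e
  have hsη : tsupport (fun x => fderiv ℝ η x e) ⊆ U :=
    (tsupport_fderiv_apply_subset ℝ e).trans hs
  have hdv : ContinuousOn (fun x => fderiv ℝ v x e) U :=
    (hv.continuousOn_fderiv_of_isOpen hU (by simp)).clm_apply continuousOn_const
  have i1 : Integrable fun x => (g x * v x) * fderiv ℝ η x e :=
    integrable_mul_of_tsupport hU (hg.continuous.continuousOn.mul hv.continuousOn) hdη hcη hsη
  have i2 : Integrable fun x => (g x * fderiv ℝ v x e) * η x :=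
    integrable_mul_of_tsupport hU (hg.continuous.continuousOn.mul hdv) hη.continuous hc hs
  have i3 : Integrable fun x => lineDeriv ℝ g x e * (η x * v x) :=
    (hsm.continuous.integrable_of_hasCompactSupport hcm).bdd_mul (c := L * ‖e‖)
      (measurable_lineDeriv hg.continuous).aestronglyMeasurable
      (ae_of_all _ fun x => norm_lineDeriv_le_of_lipschitz ℝ hg)
  have key := hg.integral_lineDeriv_mul_eq (μ := volume) hD hcm e
  -- Points outside `U` are treated apart: `v` is arbitrary there, but `η` and the derivatives of
  -- `η` and of ηv all vanish.
  have hlin : ∀ x, lineDeriv ℝ (fun x => η x * v x) x (-e) * g x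
      = -((g x * v x) * fderiv ℝ η x e + (g x * fderiv ℝ v x e) * η x) := by
    intro x
    rw [(hsm.differentiable (by simp) x).lineDeriv_eq_fderiv, map_neg]
    by_cases hx : x ∈ U
    · rw [fderiv_fun_mul (hη.differentiable (by simp) x) (hvd x hx)]
      simp
      ring
    · have hx' : x ∉ tsupport η := fun h => hx (hs h)
      have hx'' : x ∉ tsupport fun x => η x * v x := fun h => hx' (tsupport_mul_subset_left h)
      simp [fderiv_of_notMem_tsupport ℝ hx', fderiv_of_notMem_tsupport ℝ hx'',
        image_eq_zero_of_notMem_tsupport hx']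
  simp only [hlin] at key
  rw [integral_neg, integral_add i1 i2] at key
  rw [setIntegral_eq_of_tsupport (v := fun x => g x * v x) hsη,
    setIntegral_eq_of_tsupport (v := fun x => (v x • gradient g x + g x • gradient v x) i) hs]
  have hlast : ∫ x, (v x • gradient g x + g x • gradient v x) i * η x
      = (∫ x, lineDeriv ℝ g x e * (η x * v x)) + ∫ x, (g x * fderiv ℝ v x e) * η x := by
    rw [← integral_add i3 i2]
    apply integral_congr_ae
    filter_upwards [hg.ae_differentiableAt] with x hx
    rw [hx.lineDeriv_eq_fderiv, PiLp.add_apply, PiLp.smul_apply, PiLp.smul_apply, gradient_coord,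
      gradient_coord, smul_eq_mul, smul_eq_mul]
    ring
  rw [hlast, key]
  ring

/-! ### Convergence of translates -/

/-- Continuity of translations in L², obtained from the continuity of composition with measure
preserving maps that vary continuously. -/
theorem tendsto_integral_translate_sub {E : Type*} [NormedAddCommGroup E] {G : Plane → E}
    (hG : MemLp G 2) :
    Tendsto (fun h : Plane => ∫ x, ‖G (x - h) - G x‖ ^ 2) (𝓝 0) (𝓝 0) := by
  let g : Plane → C(Plane, Plane) := fun h => ⟨fun x => x - h, continuous_sub_right h⟩
  have hgm : ∀ h, MeasurePreserving (g h) volume volume := fun h =>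
    measurePreserving_sub_right volume h
  have hg : Continuous g := ContinuousMap.continuous_of_continuous_uncurry _
    (continuous_snd.sub continuous_fst)
  have h1 := (tendsto_const_nhds (x := hG.toLp G)).compMeasurePreservingLp (p := 2) (hg.tendsto 0)
    hgm (hgm 0) (by simp)
  have h2 := ((tendsto_iff_norm_sub_tendsto_zero.1 h1).pow 2)
  rw [zero_pow two_ne_zero] at h2
  refine h2.congr fun h => ?_
  have h3 : (∫ x, ‖G (x - h) - G x‖ ^ 2) = ∫ x, ‖G (x - h) - G (x - 0)‖ ^ 2 := by
    simp only [sub_zero]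
  have hs := (hG.comp_measurePreserving (hgm h)).sub (hG.comp_measurePreserving (hgm 0))
  rw [Lp.toLp_compMeasurePreserving, Lp.toLp_compMeasurePreserving, ← MemLp.toLp_sub, Lp.norm_toLp,
    hs.eLpNorm_eq_integral_rpow_norm (by simp) (by simp)]
  simp only [ENNReal.toReal_ofNat, Real.rpow_ofNat]
  rw [ENNReal.toReal_ofReal (by positivity), ← Real.rpow_natCast,
    ← Real.rpow_mul (integral_nonneg fun x => by positivity)]
  norm_num
  exact h3.symm

theorem tendsto_integral_shift_sub {E : Type*} [NormedAddCommGroup E] {R c : ℝ}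
    {F : ℝ → Plane → E} (hF : ∀ t x, F t x = F 0 (x - !₂[c * t, 0]))
    (hm : ∀ ρ, 0 < ρ → MemLp (F 0) 2 (volume.restrict (Metric.ball 0 ρ))) :
    Tendsto (fun t => ∫ x in Metric.ball (0 : Plane) R, ‖F t x - F 0 x‖ ^ 2) (𝓝 0) (𝓝 0) := by
  -- Truncation in a ball larger by one makes the profile globally square integrable, and it is
  -- invisible in the disc for translations shorter than one.
  set G : Plane → E := (Metric.ball (0 : Plane) (|R| + 1)).indicator (F 0) with hG
  have hGm : MemLp G 2 := (memLp_indicator_iff_restrict Metric.isOpen_ball.measurableSet).2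
    (hm _ (by positivity))
  have hlim : Tendsto (fun t : ℝ => (!₂[c * t, 0] : Plane)) (𝓝 0) (𝓝 0) := by
    have : Continuous fun t : ℝ => (!₂[c * t, 0] : Plane) :=
      continuous_toLp_pair (continuous_const.mul continuous_id) continuous_const
    convert this.tendsto 0 using 2
    ext i; fin_cases i <;> simp
  refine squeeze_zero' (Eventually.of_forall fun t => integral_nonneg fun x => by positivity) ?_
    ((tendsto_integral_translate_sub hGm).comp hlim)
  have hsmall : ∀ᶠ t : ℝ in 𝓝 0, ‖(!₂[c * t, 0] : Plane)‖ < 1 := by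
    have := hlim.norm
    rw [norm_zero] at this
    exact this.eventually_lt_const one_pos
  filter_upwards [hsmall] with t ht
  have hball : ∀ x ∈ Metric.ball (0 : Plane) R, ‖F t x - F 0 x‖ ^ 2
      = ‖G (x - !₂[c * t, 0]) - G x‖ ^ 2 := by
    intro x hx
    rw [mem_ball_zero_iff] at hx
    have h1 : x ∈ Metric.ball (0 : Plane) (|R| + 1) := by
      rw [mem_ball_zero_iff]; linarith [le_abs_self R]
    have h2 : x - !₂[c * t, 0] ∈ Metric.ball (0 : Plane) (|R| + 1) := by
      rw [mem_ball_zero_iff]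
      linarith [le_abs_self R, norm_sub_le x !₂[c * t, 0]]
    rw [hG, indicator_of_mem h1, indicator_of_mem h2, ← hF]
  rw [setIntegral_congr_fun Metric.isOpen_ball.measurableSet hball]
  have hsh : MemLp (fun x => G (x - !₂[c * t, 0])) 2 :=
    hGm.comp_measurePreserving (measurePreserving_sub_right volume _)
  exact setIntegral_le_integral ((hsh.sub hGm).integrable_norm_pow two_ne_zero)
    (ae_of_all _ fun x => by positivity)

theorem tendsto_average_of_tendsto_zero {g : ℝ → ℝ} (hg : Tendsto g (𝓝 0) (𝓝 0)) :
    Tendsto (fun h : ℝ => h⁻¹ * ∫ t in (0 : ℝ)..h, g t) (𝓝[>] 0) (𝓝 0) := by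
  rw [Metric.tendsto_nhds] at hg ⊢
  intro ε hε
  obtain ⟨δ, hδ, h⟩ := Metric.eventually_nhds_iff.1 (hg (ε / 2) (by positivity))
  filter_upwards [Ioo_mem_nhdsGT hδ] with r hr
  have hb := intervalIntegral.norm_integral_le_of_norm_le_const (a := 0) (b := r) (f := g)
    (C := ε / 2) fun x hx => by
      rw [uIoc_of_le hr.1.le] at hx
      have := h (y := x) (by rw [Real.dist_eq, sub_zero, abs_of_pos hx.1]; linarith [hx.2, hr.2])
      rw [dist_zero_right] at this
      exact this.le
  rw [dist_zero_right, norm_mul, norm_inv, Real.norm_of_nonneg hr.1.le]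
  rw [sub_zero, abs_of_pos hr.1] at hb
  calc r⁻¹ * ‖∫ t in (0 : ℝ)..r, g t‖ ≤ r⁻¹ * (ε / 2 * r) := by
        have := inv_nonneg.2 hr.1.le; gcongr
    _ = ε / 2 := by have := hr.1.ne'; field_simp
    _ < ε := by linarith

/-! ### The length of the crack increment -/

theorem hausdorffMeasure_crack_diff {R T c t : ℝ} (hc0 : 0 < c) (hcT : c * T < R)
    (ht : t ∈ Icc 0 T) :
    Measure.hausdorffMeasure 1 (crack R c t \ crack R c 0) = ENNReal.ofReal (c * t) := by
  have hi : Isometry fun a : ℝ => (EuclideanSpace.single 0 a : Plane) := by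
    refine Isometry.of_dist_eq fun a b => ?_
    exact PiLp.dist_single_same ..
  have hcrack : crack R c t \ crack R c 0
      = (fun a : ℝ => (EuclideanSpace.single 0 a : Plane)) '' Ioc 0 (c * t) := by
    have hctR : c * t ≤ R := (mul_le_mul_of_nonneg_left ht.2 hc0.le).trans hcT.le
    ext x
    constructor
    · rintro ⟨⟨h1, h2, h3⟩, h4⟩
      refine ⟨x 0, ⟨lt_of_not_ge fun h => h4 ⟨h1, h2, by simpa using h⟩, h3⟩, ?_⟩
      ext i
      fin_cases i <;> simp [h2]
    · rintro ⟨a, ⟨ha0, ha1⟩, rfl⟩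
      refine ⟨⟨?_, by simp, by simpa using ha1⟩, fun h => absurd h.2.2 (by simpa using ha0)⟩
      rw [mem_closedBall_zero_iff, PiLp.norm_single, Real.norm_of_nonneg ha0.le]
      linarith
  rw [hcrack, hi.hausdorffMeasure_image (Or.inl zero_le_one), hausdorffMeasure_real,
    Real.volume_Ioc, sub_zero]

/-! ### The initial data -/

section

variable {R T c ε : ℝ} {Ψ : ℝ → Plane → ℝ}

theorem tipCoord_shift (c t : ℝ) (x : Plane) :
    tipCoord c t x = tipCoord c 0 (x - !₂[c * t, 0]) := by
  simp [tipCoord]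

theorem initialDisplacement_eq (c : ℝ) : initialDisplacement c = crackDisplacement c 0 := by
  funext x
  simp [initialDisplacement, crackDisplacement]

theorem initialVelocity_eq {x : Plane} (hx : tipCoord c 0 x ∈ Complex.slitPlane) :
    initialVelocity c x = velField c 0 x := by
  set y : Plane := !₂[x 0 / √(1 - c ^ 2), x 1] with hy
  -- Tip coordinates with speed zero are the identification of the plane with ℂ, so the chain rule
  -- already proved for `tipCoord` also computes the derivative of `tipFunction`.
  have hty : tipCoord c 0 x = tipCoord 0 0 y := by
    simp [tipCoord, hy]
  have h := hasFDerivAt_comp_tipCoord_im (c := 0) (t := 0) (x := y)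
    (hasDerivAt_sqrt (hty ▸ hx))
  have e : (fun z => (Complex.sqrt (tipCoord 0 0 z)).im) = tipFunction := by
    funext z
    simp [tipFunction, tipCoord]
  rw [e] at h
  rw [initialVelocity, ← hy, h.fderiv, velField, hty]
  simp [ContinuousLinearMap.comp_apply, tipLin_basis_zero]

theorem memV_crackDisplacement (hR : 0 < R) (hT : 0 < T) (hc0 : 0 < c) (hc1 : c < 1)
    (hcT : c * T < R) :
    MemV T (Metric.ball 0 R) (crack R c) (crackDisplacement c) (velField c) (gradField c) where
  time := isH1Time_of_hasDerivAt (memLp_crackDisplacement hR hT hc0 hc1)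
    (memLp_velField hR hc0 hc1 hcT)
    (fun _ hx _ => hasDerivAt_crackDisplacement (tipCoord_mem_slitPlane hx))
    (fun _ hx => continuous_velField_time hx)
  space := isL2Sobolev_of_weakGradient (volume_crack R c)
    (memLp_crackDisplacement hR hT hc0 hc1) (memLp_gradField hR hc0 hc1 hcT)
    (ae_of_all _ fun t => weakGradient_crackDisplacement hc0 hc1 t)

theorem MemV.congr {T : ℝ} {Ω : Set Plane} {Γ : ℝ → Set Plane} {v v' w' : ℝ → Plane → ℝ}
    {Dv Dw : ℝ → Plane → Plane} (h : MemV T Ω Γ v v' Dv)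
    (h' : ∀ x : Plane, x 1 ≠ 0 → ∀ t, v' t x = w' t x)
    (hD : ∀ x : Plane, x 1 ≠ 0 → ∀ t, Dv t x = Dw t x) : MemV T Ω Γ v w' Dw where
  time :=
    { memLp := h.time.memLp
      memLp_deriv := h.time.memLp_deriv.ae_eq (by
        filter_upwards [ae_cyl_coord_ne_zero T Ω] with p hp using h' _ hp _)
      eq_integral := fun t ht => by
        filter_upwards [h.time.eq_integral t ht, ae_restrict_of_ae ae_coord_ne_zero] with x hx hx1
        simpa only [h' x hx1] using hx }
  space :=
    { memLp := h.space.memLp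
      memLp_grad := h.space.memLp_grad.ae_eq (by
        filter_upwards [ae_cyl_coord_ne_zero T Ω] with p hp using hD _ hp _)
      sobolev := by
        filter_upwards [h.space.sobolev] with t ht
        have : ∀ᵐ x ∂(volume.restrict (Ω \ Γ t)), Dv t x = Dw t x := by
          filter_upwards [ae_restrict_of_ae ae_coord_ne_zero] with x hx using hD x hx t
        exact ⟨ht.memLp, ht.memLp_grad.ae_eq this, ht.weak.congr this⟩ }

/-- Displacement, strain and velocity are profiles translated rigidly with the tip, so continuity of
translations in L² makes the integrand tend to zero as t → 0. This is stronger than the convergence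
of averages. -/
theorem attainsInitialData (hR : 0 < R) (hT : 0 < T) (hc0 : 0 < c) (hc1 : c < 1)
    (hcT : c * T < R) :
    AttainsInitialData T (Metric.ball 0 R) (crack R c) (crackDisplacement c)
      (initialDisplacement c) (initialVelocity c) := by
  have hvel : ∀ᵐ x ∂(volume.restrict (Metric.ball (0 : Plane) R)),
      initialVelocity c x = velField c 0 x := by
    filter_upwards [ae_restrict_of_ae (ae_tipCoord_mem_slitPlane c 0)] with x hx
    exact initialVelocity_eq hx
  have h0 : (0 : ℝ) ∈ Icc 0 T := ⟨le_rfl, hT.le⟩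
  refine ⟨velField c, gradField c, gradField c 0, memV_crackDisplacement hR hT hc0 hc1 hcT,
    initialDisplacement_eq c ▸ isSobolev_crackDisplacement hR hT hc0 hc1 hcT h0,
    (memLp_velField_at hR hc0 hc1 hcT h0).ae_eq (hvel.mono fun _ h => h.symm), ?_⟩
  refine tendsto_average_of_tendsto_zero ?_
  -- At time zero the tip is the origin, which is interior to every disc. The L² bounds are applied
  -- with final time zero so that every radius ρ > 0 is allowed.
  have hz : ∀ ρ : ℝ, 0 < ρ → c * 0 < ρ := fun ρ hρ => by simpa using hρ
  have h00 : (0 : ℝ) ∈ Icc (0 : ℝ) 0 := ⟨le_rfl, le_rfl⟩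
  have s1 := tendsto_integral_shift_sub (R := R) (c := c) (F := crackDisplacement c)
    (fun t x => by rw [crackDisplacement_eq, crackDisplacement_eq, tipCoord_shift])
    fun ρ hρ => memLp_crackDisplacement_at hρ one_pos hc0 hc1 ⟨le_rfl, zero_le_one⟩
  have s2 := tendsto_integral_shift_sub (R := R) (c := c) (F := gradField c)
    (fun t x => by rw [gradField, gradField, tipCoord_shift])
    fun ρ hρ => memLp_gradField_at hρ hc0 hc1 (hz ρ hρ) h00
  have s3 := tendsto_integral_shift_sub (R := R) (c := c) (F := velField c)
    (fun t x => by rw [velField, velField, tipCoord_shift])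
    fun ρ hρ => memLp_velField_at hρ hc0 hc1 (hz ρ hρ) h00
  have := (s1.add s2).add s3
  simp only [add_zero, Real.norm_eq_abs, sq_abs] at this
  refine this.congr fun t => ?_
  rw [initialDisplacement_eq]
  congr 1
  apply integral_congr_ae
  filter_upwards [hvel] with x hx
  rw [hx]

end

/-! ### The weak equation -/

theorem HasWeakGradient.congr_fun {U : Set Plane} {v v' : Plane → ℝ} {G : Plane → Plane}
    (h : HasWeakGradient U v G) (hv : ∀ᵐ x ∂(volume.restrict U), v x = v' x) :
    HasWeakGradient U v' G := by
  intro η hη hc hs i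
  rw [← h η hη hc hs i]
  apply integral_congr_ae
  filter_upwards [hv] with x hx
  rw [hx]

theorem IsSobolevZeroTrace.congr_gradient {Ω K : Set Plane} {v : Plane → ℝ}
    {G G' : Plane → Plane} (h : IsSobolevZeroTrace Ω K v G)
    (hG : ∀ᵐ x ∂(volume.restrict (Ω \ K)), G x = G' x) : IsSobolevZeroTrace Ω K v G' where
  sobolev := ⟨h.sobolev.memLp, h.sobolev.memLp_grad.ae_eq hG, h.sobolev.weak.congr hG⟩
  approx := fun δ hδ => by
    obtain ⟨z, Z, hz, hO, hlt⟩ := h.approx δ hδ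
    refine ⟨z, Z, hz, hO, lt_of_eq_of_lt (integral_congr_ae ?_) hlt⟩
    filter_upwards [hG] with x hx
    rw [hx]

theorem IsSobolev.mono {U V : Set Plane} {v : Plane → ℝ} {G : Plane → Plane}
    (h : IsSobolev U v G) (hVU : V ⊆ U) : IsSobolev V v G :=
  ⟨h.memLp.mono_measure (Measure.restrict_mono_set _ hVU),
    h.memLp_grad.mono_measure (Measure.restrict_mono_set _ hVU), h.weak.mono hVU⟩

section

variable {R T c ε : ℝ} {Ψ : ℝ → Plane → ℝ}

theorem memVD_sub (hR : 0 < R) (hT : 0 < T) (hc0 : 0 < c) (hc1 : c < 1)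
    (hcT : c * T < R) {w w' w'' : ℝ → Plane → ℝ} {Dw Dw' : ℝ → Plane → Plane}
    (hw : IsDirichletDatum T (Metric.ball 0 R) (crack R c 0) w w' w'' Dw Dw')
    (htr : SameTrace T (Metric.ball 0 R) (crack R c) (crackDisplacement c) w) :
    MemVD T (Metric.ball 0 R) (crack R c) (fun t x => crackDisplacement c t x - w t x)
      (fun t x => velField c t x - w' t x) (fun t x => gradField c t x - Dw t x) := by
  have hu := memV_crackDisplacement hR hT hc0 hc1 hcT
  have hsob : ∀ᵐ t ∂(volume.restrict (Ioo 0 T)),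
      IsSobolev (Metric.ball 0 R \ crack R c t) (fun x => crackDisplacement c t x - w t x)
        (fun x => gradField c t x - Dw t x) := by
    filter_upwards [hu.space.sobolev, hw.space.sobolev, ae_restrict_Ioo_mem_Icc T] with t h1 h2 ht
    exact h1.sub (h2.mono (sdiff_subset_sdiff_right (crack_mono hc0 ht.1)))
      (volume_ball_diff_ne_top R _)
  refine ⟨⟨hu.time.sub hw.time, hu.space.memLp.sub hw.space.memLp,
    hu.space.memLp_grad.sub hw.space.memLp_grad, hsob⟩, ?_⟩
  filter_upwards [hsob, ae_restrict_Ioo_mem_Icc T] with t h1 ht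
  obtain ⟨G, hG⟩ := htr t ht
  have : IsFiniteMeasure (volume.restrict (Metric.ball (0 : Plane) R \ crack R c t)) :=
    ⟨by rw [Measure.restrict_apply_univ]; exact (volume_ball_diff_ne_top R _).lt_top⟩
  -- The trace hypothesis provides some gradient at each time; uniqueness of weak gradients
  -- identifies it with the difference of the two given ones.
  exact hG.congr_gradient (hG.sobolev.weak.unique
    (Metric.isOpen_ball.sdiff (isClosed_crack R c t)) h1.weak (ae_of_all _ fun _ => rfl)
    (hG.sobolev.memLp_grad.integrable one_le_two) (h1.memLp_grad.integrable one_le_two))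

theorem IsAdmissibleViscosity.memLp_smul (hΨ : IsAdmissibleViscosity R T c ε Ψ)
    {F : ℝ → Plane → Plane}
    (hF : MemLp (fun p : ℝ × Plane => F p.1 p.2) 2 (cylMeasure T (Metric.ball 0 R))) :
    MemLp (fun p : ℝ × Plane => Ψ p.1 p.2 • F p.1 p.2) 2 (cylMeasure T (Metric.ball 0 R)) := by
  obtain ⟨B, -, hB⟩ := hΨ.exists_bounds
  refine hF.smul (p := ⊤) (memLp_cyl_of_bound hΨ.aestronglyMeasurable B ?_)
  filter_upwards [ae_cyl_mem Metric.isOpen_ball.measurableSet] with p hp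
  exact (hB _ (Ioo_subset_Icc_self hp.1) _ hp.2).1

theorem IsAdmissibleViscosity.memLp_smul_gradient (hΨ : IsAdmissibleViscosity R T c ε Ψ)
    {v : ℝ → Plane → ℝ}
    (hv : MemLp (fun p : ℝ × Plane => v p.1 p.2) 2 (cylMeasure T (Metric.ball 0 R))) :
    MemLp (fun p : ℝ × Plane => v p.1 p.2 • gradient (Ψ p.1) p.2) 2
      (cylMeasure T (Metric.ball 0 R)) := by
  obtain ⟨B, -, hB⟩ := hΨ.exists_bounds
  refine MemLp.smul (q := ⊤) (memLp_cyl_of_bound hΨ.aestronglyMeasurable_gradient B ?_) hv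
  filter_upwards [ae_cyl_mem Metric.isOpen_ball.measurableSet] with p hp
  exact (hB _ (Ioo_subset_Icc_self hp.1) _ hp.2).2

theorem isL2Sobolev_viscosity_mul (hR : 0 < R) (hc0 : 0 < c) (hc1 : c < 1)
    (hcT : c * T < R) (hε : 0 < ε) (hΨ : IsAdmissibleViscosity R T c ε Ψ) :
    IsL2Sobolev T (Metric.ball 0 R) (crack R c) (fun t x => Ψ t x * velField c t x)
      (fun t x => velField c t x • gradient (Ψ t) x + Ψ t x • velGradField c t x) := by
  refine isL2Sobolev_of_weakGradient (volume_crack R c)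
    (memLp_viscosity_mul_velField hΨ hc0 hc1 hε)
    ((hΨ.memLp_smul_gradient (memLp_velField hR hc0 hc1 hcT)).add (memLp_viscous hΨ hc0 hc1 hε)) ?_
  obtain ⟨L, Φ, hL, hΦ⟩ := hΨ.exists_extension
  filter_upwards [ae_restrict_Ioo_mem_Icc T] with t ht
  have hU : IsOpen (Metric.ball (0 : Plane) R \ crack R c t) :=
    Metric.isOpen_ball.sdiff (isClosed_crack R c t)
  have hsub : Metric.ball (0 : Plane) R \ crack R c t ⊆ tipCoord c t ⁻¹' Complex.slitPlane :=
    fun x hx => tipCoord_mem_of_notMem_crack hc0 hc1 hx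
  have h := hasWeakGradient_lipschitz_mul hU (lipschitzWith_slice hL t)
    ((contDiffOn_velField c t).mono hsub)
  refine (h.congr_fun ?_).congr ?_ <;>
    filter_upwards [ae_restrict_mem hU.measurableSet] with x hx
  · rw [hΦ t ht x (Metric.ball_subset_closedBall hx.1)]
  · rw [hΦ t ht x (Metric.ball_subset_closedBall hx.1), gradient_velField (hsub hx),
      gradient_congr (eventuallyEq_slice hΦ ht hx.1)]

/-- The two halves of the equation hold separately. Test functions vanishing at both end times make
the kinetic and elastic terms cancel by `wave_identity`. By the product rule ∇(Ψu̇) - u̇∇Ψ = Ψ∇u̇,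
so the two viscous terms combine into the flux of `viscous_identity`, which equals the work of the
force. -/
theorem isWeakSolution (hR : 0 < R) (hT : 0 < T) (hc0 : 0 < c) (hc1 : c < 1)
    (hcT : c * T < R) (hε : 0 < ε) (hΨ : IsAdmissibleViscosity R T c ε Ψ)
    {w w' w'' : ℝ → Plane → ℝ} {Dw Dw' : ℝ → Plane → Plane}
    (hw : IsDirichletDatum T (Metric.ball 0 R) (crack R c 0) w w' w'' Dw Dw')
    (htr : SameTrace T (Metric.ball 0 R) (crack R c) (crackDisplacement c) w) :
    IsWeakSolution T (Metric.ball 0 R) (crack R c) Ψ (crackForce c Ψ) w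
      (crackDisplacement c) := by
  refine ⟨velField c, gradField c,
    fun t x => velField c t x • gradient (Ψ t) x + Ψ t x • velGradField c t x,
    memV_crackDisplacement hR hT hc0 hc1 hcT, isL2Sobolev_viscosity_mul hR hc0 hc1 hcT hε hΨ,
    ⟨_, _, memVD_sub hR hT hc0 hc1 hcT hw htr⟩, ?_⟩
  intro φ φ' Dφ hφ hφ0 hφT
  have hTT : T ∈ Icc 0 T := ⟨hT.le, le_rfl⟩
  have hz : ∀ᵐ s ∂(volume.restrict (Ioo 0 T)),
      WeakZeroTrace (Metric.ball 0 R) (crack R c s) (φ s) (Dφ s) := by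
    filter_upwards [hφ.zeroTrace] with s hs
    exact hs.weakZeroTrace hR (isClosed_crack R c s) (volume_crack R c s)
  have hwave := wave_identity hR hT hc0 hc1 hcT hTT hφ.memV.time hφ.memV.space.memLp_grad hz
  have z0 : ∫ x in Metric.ball (0 : Plane) R, velField c 0 x * φ 0 x = 0 :=
    integral_eq_zero_of_ae (hφ0.mono fun x hx => by simp [hx])
  have zT : ∫ x in Metric.ball (0 : Plane) R, velField c T x * φ T x = 0 :=
    integral_eq_zero_of_ae (hφT.mono fun x hx => by simp [hx])
  have mΨ := hΨ.memLp_smul hφ.memV.space.memLp_grad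
  have mg := hΨ.memLp_smul_gradient (memLp_velField hR hc0 hc1 hcT)
  have mG := memLp_viscous (p := 2) hΨ hc0 hc1 hε
  have i1 := intervalIntegrable_space (F := fun t x =>
    inner ℝ (velField c t x • gradient (Ψ t) x + Ψ t x • velGradField c t x) (Ψ t x • Dφ t x)) hTT
    (integrable_inner_of_memLp (mg.add mG) mΨ)
  have i2 := intervalIntegrable_space (F := fun t x =>
    inner ℝ (velField c t x • gradient (Ψ t) x) (Ψ t x • Dφ t x)) hTT
    (integrable_inner_of_memLp mg mΨ)
  have hvisc : (∫ t in (0 : ℝ)..T, ∫ x in Metric.ball (0 : Plane) R,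
        inner ℝ (velField c t x • gradient (Ψ t) x + Ψ t x • velGradField c t x) (Ψ t x • Dφ t x))
      - (∫ t in (0 : ℝ)..T, ∫ x in Metric.ball (0 : Plane) R,
        inner ℝ (velField c t x • gradient (Ψ t) x) (Ψ t x • Dφ t x))
      = ∫ t in (0 : ℝ)..T, ∫ x in Metric.ball (0 : Plane) R, crackForce c Ψ t x * φ t x := by
    rw [← intervalIntegral.integral_sub i1 i2, intervalIntegral_eq_Ioo hT.le,
      intervalIntegral_eq_Ioo hT.le]
    apply integral_congr_ae
    filter_upwards [hz, ae_memLp_slice (F := fun s x => Ψ s x • Dφ s x) mΨ,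
      ae_memLp_slice (F := fun s x => velField c s x • gradient (Ψ s) x) mg,
      ae_memLp_slice (F := fun s x => Ψ s x • velGradField c s x) mG,
      ae_memLp_slice hφ.memV.space.memLp, ae_memLp_slice hφ.memV.space.memLp_grad,
      ae_restrict_Ioo_mem_Icc T] with t h1 kΨ kg kG kφ kD ht
    have hv := viscous_identity hR hΨ hc0 hc1 hε ht h1 (memLp_two_integrableOn kφ)
      (memLp_two_integrableOn kD)
    have hsplit := integral_sub (integrable_inner_of_memLp (kg.add kG) kΨ)
      (integrable_inner_of_memLp kg kΨ)
    simp only [Pi.add_apply] at hsplit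
    have e1 : ∫ x in Metric.ball (0 : Plane) R, crackForce c Ψ t x * φ t x
        = ∫ x in Metric.ball (0 : Plane) R, forceField c Ψ t x * φ t x := by
      apply integral_congr_ae
      filter_upwards [hΨ.ae_differentiable ht,
        ae_restrict_of_ae (ae_tipCoord_mem_slitPlane c t)] with x hd hx
      rw [crackForce_eq hx hd]
    rw [e1, ← hv, ← hsplit]
    refine integral_congr_ae (ae_of_all _ fun x => ?_)
    simp only [inner_add_left, inner_smul_left, inner_smul_right]
    simp
    ring
  rw [hwave, z0, zT, ← hvisc]
  ring

/-! ### The energy-dissipation balance -/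

theorem energy_crackDisplacement (hR : 0 < R) (hc0 : 0 < c) (hc1 : c < 1)
    (hcT : c * T < R) {t : ℝ} (ht : t ∈ Icc 0 T) :
    energy (Metric.ball 0 R) (timeDeriv (crackDisplacement c) t)
      (gradient (crackDisplacement c t))
      = ∫ x in Metric.ball (0 : Plane) R, energyDensity c t x := by
  have hx := ae_restrict_of_ae (s := Metric.ball (0 : Plane) R) (ae_tipCoord_mem_slitPlane c t)
  have e1 : ∫ x in Metric.ball (0 : Plane) R, timeDeriv (crackDisplacement c) t x ^ 2
      = ∫ x in Metric.ball (0 : Plane) R, velField c t x ^ 2 :=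
    integral_congr_ae (hx.mono fun x hx => by simp only [timeDeriv_crackDisplacement hx])
  have e2 : ∫ x in Metric.ball (0 : Plane) R, ‖gradient (crackDisplacement c t) x‖ ^ 2
      = ∫ x in Metric.ball (0 : Plane) R, ‖gradField c t x‖ ^ 2 :=
    integral_congr_ae (hx.mono fun x hx => by simp only [gradient_crackDisplacement hx])
  have j1 := (memLp_velField_at hR hc0 hc1 hcT ht).integrable_sq
  have j2 := (memLp_gradField_at hR hc0 hc1 hcT ht).integrable_norm_pow two_ne_zero
  rw [energy, e1, e2, ← mul_add, ← integral_add j1 j2, ← integral_const_mul]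
  rfl

theorem dissipation_crackDisplacement (t : ℝ) :
    dissipation (Metric.ball 0 R) Ψ (crackDisplacement c) t
      = ∫ s in (0 : ℝ)..t, ∫ x in Metric.ball (0 : Plane) R, ‖Ψ s x • velGradField c s x‖ ^ 2 := by
  refine intervalIntegral.integral_congr fun s _ => integral_congr_ae ?_
  filter_upwards [ae_restrict_of_ae (ae_tipCoord_mem_slitPlane c s)] with x hx
  rw [gradient_timeDeriv hx]

/-- The work of the force on u̇ - ẇ and the viscous work on ẇ add up to the dissipation at almost
every time, so in the balance the viscosity cancels and only the wave terms remain. -/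
theorem totalWork_crackDisplacement (hR : 0 < R) (hT : 0 < T) (hc0 : 0 < c) (hc1 : c < 1)
    (hcT : c * T < R) (hε : 0 < ε) (hΨ : IsAdmissibleViscosity R T c ε Ψ)
    {w w' w'' : ℝ → Plane → ℝ} {Dw Dw' : ℝ → Plane → Plane}
    (hw : IsDirichletDatum T (Metric.ball 0 R) (crack R c 0) w w' w'' Dw Dw')
    (htr : SameTrace T (Metric.ball 0 R) (crack R c) (crackDisplacement c) w) {t : ℝ}
    (ht : t ∈ Icc 0 T) :
    totalWork (Metric.ball 0 R) Ψ (crackForce c Ψ) (crackDisplacement c) w' w'' Dw' t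
    = (∫ s in (0 : ℝ)..t, ∫ x in Metric.ball (0 : Plane) R, ‖Ψ s x • velGradField c s x‖ ^ 2)
      + (∫ s in (0 : ℝ)..t, ∫ x in Metric.ball (0 : Plane) R, inner ℝ (gradField c s x) (Dw' s x))
      - (∫ s in (0 : ℝ)..t, ∫ x in Metric.ball (0 : Plane) R, velField c s x * w'' s x)
      + (∫ x in Metric.ball (0 : Plane) R, velField c t x * w' t x)
      - ∫ x in Metric.ball (0 : Plane) R, velField c 0 x * w' 0 x := by
  have htip := fun s => ae_restrict_of_ae (s := Metric.ball (0 : Plane) R)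
    (ae_tipCoord_mem_slitPlane c s)
  have hvel : ∀ (s : ℝ) (g : Plane → ℝ),
      ∫ x in Metric.ball (0 : Plane) R, timeDeriv (crackDisplacement c) s x * g x
        = ∫ x in Metric.ball (0 : Plane) R, velField c s x * g x := fun s g =>
    integral_congr_ae ((htip s).mono fun x hx => by simp only [timeDeriv_crackDisplacement hx])
  have i1 := intervalIntegrable_space (F := fun s x => ‖Ψ s x • velGradField c s x‖ ^ 2) ht
    ((memLp_viscous (p := 2) hΨ hc0 hc1 hε).integrable_norm_pow two_ne_zero)
  have i2 := intervalIntegrable_space (F := fun s x => inner ℝ (gradField c s x) (Dw' s x)) ht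
    (integrable_inner_of_memLp (memLp_gradField hR hc0 hc1 hcT) hw.space'.memLp_grad)
  have hmain : ∫ s in (0 : ℝ)..t,
      ((∫ x in Metric.ball (0 : Plane) R,
          crackForce c Ψ s x * (timeDeriv (crackDisplacement c) s x - w' s x))
        + (∫ x in Metric.ball (0 : Plane) R,
          inner ℝ (gradient (crackDisplacement c s) x) (Dw' s x))
        + ∫ x in Metric.ball (0 : Plane) R,
          inner ℝ (Ψ s x • gradient (timeDeriv (crackDisplacement c) s) x) (Ψ s x • Dw' s x))
      = (∫ s in (0 : ℝ)..t, ∫ x in Metric.ball (0 : Plane) R, ‖Ψ s x • velGradField c s x‖ ^ 2)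
        + ∫ s in (0 : ℝ)..t, ∫ x in Metric.ball (0 : Plane) R,
          inner ℝ (gradField c s x) (Dw' s x) := by
    rw [← intervalIntegral.integral_add i1 i2, intervalIntegral_eq_Ioo ht.1,
      intervalIntegral_eq_Ioo ht.1]
    refine integral_congr_ae (ae_restrict_of_ae_restrict_of_subset (Ioo_subset_Ioo_right ht.2) ?_)
    filter_upwards [ae_viscous_balance hR hT hc0 hc1 hcT hε hΨ hw htr,
      ae_restrict_Ioo_mem_Icc T] with s hs hsT
    have e1 : ∫ x in Metric.ball (0 : Plane) R,
          crackForce c Ψ s x * (timeDeriv (crackDisplacement c) s x - w' s x)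
        = ∫ x in Metric.ball (0 : Plane) R, forceField c Ψ s x * (velField c s x - w' s x) := by
      apply integral_congr_ae
      filter_upwards [htip s, hΨ.ae_differentiable hsT] with x hx hd
      rw [crackForce_eq hx hd, timeDeriv_crackDisplacement hx]
    have e2 : ∫ x in Metric.ball (0 : Plane) R,
          inner ℝ (gradient (crackDisplacement c s) x) (Dw' s x)
        = ∫ x in Metric.ball (0 : Plane) R, inner ℝ (gradField c s x) (Dw' s x) :=
      integral_congr_ae ((htip s).mono fun x hx => by simp only [gradient_crackDisplacement hx])
    have e3 : ∫ x in Metric.ball (0 : Plane) R,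
          inner ℝ (Ψ s x • gradient (timeDeriv (crackDisplacement c) s) x) (Ψ s x • Dw' s x)
        = ∫ x in Metric.ball (0 : Plane) R,
          inner ℝ (Ψ s x • velGradField c s x) (Ψ s x • Dw' s x) :=
      integral_congr_ae ((htip s).mono fun x hx => by simp only [gradient_timeDeriv hx])
    rw [e1, e2, e3, hs]
    ring
  rw [totalWork, hmain]
  simp only [hvel]

theorem energy_balance (hR : 0 < R) (hT : 0 < T) (hc0 : 0 < c) (hc1 : c < 1)
    (hcT : c * T < R) (hε : 0 < ε) (hΨ : IsAdmissibleViscosity R T c ε Ψ)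
    {w w' w'' : ℝ → Plane → ℝ} {Dw Dw' : ℝ → Plane → Plane}
    (hw : IsDirichletDatum T (Metric.ball 0 R) (crack R c 0) w w' w'' Dw Dw')
    (htr : SameTrace T (Metric.ball 0 R) (crack R c) (crackDisplacement c) w) {t : ℝ}
    (ht : t ∈ Icc 0 T) :
    energy (Metric.ball 0 R) (timeDeriv (crackDisplacement c) t)
        (gradient (crackDisplacement c t))
      + dissipation (Metric.ball 0 R) Ψ (crackDisplacement c) t + c * t
    = energy (Metric.ball 0 R) (timeDeriv (crackDisplacement c) 0)
        (gradient (crackDisplacement c 0))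
      + totalWork (Metric.ball 0 R) Ψ (crackForce c Ψ) (crackDisplacement c) w' w'' Dw' t := by
  have h := wave_energy_balance hR hT hc0 hc1 hcT hw htr ht
  rw [energy_crackDisplacement hR hc0 hc1 hcT ht,
    energy_crackDisplacement hR hc0 hc1 hcT ⟨le_rfl, hT.le⟩, dissipation_crackDisplacement,
    totalWork_crackDisplacement hR hT hc0 hc1 hcT hε hΨ hw htr ht]
  linarith

end

/-! ### The main theorem -/

theorem ae_crackForce_eq {R T c ε : ℝ} {Ψ : ℝ → Plane → ℝ}
    (hΨ : IsAdmissibleViscosity R T c ε Ψ) :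
    ∀ᵐ p ∂(cylMeasure T (Metric.ball (0 : Plane) R)),
      crackForce c Ψ p.1 p.2 = forceField c Ψ p.1 p.2 := by
  filter_upwards [hΨ.ae_cyl_differentiable, ae_cyl_coord_ne_zero T (Metric.ball 0 R)] with p hd hp
  exact crackForce_eq (tipCoord_mem_slitPlane hp) hd

end

theorem mainTheorem5 (R T c ε : ℝ) (hR : 0 < R) (hT : 0 < T) (hc0 : 0 < c) (hc1 : c < 1)
    (hcT : c * T < R) (hε0 : 0 < ε) (hε : ε < R - c * T)
    (Ψ : ℝ → Plane → ℝ) (hΨ : IsAdmissibleViscosity R T c ε Ψ)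
    (Ω : Set Plane) (hΩ : Ω = Metric.ball 0 R)
    (Γ : ℝ → Set Plane) (hΓ : Γ = crack R c)
    (u : ℝ → Plane → ℝ) (hu : u = crackDisplacement c)
    (f : ℝ → Plane → ℝ) (hf : f = crackForce c Ψ) :
    -- the forcing term belongs to `L²(0,T; L²(Ω))` and has the expanded form
    MemLp (fun p : ℝ × Plane => f p.1 p.2) 2 (cylMeasure T Ω) ∧
    (∀ᵐ p ∂(cylMeasure T Ω), f p.1 p.2 =
      -(inner ℝ (gradient (Ψ p.1) p.2)
          ((2 * Ψ p.1 p.2) • gradient (timeDeriv u p.1) p.2))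
        - Ψ p.1 p.2 ^ 2 * Laplacian.laplacian (timeDeriv u p.1) p.2) ∧
    -- the classical derivatives of `u` are its weak derivatives, and all terms of the balance
    -- are finite
    MemV T Ω Γ u (timeDeriv u) (fun t => gradient (u t)) ∧
    (∀ t ∈ Icc 0 T, MemLp (timeDeriv u t) 2 (volume.restrict Ω) ∧
      MemLp (gradient (u t)) 2 (volume.restrict Ω)) ∧
    MemLp (fun p : ℝ × Plane => Ψ p.1 p.2 • gradient (timeDeriv u p.1) p.2) 2
      (cylMeasure T Ω) ∧
    -- the initial conditions
    AttainsInitialData T Ω Γ u (initialDisplacement c) (initialVelocity c) ∧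
    -- the boundary values of `u` are those of an admissible Dirichlet datum
    (∃ (w w' w'' : ℝ → Plane → ℝ) (Dw Dw' : ℝ → Plane → Plane),
      IsDirichletDatum T Ω (Γ 0) w w' w'' Dw Dw' ∧ SameTrace T Ω Γ u w) ∧
    -- the length of the crack increment
    (∀ t ∈ Icc 0 T, Measure.hausdorffMeasure 1 (Γ t \ Γ 0) = ENNReal.ofReal (c * t)) ∧
    -- weak solution and energy-dissipation balance, for every such datum
    ∀ (w w' w'' : ℝ → Plane → ℝ) (Dw Dw' : ℝ → Plane → Plane),
      IsDirichletDatum T Ω (Γ 0) w w' w'' Dw Dw' → SameTrace T Ω Γ u w →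
      IsWeakSolution T Ω Γ Ψ f w u ∧
      ∀ t ∈ Icc 0 T,
        energy Ω (timeDeriv u t) (gradient (u t)) + dissipation Ω Ψ u t + c * t
          = energy Ω (timeDeriv u 0) (gradient (u 0))
            + totalWork Ω Ψ f u w' w'' Dw' t := by
  subst hΩ hΓ hu hf
  have hmV := (memV_crackDisplacement hR hT hc0 hc1 hcT).congr (w' := timeDeriv (crackDisplacement c))
    (Dw := fun t => gradient (crackDisplacement c t))
    (fun x hx t => (timeDeriv_crackDisplacement (tipCoord_mem_slitPlane hx)).symm)
    (fun x hx t => (gradient_crackDisplacement (tipCoord_mem_slitPlane hx)).symm)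
  have hforce := ae_crackForce_eq hΨ
  refine ⟨(memLp_forceField hΨ hc0 hc1 hε0).ae_eq (hforce.mono fun p hp => hp.symm), ?_, hmV,
    fun t ht => ?_, ?_, attainsInitialData hR hT hc0 hc1 hcT, ?_,
    fun t ht => hausdorffMeasure_crack_diff hc0 hcT ht, fun w w' w'' Dw Dw' hw htr =>
      ⟨isWeakSolution hR hT hc0 hc1 hcT hε0 hΨ hw htr,
        fun t ht => energy_balance hR hT hc0 hc1 hcT hε0 hΨ hw htr ht⟩⟩
  · filter_upwards [hforce, ae_cyl_coord_ne_zero T (Metric.ball 0 R)] with p hp hx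
    rw [hp, laplacian_timeDeriv (tipCoord_mem_slitPlane hx),
      gradient_timeDeriv (tipCoord_mem_slitPlane hx), forceField]
  · have hx := ae_restrict_of_ae (s := Metric.ball (0 : Plane) R) (ae_tipCoord_mem_slitPlane c t)
    exact ⟨(memLp_velField_at hR hc0 hc1 hcT ht).ae_eq
        (hx.mono fun x hx => (timeDeriv_crackDisplacement hx).symm),
      (memLp_gradField_at hR hc0 hc1 hcT ht).ae_eq
        (hx.mono fun x hx => (gradient_crackDisplacement hx).symm)⟩
  · refine (memLp_viscous hΨ hc0 hc1 hε0).ae_eq ?_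
    filter_upwards [ae_cyl_coord_ne_zero T (Metric.ball 0 R)] with p hx
    rw [gradient_timeDeriv (tipCoord_mem_slitPlane hx)]
  -- There is room for the cutoff because the tip never reaches the boundary circle.
  · obtain ⟨ρ, hρ1, hρ2⟩ : ∃ ρ, c * T < ρ ∧ ρ < R := exists_between hcT
    obtain ⟨θ, hθ⟩ := exists_isInnerCutoff ((mul_pos hc0 hT).trans hρ1) hρ2
    exact ⟨_, _, _, _, _, hθ.isDirichletDatum hR hT hc0 hc1 hρ1,
      hθ.sameTrace hR hT hc0 hc1 hcT hρ1⟩
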